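/- Let $V$ be a finite-dimensional real vector space, $\mathfrak k$ a compact simple real Lie algebra, $R=\mathbb R[[V^*]]$ the ring of formal power series on $V$ (with the product topology) and $\mathfrak g = R\otimes\mathfrak k$ the topological Lie algebra of formal power series with values in $\mathfrak k$, with bracket $[f\otimes X,g\otimes Y]=fg\otimes[X,Y]$. Let $\boldsymbol v$ be a formal vector field on $V$ vanishing at the origin, let $\sigma\in\mathfrak g$, and let $\mathfrak g^\sharp=\mathfrak g\rtimes_D\mathbb R\boldsymbol d$ be the semidirect product (with the product topology) defined by the derivation $D=-\mathcal L_{\boldsymbol v}+\mathrm{ad}_\sigma$, so that $[\boldsymbol d,\xi]=D\xi$ for $\xi\in\mathfrak g$. Write $\boldsymbol v=\boldsymbol v_{\mathrm l}+\boldsymbol v_{\mathrm{ho}}$, where $\boldsymbol v_{\mathrm l}\in\mathfrak{gl}(V)$ is the linearization of $\boldsymbol v$ at $0$ and $\boldsymbol v_{\mathrm{ho}}$ vanishes at $0$ to second order, and let $\boldsymbol v_{\mathrm l}=\boldsymbol v_{\mathrm{l,s}}+\boldsymbol v_{\mathrm{l,n}}$ be the Jordan decomposition over $\mathbb C$ into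 commuting semisimple and nilpotent parts. Let $V_{\mathrm c}\subseteq V$ be the intersection with $V$ of the span in $V_{\mathbb C}$ of all generalized eigenspaces of $\boldsymbol v_{\mathrm l}$ for eigenvalues with zero real part, and let $V_{\mathrm c}^\perp\subseteq V^*$ be its annihilator. For a complex pre-Hilbert space $\mathcal D$, let $\mathfrak u(\mathcal D)$ be the real Lie algebra of linear operators $X:\mathcal D\to\mathcal D$ with $\langle X\varphi,\psi\rangle=-\langle\varphi,X\psi\rangle$ for all $\varphi,\psi\in\mathcal D$, and $\mathfrak{pu}(\mathcal D)=\mathfrak u(\mathcal D)/i\mathbb R I$. A continuous projective unitary representation of a topological Lie algebra $\mathfrak h$ on $\mathcal D$ is a Lie algebra homomorphism $\overline\pi:\mathfrak h\to\mathfrak{pu}(\mathcal D)$ such that for every ray $[\psi]$ the map $\xi\mapsto\overline\pi(\xi)[\psi]\in T_{[\psi]}\mathrm P(\mathcal D)=\mathcal D/\mathbb C\psi$ is continuous. It is of generalized positive energy at $\xi\in\mathfrak h$ if there are a continuous $2$-cocycle $\omega$ on $\mathfrak h$, a homomorphism $\pi:\mathbb R\oplus_\omega\mathfrak h\to\mathfrak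 u(\mathcal D)$ lifting $\overline\pi$, with $\pi(1,0)=iI$ and with $\zeta\mapsto\pi(\zeta)\psi$ continuous for all $\psi\in\mathcal D$, an element $\hat\xi\in\mathbb R\oplus_\omega\mathfrak h$ over $\xi$, a $1$-connected locally convex Lie group $H$ (smooth in the sense of Michal-Bastiani) with Lie algebra $\mathbb R\oplus_\omega\mathfrak h$, and a dense linear subspace $\mathcal D_0\subseteq\mathcal D$ such that $\inf_{h\in H}\langle\psi,-i\pi(\mathrm{Ad}_h\hat\xi)\psi\rangle>-\infty$ for all $\psi\in\mathcal D_0$. Theorem. Let $\mathfrak t\subseteq\mathfrak k$ be a maximal abelian subalgebra. Assume that $\sigma\in R\otimes\mathfrak t$ and that $[\boldsymbol v_{\mathrm{l,s}},\boldsymbol v_{\mathrm{ho}}]=0$ as formal vector fields. Let $\overline\pi$ be a continuous projective unitary representation of $\mathfrak g^\sharp$ on a complex pre-Hilbert space $\mathcal D$ that is of generalized positive energy at $\boldsymbol d$. Then $RV_{\mathrm c}^\perp\otimes\mathfrak k\subseteq\ker\overline\pi$, where $RV_{\mathrm c}^\perp$ is the ideal of $R$ generated by $V_{\mathrm c}^\perp$.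 Consequently $\overline\pi|_{\mathfrak g}$ factors, through the restriction of formal power series from $V$ to $V_{\mathrm c}$, through a continuous projective unitary representation of $\mathbb R[[V_{\mathrm c}^*]]\otimes\mathfrak k$. In particular, if $V_{\mathrm c}=\{0\}$, then $\overline\pi|_{\mathfrak g}$ factors through the evaluation $\mathfrak g\to\mathfrak k$ at the origin. -/

import Mathlib

open Filter Topology TensorProduct

universe u v w

-- The commutator bracket on associative rings such as `ℝ` and `Module.End ℂ 𝓓`.
attribute [local instance] LieRing.ofAssociativeRing

noncomputable section

namespace JetGPE

/-! ### Calculus and Lie groups modelled on locally convex spaces -/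

section Calculus

/-- `x` is the velocity at time `0` of the curve `γ` in a topological vector space. -/
def HasVelocity {E : Type u} [AddCommGroup E] [Module ℝ E] [TopologicalSpace E]
    (γ : ℝ → E) (x : E) : Prop :=
  Tendsto (fun t : ℝ => t⁻¹ • (γ t - γ 0)) (𝓝[≠] 0) (𝓝 x)

/-- `f` is `C^n` on the open set `U` in the sense of Michal-Bastiani: `f` is continuous on `U` and,
for positive order, all directional derivatives `df (x, v)` with `x ∈ U` exist and the map `df` is
`C^(n-1)` on `U × E`. -/
def BastianiC : (n : ℕ) → {E : Type u} → [AddCommGroup E] → [Module ℝ E] → [TopologicalSpace E] →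
    {F : Type v} → [AddCommGroup F] → [Module ℝ F] → [TopologicalSpace F] →
    (f : E → F) → (U : Set E) → Prop
  | 0, _, _, _, _, _, _, _, _, f, U => ContinuousOn f U
  | n + 1, E, _, _, _, F, _, _, _, f, U => ContinuousOn f U ∧
      ∃ df : E × E → F, (∀ x ∈ U, ∀ y : E, HasVelocity (fun t : ℝ => f (x + t • y)) (df (x, y))) ∧
        BastianiC n df (U ×ˢ Set.univ)

/-- Smoothness in the sense of Michal-Bastiani. -/
def BastianiSmooth {E : Type u} [AddCommGroup E] [Module ℝ E] [TopologicalSpace E]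
    {F : Type v} [AddCommGroup F] [Module ℝ F] [TopologicalSpace F] (f : E → F) (U : Set E) : Prop :=
  ∀ n : ℕ, BastianiC n f U

variable (E : Type u) [AddCommGroup E] [Module ℝ E] [TopologicalSpace E]
variable (H : Type w) [Group H] [TopologicalSpace H] [ChartedSpace E H]

/-- `H` is a (Hausdorff) Lie group modelled on the locally convex space `E`: the changes of charts,
the multiplication and the inversion are smooth in the charts of the atlas. -/
structure IsLocallyConvexLieGroup : Prop where
  t2 : T2Space H
  topologicalGroup : IsTopologicalGroup H
  smooth_transition : ∀ e ∈ atlas E H, ∀ e' ∈ atlas E H,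
    BastianiSmooth (fun x : E => e' (e.symm x)) {x | x ∈ e.target ∧ e.symm x ∈ e'.source}
  smooth_mul : ∀ e₁ ∈ atlas E H, ∀ e₂ ∈ atlas E H, ∀ e₃ ∈ atlas E H,
    BastianiSmooth (fun p : E × E => e₃ (e₁.symm p.1 * e₂.symm p.2))
      {p | p.1 ∈ e₁.target ∧ p.2 ∈ e₂.target ∧ e₁.symm p.1 * e₂.symm p.2 ∈ e₃.source}
  smooth_inv : ∀ e₁ ∈ atlas E H, ∀ e₂ ∈ atlas E H,
    BastianiSmooth (fun x : E => e₂ ((e₁.symm x)⁻¹))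
      {x | x ∈ e₁.target ∧ (e₁.symm x)⁻¹ ∈ e₂.source}

variable {E H}

/-- The curve through the identity of `H` that is the straight line in direction `x` in the
preferred chart at the identity. This chart identifies the tangent space at the identity with `E`. -/
def lineCurve (H : Type w) [Group H] [TopologicalSpace H] [ChartedSpace E H] (x : E) (t : ℝ) : H :=
  (chartAt E (1 : H)).symm (chartAt E (1 : H) 1 + t • x)

/-- `Ad` is the adjoint action of `H` on its tangent space `E` at the identity:
`Ad g x` is the derivative at `t = 0` of `g γ(t) g⁻¹`, where `γ` is a curve with `γ(0) = 1` and
`γ'(0) = x`. -/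
def IsAdjointAction (Ad : H → E → E) : Prop :=
  ∀ (g : H) (x : E),
    HasVelocity (fun t : ℝ => chartAt E (1 : H) (g * lineCurve H x t * g⁻¹)) (Ad g x)

end Calculus

section LieAlgebraOf

variable {𝔥 : Type u} [LieRing 𝔥] [LieAlgebra ℝ 𝔥] [TopologicalSpace 𝔥]
variable {H : Type w} [Group H] [TopologicalSpace H] [ChartedSpace 𝔥 H]

/-- For a Lie group `H` modelled on (the locally convex space underlying) `𝔥`, with adjoint action
`Ad`, the Lie bracket of `H` on the tangent space at the identity, which is the derivative of `Ad`
at the identity, is the bracket of `𝔥`. -/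
def HasLieAlgebra (Ad : H → 𝔥 → 𝔥) : Prop :=
  ∀ x y : 𝔥, HasVelocity (fun t : ℝ => Ad (lineCurve H x t) y) ⁅x, y⁆

end LieAlgebraOf

/-! ### Unitary and projective unitary representations of Lie algebras -/

section Unitary

variable (𝓓 : Type v) [NormedAddCommGroup 𝓓] [InnerProductSpace ℂ 𝓓]

/-- The real Lie algebra `𝔲(𝓓)` of linear operators `X : 𝓓 → 𝓓` such that the adjoint of `X` is
defined on `𝓓` and equals `-X` there. -/
def skewOps : LieSubalgebra ℝ (Module.End ℂ 𝓓) where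
  carrier := {X | ∀ φ ψ : 𝓓, inner ℂ (X φ) ψ = - inner ℂ φ (X ψ)}
  add_mem' := by
    intro X Y hX hY φ ψ
    simp only [Set.mem_ofPred_eq] at hX hY
    simp [hX, hY, add_comm]
  zero_mem' := by intro φ ψ; simp
  smul_mem' := by
    intro r X hX φ ψ
    simp only [Set.mem_ofPred_eq] at hX
    simp only [LinearMap.smul_apply]
    rw [← Complex.coe_smul, ← Complex.coe_smul, inner_smul_left, inner_smul_right, hX]
    simp
  lie_mem' := by
    intro X Y hX hY φ ψ
    change ∀ φ ψ : 𝓓, inner ℂ (X φ) ψ = - inner ℂ φ (X ψ) at hX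
    change ∀ φ ψ : 𝓓, inner ℂ (Y φ) ψ = - inner ℂ φ (Y ψ) at hY
    simp [LieRing.of_associative_ring_bracket, hX, hY]

/-- The ideal `iℝ·I` of `𝔲(𝓓)`. -/
def imaginaryScalars : LieIdeal ℝ (skewOps 𝓓) where
  carrier := {X | ∃ r : ℝ, (X : Module.End ℂ 𝓓) = ((r : ℂ) * Complex.I) • 1}
  add_mem' := by
    rintro X Y ⟨r, hr⟩ ⟨s, hs⟩
    exact ⟨r + s, by simp [hr, hs, add_mul, add_smul]⟩
  zero_mem' := ⟨0, by simp⟩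
  smul_mem' := by
    rintro t X ⟨r, hr⟩
    refine ⟨t * r, ?_⟩
    change t • (X : Module.End ℂ 𝓓) = _
    rw [hr, ← Complex.coe_smul, smul_smul]
    simp [mul_assoc]
  lie_mem := by
    rintro X Y ⟨r, hr⟩
    refine ⟨0, ?_⟩
    simp only [LieSubalgebra.coe_bracket, hr, LieRing.of_associative_ring_bracket]
    simp

/-- `𝔭𝔲(𝓓) = 𝔲(𝓓) / iℝ·I`. -/
abbrev projSkewOps : Type v := skewOps 𝓓 ⧸ imaginaryScalars 𝓓

variable {𝓓}

/-- The infinitesimal action of `𝔭𝔲(𝓓)` at the ray through `ψ`, with values in the tangent space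
`𝓓 / ℂψ` of the projective space: the class of `X` is sent to the class of `X ψ`. -/
def rayAction (ψ : 𝓓) : projSkewOps 𝓓 →ₗ[ℝ] 𝓓 ⧸ (ℂ ∙ ψ) :=
  (imaginaryScalars 𝓓).toSubmodule.liftQ
    { toFun := fun X => (ℂ ∙ ψ).mkQ ((X : Module.End ℂ 𝓓) ψ)
      map_add' := by intro X Y; simp
      map_smul' := by intro r X; rfl }
    (by
      rintro X ⟨r, hr⟩
      change (ℂ ∙ ψ).mkQ ((X : Module.End ℂ 𝓓) ψ) = 0
      rw [hr, Submodule.mkQ_apply, Submodule.Quotient.mk_eq_zero]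
      exact Submodule.smul_mem _ _ (Submodule.mem_span_singleton_self ψ))

variable {𝔥 : Type u} [LieRing 𝔥] [LieAlgebra ℝ 𝔥] [TopologicalSpace 𝔥]

/-- Continuity of a unitary representation: all maps `ξ ↦ π(ξ)ψ` are continuous. -/
def IsContinuousRep (π : 𝔥 →ₗ⁅ℝ⁆ skewOps 𝓓) : Prop :=
  ∀ ψ : 𝓓, Continuous fun ξ : 𝔥 => (π ξ : Module.End ℂ 𝓓) ψ

/-- Continuity of a projective unitary representation: for every ray `[ψ]`, the map
`ξ ↦ π(ξ)[ψ]` to the tangent space of the projective space at `[ψ]` is continuous. -/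
def IsContinuousProjRep (π : 𝔥 →ₗ⁅ℝ⁆ projSkewOps 𝓓) : Prop :=
  ∀ ψ : 𝓓, ψ ≠ 0 → Continuous fun ξ : 𝔥 => rayAction ψ (π ξ)

/-- `π` is of generalized positive energy at `ξ`: there are a `1`-connected Lie group `H` with Lie
algebra `𝔥` and a dense subspace `𝓓₀` such that `⟨ψ, -i π(Ad_g ξ) ψ⟩` (a real number) is bounded
below in `g ∈ H` for every `ψ ∈ 𝓓₀`. -/
def IsGPE (π : 𝔥 →ₗ⁅ℝ⁆ skewOps 𝓓) (ξ : 𝔥) : Prop :=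
  ∃ (H : Type w) (_ : Group H) (_ : TopologicalSpace H) (_ : ChartedSpace 𝔥 H)
    (Ad : H → 𝔥 → 𝔥) (𝓓₀ : Submodule ℂ 𝓓),
    IsLocallyConvexLieGroup 𝔥 H ∧ SimplyConnectedSpace H ∧
    IsAdjointAction Ad ∧ HasLieAlgebra Ad ∧ Dense (𝓓₀ : Set 𝓓) ∧
    ∀ ψ ∈ 𝓓₀, BddBelow (Set.range fun g : H =>
      (inner ℂ ψ ((-Complex.I) • (π (Ad g ξ) : Module.End ℂ 𝓓) ψ)).re)

/-- Scalar `2`-cocycles of the Lie algebra `𝔥`. -/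
abbrev ScalarCocycle (𝔥 : Type u) [LieRing 𝔥] [LieAlgebra ℝ 𝔥] :=
  LieModule.Cohomology.twoCocycle ℝ 𝔥 (TrivialLieModule ℝ 𝔥 ℝ)

/-- Joint continuity of a scalar `2`-cocycle. -/
def IsContinuousCocycle (ω : ScalarCocycle 𝔥) : Prop :=
  Continuous fun p : 𝔥 × 𝔥 => TrivialLieModule.equiv ℝ 𝔥 ℝ (ω.1 p.1 p.2)

/-- The element `(ξ, z)` of the central extension of `𝔥` by `ℝ` defined by `ω`. -/
def centralMk (ω : ScalarCocycle 𝔥) (ξ : 𝔥) (z : ℝ) : LieAlgebra.ofTwoCocycle ω :=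
  LieAlgebra.ofProd ω (ξ, (TrivialLieModule.equiv ℝ 𝔥 ℝ).symm z)

/-- The central extension carries the product topology of `𝔥 × ℝ`. -/
instance centralTopology (ω : ScalarCocycle 𝔥) : TopologicalSpace (LieAlgebra.ofTwoCocycle ω) :=
  TopologicalSpace.induced
    (fun x => (x.carrier.1, TrivialLieModule.equiv ℝ 𝔥 ℝ x.carrier.2)) inferInstance

/-- `π` is a lift of the projective unitary representation `πbar` to the continuous central
extension of `𝔥` by `ℝ` defined by `ω`: a continuous unitary representation that sends the central
generator to `i·I` and covers `πbar`. -/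
structure IsLift (πbar : 𝔥 →ₗ⁅ℝ⁆ projSkewOps 𝓓) (ω : ScalarCocycle 𝔥)
    (π : LieAlgebra.ofTwoCocycle ω →ₗ⁅ℝ⁆ skewOps 𝓓) : Prop where
  continuous_cocycle : IsContinuousCocycle ω
  continuous_rep : IsContinuousRep π
  central : (π (centralMk ω 0 1) : Module.End ℂ 𝓓) = Complex.I • 1
  covers : ∀ (ξ : 𝔥) (z : ℝ), LieSubmodule.Quotient.mk (π (centralMk ω ξ z)) = πbar ξ

/-- A projective unitary representation is of generalized positive energy at `ξ` if a lift of it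
is of generalized positive energy at some element over `ξ`. -/
def IsProjGPE (πbar : 𝔥 →ₗ⁅ℝ⁆ projSkewOps 𝓓) (ξ : 𝔥) : Prop :=
  ∃ (ω : ScalarCocycle 𝔥) (π : LieAlgebra.ofTwoCocycle ω →ₗ⁅ℝ⁆ skewOps 𝓓) (z : ℝ),
    IsLift πbar ω π ∧ IsGPE.{u, v, w} π (centralMk ω ξ z)

end Unitary

/-! ### Jets and formal vector fields -/

section Jets

variable {ι : Type*} {V : Type*} [AddCommGroup V] [Module ℝ V]

/-- The Lie algebra `R ⊗ 𝔨` of formal power series with coefficients in `𝔨`, where `R` is the ring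
of formal power series in coordinates indexed by `ι`. -/
abbrev JetAlg (ι : Type*) (𝔨 : Type*) [LieRing 𝔨] [LieAlgebra ℝ 𝔨] : Type _ :=
  MvPowerSeries ι ℝ ⊗[ℝ] 𝔨

variable {𝔨 : Type*} [LieRing 𝔨] [LieAlgebra ℝ 𝔨]

/-- The coefficient in `𝔨` of `ξ ∈ R ⊗ 𝔨` at the monomial with exponent `n`. -/
def jetCoeff (n : ι →₀ ℕ) : JetAlg ι 𝔨 →ₗ[ℝ] 𝔨 :=
  (TensorProduct.lid ℝ 𝔨).toLinearMap ∘ₗ LinearMap.rTensor 𝔨 (MvPowerSeries.coeff (R := ℝ) n)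

/-- The product topology on `R ⊗ 𝔨`: the topology of convergence of all coefficients. -/
instance jetTopology [TopologicalSpace 𝔨] : TopologicalSpace (JetAlg ι 𝔨) :=
  TopologicalSpace.induced (fun ξ (n : ι →₀ ℕ) => jetCoeff n ξ) inferInstance

/-- The evaluation `R ⊗ 𝔨 → 𝔨` at the origin. -/
def jetEval : JetAlg ι 𝔨 →ₗ⁅ℝ⁆ 𝔨 :=
  { (jetCoeff 0 : JetAlg ι 𝔨 →ₗ[ℝ] 𝔨) with
    map_lie' := by
      intro x y
      induction x using TensorProduct.induction_on with
      | zero => simp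
      | add x₁ x₂ h₁ h₂ => simp_all [add_lie]
      | tmul f X =>
        induction y using TensorProduct.induction_on with
        | zero => simp
        | add y₁ y₂ h₁ h₂ => simp_all [lie_add]
        | tmul g Y => simp [jetCoeff, smul_smul, mul_comm] }

/-- The linear function `φ ∈ V*` as a formal power series in the coordinates given by `b`. -/
def linearSeries [Fintype ι] (b : Module.Basis ι ℝ V) :
    Module.Dual ℝ V →ₗ[ℝ] MvPowerSeries ι ℝ where
  toFun φ := ∑ i, φ (b i) • MvPowerSeries.X i
  map_add' := by intro φ ψ; simp [add_smul, Finset.sum_add_distrib]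
  map_smul' := by intro r φ; simp [mul_smul, Finset.smul_sum]

/-- The ideal `R W^⊥` of `R` generated by the annihilator in `V*` of a subspace `W` of `V`. -/
def annihilatorIdeal [Fintype ι] (b : Module.Basis ι ℝ V) (W : Submodule ℝ V) :
    Ideal (MvPowerSeries ι ℝ) :=
  Ideal.span (linearSeries b '' (W.dualAnnihilator : Set (Module.Dual ℝ V)))

/-- The restriction of the `i`-th coordinate of `V` to the subspace `W`, as a formal power series
on `W`. -/
def restrictedCoordinate {κ : Type*} [Fintype κ] (b : Module.Basis ι ℝ V) {W : Submodule ℝ V}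
    (c : Module.Basis κ ℝ W) (i : ι) : MvPowerSeries κ ℝ :=
  linearSeries c (b.coord i ∘ₗ W.subtype)

lemma hasSubst_restrictedCoordinate {κ : Type*} [Fintype ι] [Fintype κ] (b : Module.Basis ι ℝ V)
    {W : Submodule ℝ V} (c : Module.Basis κ ℝ W) :
    MvPowerSeries.HasSubst (restrictedCoordinate b c) :=
  MvPowerSeries.hasSubst_of_constantCoeff_zero fun i => by
    simp [restrictedCoordinate, linearSeries]

/-- Restriction of formal power series from `V` to the subspace `W`. -/
def restrictSeries {κ : Type*} [Fintype ι] [Fintype κ] (b : Module.Basis ι ℝ V)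
    {W : Submodule ℝ V} (c : Module.Basis κ ℝ W) : MvPowerSeries ι ℝ →ₐ[ℝ] MvPowerSeries κ ℝ :=
  MvPowerSeries.substAlgHom (hasSubst_restrictedCoordinate b c)

/-- Restriction `ℝ⟦V*⟧ ⊗ 𝔨 → ℝ⟦W*⟧ ⊗ 𝔨` of `𝔨`-valued formal power series. -/
def restrictJet {κ : Type*} [Fintype ι] [Fintype κ] (b : Module.Basis ι ℝ V)
    {W : Submodule ℝ V} (c : Module.Basis κ ℝ W) (𝔨 : Type*) [LieRing 𝔨] [LieAlgebra ℝ 𝔨] :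
    JetAlg ι 𝔨 →ₗ⁅ℝ⁆ JetAlg κ 𝔨 :=
  LieAlgebra.ExtendScalars.map (restrictSeries b c) LieHom.id

/-- The Lie derivative `L_v = ∑ i, v i ∂_i` on `R` along the formal vector field with components
`v i`. -/
def lieDer [Fintype ι] (v : ι → MvPowerSeries ι ℝ) :
    Derivation ℝ (MvPowerSeries ι ℝ) (MvPowerSeries ι ℝ) :=
  ∑ i, v i • MvPowerSeries.pderiv ℝ i

/-- The linear vector field on `V` defined by the endomorphism `A`. -/
def linearField [Fintype ι] [DecidableEq ι] (b : Module.Basis ι ℝ V) (A : Module.End ℝ V) :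
    ι → MvPowerSeries ι ℝ :=
  fun i => ∑ j, LinearMap.toMatrix b b A i j • MvPowerSeries.X j

/-- The linearization at the origin of a formal vector field. -/
def linearPart [Fintype ι] [DecidableEq ι] (b : Module.Basis ι ℝ V) (v : ι → MvPowerSeries ι ℝ) :
    Module.End ℝ V :=
  Matrix.toLin b b
    (Matrix.of fun i j => MvPowerSeries.coeff (R := ℝ) (Finsupp.single j 1) (v i))

/-- The higher order part of a formal vector field vanishing at the origin. -/
def higherOrderPart [Fintype ι] [DecidableEq ι] (b : Module.Basis ι ℝ V)
    (v : ι → MvPowerSeries ι ℝ) : ι → MvPowerSeries ι ℝ :=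
  v - linearField b (linearPart b v)

/-- `A = S + N` is the Jordan decomposition over `ℂ` of the endomorphism `A` (the two parts of a
real endomorphism are real). -/
structure IsJordanDecomposition (A S N : Module.End ℝ V) : Prop where
  eq_add : A = S + N
  commute : Commute S N
  semisimple : Module.End.IsSemisimple (S.baseChange ℂ : Module.End ℂ (ℂ ⊗[ℝ] V))
  nilpotent : IsNilpotent N

/-- The span in `V_ℂ` of the generalized eigenspaces of `A` for the eigenvalues with zero real
part. -/
def complexCenterSpace (A : Module.End ℝ V) : Submodule ℂ (ℂ ⊗[ℝ] V) :=
  ⨆ μ ∈ {μ : ℂ | μ.re = 0},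
    Module.End.maxGenEigenspace (A.baseChange ℂ : Module.End ℂ (ℂ ⊗[ℝ] V)) μ

/-- The center subspace of `A`, the intersection of `V` with its complex version. -/
def centerSpace (A : Module.End ℝ V) : Submodule ℝ V :=
  ((complexCenterSpace A).restrictScalars ℝ).comap (TensorProduct.mk ℝ ℂ V 1)

/-- The derivation `-L_v + ad_σ` of `R ⊗ 𝔨`. -/
def jetDerivation [Fintype ι] (v : ι → MvPowerSeries ι ℝ) (σ : JetAlg ι 𝔨) :
    LieDerivation ℝ (JetAlg ι 𝔨) (JetAlg ι 𝔨) :=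
  - Lie.Derivation.ofDerivation 𝔨 (lieDer v) + LieDerivation.ad ℝ (JetAlg ι 𝔨) σ

/-- The action of the one-dimensional Lie algebra `ℝ` generated by a derivation. -/
def oneParamAction {𝔤 : Type*} [LieRing 𝔤] [LieAlgebra ℝ 𝔤] (D : LieDerivation ℝ 𝔤 𝔤) :
    ℝ →ₗ⁅ℝ⁆ LieDerivation ℝ 𝔤 𝔤 :=
  { LinearMap.toSpanSingleton ℝ (LieDerivation ℝ 𝔤 𝔤) D with
    map_lie' := by
      intro s t
      simp [LieRing.of_associative_ring_bracket, mul_comm] }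

/-- A semidirect sum of topological Lie algebras carries the product topology. -/
instance semidirectTopology {𝔤 𝔭 : Type*} [LieRing 𝔤] [LieAlgebra ℝ 𝔤] [LieRing 𝔭] [LieAlgebra ℝ 𝔭]
    [TopologicalSpace 𝔤] [TopologicalSpace 𝔭] (D : 𝔭 →ₗ⁅ℝ⁆ LieDerivation ℝ 𝔤 𝔤) :
    TopologicalSpace (LieAlgebra.SemiDirectSum 𝔤 𝔭 D) :=
  TopologicalSpace.induced (fun x => (x.left, x.right)) inferInstance

/-- The Lie algebra `(R ⊗ 𝔨) ⋊_D ℝ` with `D = -L_v + ad_σ`. -/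
abbrev JetSharp [Fintype ι] (v : ι → MvPowerSeries ι ℝ) (σ : JetAlg ι 𝔨) : Type _ :=
  LieAlgebra.SemiDirectSum (JetAlg ι 𝔨) ℝ (oneParamAction (jetDerivation v σ))

/-- The inclusion of `R ⊗ 𝔨` in `(R ⊗ 𝔨) ⋊_D ℝ`. -/
def jetIncl [Fintype ι] (v : ι → MvPowerSeries ι ℝ) (σ : JetAlg ι 𝔨) :
    JetAlg ι 𝔨 →ₗ⁅ℝ⁆ JetSharp v σ :=
  LieAlgebra.SemiDirectSum.inl (oneParamAction (jetDerivation v σ))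

/-- The generator `d = (0, 1)` of `(R ⊗ 𝔨) ⋊_D ℝ`. -/
def jetGenerator [Fintype ι] (v : ι → MvPowerSeries ι ℝ) (σ : JetAlg ι 𝔨) : JetSharp v σ :=
  LieAlgebra.SemiDirectSum.inr (oneParamAction (jetDerivation v σ)) 1

/-- A compact simple real Lie algebra: finite-dimensional, simple, with negative definite Killing
form. -/
structure IsCompactSimple (𝔨 : Type*) [LieRing 𝔨] [LieAlgebra ℝ 𝔨] : Prop where
  finite : Module.Finite ℝ 𝔨
  simple : LieAlgebra.IsSimple ℝ 𝔨
  killing_neg : ∀ X : 𝔨, X ≠ 0 → killingForm ℝ 𝔨 X X < 0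

end Jets

end JetGPE

end

/-!
Let `π` be a lift of `πbar` to a central extension. An expectation value `-i ⟨ψ, π(·) ψ⟩` is
continuous, hence factors through a finite-dimensional quotient (finitely many Taylor coefficients
together with `d` and the center). There the adjoint action along a curve in the group solves a
linear ODE, and Euler products of group elements approximate `exp (t ad x)`. If `[x, [x, y]] = 0`,
the expectation along `exp (t ad x) y` is the affine function `t ↦ l y + t l [x, y]`; being
bounded below on the adjoint orbit of `y` forces `l [x, y] = 0`, and therefore `π [x, y] = 0`.

Take `y` over `d` and `x` over `g ⊗ H`, where `H` commutes with `σ`. Then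
`[g ⊗ H, d] = L_v g ⊗ H`, and the double bracket is the central element `β (g, L_v g)` with
`β (f, g) = ω (f ⊗ H, g ⊗ H)`. So `πbar` kills `L_v g ⊗ H` as soon as `β (g, L_v g) = 0`.

The cocycle identity makes `L_v` skew for `β`, and `β` depends on finitely many Taylor
coefficients. The annihilator of `V_c` is the sum of the part on which `q(v_l) = 0` for a `q`
whose roots have positive real part and the part with `q(-v_l) = 0`. Since `v_{l,s}` commutes with
`v_ho`, the operator `L_v - L_{v_{l,s}}` is nilpotent modulo any power of the maximal ideal, so
these two parts lie in `L_v`-invariant spaces annihilated by such polynomials in `L_v` up to high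
order. As `q(T)` and `q(-T)` are coprime, `β` vanishes on each of the two spaces, and as
`q(0) ≠ 0`, `L_v` is invertible there. Hence linear forms on `V` vanishing on `V_c` are, up to
high order, sums of `L_v g` with `β (g, L_v g) = 0`. Continuity of `πbar` disposes of the
high-order terms, and simplicity of `𝔨` spreads the vanishing from `H` to the whole ideal.
-/

namespace JetGPE

/-! ### Calculus in locally convex spaces -/

section Velocity

variable {E : Type*} [AddCommGroup E] [Module ℝ E] [TopologicalSpace E]
variable {F : Type*} [AddCommGroup F] [Module ℝ F] [TopologicalSpace F]

lemma HasVelocity.congr {γ γ' : ℝ → E} {x : E} (h : HasVelocity γ x) (he : γ =ᶠ[𝓝 0] γ') :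
    HasVelocity γ' x := by
  refine Tendsto.congr' ?_ h
  filter_upwards [he.filter_mono nhdsWithin_le_nhds] with t ht
  rw [ht, he.self_of_nhds]

lemma HasVelocity.unique [T2Space E] {γ : ℝ → E} {x y : E} (hx : HasVelocity γ x)
    (hy : HasVelocity γ y) : x = y :=
  tendsto_nhds_unique hx hy

lemma hasVelocity_const (x : E) : HasVelocity (fun _ : ℝ => x) 0 := by
  simpa [HasVelocity] using tendsto_const_nhds

lemma hasVelocity_line [ContinuousAdd E] (x y : E) :
    HasVelocity (fun t : ℝ => x + t • y) y := by
  refine Tendsto.congr' ?_ tendsto_const_nhds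
  filter_upwards [self_mem_nhdsWithin] with t (ht : t ≠ 0)
  simp [smul_smul, ht]

lemma HasVelocity.prodMk {γ : ℝ → E} {γ' : ℝ → F} {x : E} {y : F} (hx : HasVelocity γ x)
    (hy : HasVelocity γ' y) : HasVelocity (fun t => (γ t, γ' t)) (x, y) :=
  Tendsto.prodMk_nhds hx hy

lemma HasVelocity.const_smul [ContinuousConstSMul ℝ E] {γ : ℝ → E} {x : E} (h : HasVelocity γ x)
    (a : ℝ) : HasVelocity (fun t => a • γ t) (a • x) := by
  refine (Tendsto.const_smul h a).congr fun t => ?_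
  rw [← smul_sub, smul_comm]

lemma HasVelocity.comp_mul_right [ContinuousConstSMul ℝ E] {γ : ℝ → E} {x : E}
    (h : HasVelocity γ x) {a : ℝ} (ha : a ≠ 0) : HasVelocity (fun t => γ (t * a)) (a • x) := by
  have hlim : Tendsto (fun t : ℝ => t * a) (𝓝[≠] 0) (𝓝[≠] 0) := by
    refine tendsto_nhdsWithin_iff.mpr ⟨?_, ?_⟩
    · exact ((continuous_mul_const a).tendsto' 0 0 (zero_mul a)).mono_left nhdsWithin_le_nhds
    · filter_upwards [self_mem_nhdsWithin] with t ht using mul_ne_zero ht ha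
  refine ((Tendsto.comp h hlim).const_smul a).congr fun t => ?_
  simp [smul_smul, ha]

lemma HasVelocity.continuousAt [IsTopologicalAddGroup E] [ContinuousSMul ℝ E] {γ : ℝ → E} {x : E}
    (h : HasVelocity γ x) : ContinuousAt γ 0 := by
  rw [continuousAt_iff_punctured_nhds]
  have hlim : Tendsto (fun t : ℝ => t • (t⁻¹ • (γ t - γ 0)) + γ 0) (𝓝[≠] 0)
      (𝓝 ((0 : ℝ) • x + γ 0)) :=
    ((tendsto_nhdsWithin_of_tendsto_nhds tendsto_id).smul h).add tendsto_const_nhds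
  rw [zero_smul, zero_add] at hlim
  refine hlim.congr' ?_
  filter_upwards [self_mem_nhdsWithin] with t (ht : t ≠ 0)
  simp [smul_smul, ht]

lemma HasVelocity.hasDerivAt {γ : ℝ → E} {r : ℝ} {x : E} (h : HasVelocity (fun t => γ (r + t)) x)
    {G : Type*} [NormedAddCommGroup G] [NormedSpace ℝ G] (L : E →L[ℝ] G) :
    HasDerivAt (fun t => L (γ t)) (L x) r := by
  rw [hasDerivAt_iff_tendsto_slope_zero]
  refine ((L.continuous.tendsto x).comp h).congr fun t => ?_
  simp

/-- A functional separating `γ 1 - γ 0` from `K` would violate the scalar mean value theorem. -/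
lemma sub_mem_of_hasVelocity_mem [IsTopologicalAddGroup F] [ContinuousSMul ℝ F]
    [LocallyConvexSpace ℝ F] {γ γ' : ℝ → F} {K : Set F} (hK : Convex ℝ K) (hKc : IsClosed K)
    (hγ : ∀ r ∈ Set.Icc (0 : ℝ) 1, HasVelocity (fun s => γ (r + s)) (γ' r))
    (hmem : ∀ r ∈ Set.Icc (0 : ℝ) 1, γ' r ∈ K) : γ 1 - γ 0 ∈ K := by
  by_contra hnot
  obtain ⟨L, u, hLK, hL⟩ := geometric_hahn_banach_closed_point hK hKc hnot
  have hderiv : ∀ r ∈ Set.Icc (0 : ℝ) 1, HasDerivAt (fun r => L (γ r)) (L (γ' r)) r :=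
    fun r hr => (hγ r hr).hasDerivAt L
  obtain ⟨r, hr, hslope⟩ := exists_hasDerivAt_eq_slope (fun r => L (γ r)) (fun r => L (γ' r))
    zero_lt_one (fun r hr => (hderiv r hr).continuousAt.continuousWithinAt)
    (fun r hr => hderiv r (Set.Ioo_subset_Icc_self hr))
  have hlt := hLK _ (hmem r (Set.Ioo_subset_Icc_self hr))
  rw [hslope, sub_zero, div_one, ← map_sub] at hlt
  exact hlt.not_gt hL

lemma exists_isClosed_convex_mem_nhds_subset [IsTopologicalAddGroup F] [ContinuousSMul ℝ F]
    [LocallyConvexSpace ℝ F] {x : F} {U : Set F} (hU : U ∈ 𝓝 x) :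
    ∃ K ∈ 𝓝 x, IsClosed K ∧ Convex ℝ K ∧ K ⊆ U := by
  obtain ⟨C, hC, hCc, hCU⟩ := exists_mem_nhds_isClosed_subset hU
  obtain ⟨K, ⟨hK, hKconv⟩, hKC⟩ := (LocallyConvexSpace.convex_basis (𝕜 := ℝ) x).mem_iff.mp hC
  exact ⟨closure K, mem_of_superset hK subset_closure, isClosed_closure, hKconv.closure,
    (closure_minimal hKC hCc).trans hCU⟩

/-- `df` is a continuous directional derivative of `f` on `U`, as in the recursion that defines
Michal-Bastiani differentiability. -/
structure IsDirDeriv (f : E → F) (df : E × E → F) (U : Set E) : Prop where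
  velocity : ∀ x ∈ U, ∀ y : E, HasVelocity (fun t : ℝ => f (x + t • y)) (df (x, y))
  continuousOn : ContinuousOn df (U ×ˢ Set.univ)

lemma BastianiSmooth.exists_isDirDeriv {E : Type u} [AddCommGroup E] [Module ℝ E]
    [TopologicalSpace E] {F : Type v} [AddCommGroup F] [Module ℝ F] [TopologicalSpace F]
    {f : E → F} {U : Set E} (h : BastianiSmooth f U) :
    ∃ (df : E × E → F) (ddf : (E × E) × E × E → F),
      IsDirDeriv f df U ∧ IsDirDeriv df ddf (U ×ˢ Set.univ) := by
  obtain ⟨-, df, hdf, hdfc, ddf, hddf, hddfc⟩ := h 2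
  exact ⟨df, ddf, ⟨hdf, hdfc⟩, ⟨hddf, hddfc⟩⟩

lemma IsDirDeriv.inv_smul_sub_mem [IsTopologicalAddGroup F] [ContinuousSMul ℝ F]
    [LocallyConvexSpace ℝ F] {f : E → F} {df : E × E → F} {U : Set E} (hf : IsDirDeriv f df U)
    {K : Set F} (hK : Convex ℝ K) (hKc : IsClosed K) {x y : E} {t : ℝ} (ht : t ≠ 0)
    (hU : ∀ r ∈ Set.Icc (0 : ℝ) 1, x + (r * t) • y ∈ U)
    (hmem : ∀ r ∈ Set.Icc (0 : ℝ) 1, df (x + (r * t) • y, y) ∈ K) :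
    t⁻¹ • (f (x + t • y) - f x) ∈ K := by
  have h := sub_mem_of_hasVelocity_mem (γ := fun r => t⁻¹ • f (x + (r * t) • y)) hK hKc
    (fun r hr => ?_) hmem
  · simpa [smul_sub] using h
  · have hvel := ((hf.velocity _ (hU r hr) y).comp_mul_right ht).const_smul t⁻¹
    simpa only [add_assoc, ← add_smul, ← add_mul, inv_smul_smul₀ ht] using hvel

theorem IsDirDeriv.comp_hasVelocity [IsTopologicalAddGroup E] [ContinuousSMul ℝ E]
    [IsTopologicalAddGroup F] [ContinuousSMul ℝ F] [LocallyConvexSpace ℝ F]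
    {f : E → F} {df : E × E → F} {U : Set E} (hf : IsDirDeriv f df U) (hU : IsOpen U)
    {c : ℝ → E} {w : E} (hc : HasVelocity c w) (h0 : c 0 ∈ U) :
    HasVelocity (fun t => f (c t)) (df (c 0, w)) := by
  intro N hN
  obtain ⟨K, hK, hKc, hKconv, hKN⟩ := exists_isClosed_convex_mem_nhds_subset hN
  have hline : Tendsto (fun p : ℝ × E => (c 0 + p.1 • p.2, p.2)) (𝓝 0 ×ˢ 𝓝 w) (𝓝 (c 0, w)) := by
    rw [← nhds_prod_eq]
    exact (by fun_prop : Continuous fun p : ℝ × E => (c 0 + p.1 • p.2, p.2)).tendsto' _ _ (by simp)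
  have hnear : ∀ᶠ p in 𝓝 (c 0, w), p.1 ∈ U ∧ df p ∈ K :=
    (continuousAt_fst.eventually_mem (hU.mem_nhds h0)).and
      ((hf.continuousOn.continuousAt ((hU.prod isOpen_univ).mem_nhds ⟨h0, trivial⟩)).eventually hK)
  obtain ⟨P, hP, Q, hQ, hPQ⟩ := eventually_prod_iff.mp (hline.eventually hnear)
  obtain ⟨δ, hδ, hδP⟩ := Metric.eventually_nhds_iff.mp hP
  have hsmall : ∀ᶠ t : ℝ in 𝓝[≠] 0, dist t 0 < δ :=
    nhdsWithin_le_nhds (Metric.ball_mem_nhds 0 hδ)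
  change ∀ᶠ t : ℝ in 𝓝[≠] 0, t⁻¹ • (f (c t) - f (c 0)) ∈ N
  filter_upwards [hsmall, hc.eventually hQ, self_mem_nhdsWithin] with t ht hQt (ht0 : t ≠ 0)
  have hseg : ∀ r ∈ Set.Icc (0 : ℝ) 1, P (r * t) := by
    refine fun r hr => hδP (lt_of_le_of_lt ?_ ht)
    rw [dist_zero_right, dist_zero_right, norm_mul, Real.norm_of_nonneg hr.1]
    exact mul_le_of_le_one_left (norm_nonneg t) hr.2
  have hmem := hf.inv_smul_sub_mem (y := t⁻¹ • (c t - c 0)) hKconv hKc ht0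
    (fun r hr => (hPQ (hseg r hr) hQt).1) (fun r hr => (hPQ (hseg r hr) hQt).2)
  rw [smul_inv_smul₀ ht0, add_sub_cancel] at hmem
  exact hKN hmem

end Velocity

/-! ### The adjoint action in charts -/

section AdjointAction

section Charts

variable {E : Type u} [TopologicalSpace E] {H : Type w} [Group H] [TopologicalSpace H]

/-- The multiplication of `H` read in the charts `e₁`, `e₂` of the factors and `e₃` of the
product. -/
def mulChart (e₁ e₂ e₃ : OpenPartialHomeomorph H E) (p : E × E) : E :=
  e₃ (e₁.symm p.1 * e₂.symm p.2)

/-- The open set on which `mulChart e₁ e₂ e₃` reads the multiplication; outside of it the value of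
`mulChart` is junk. -/
def mulDom (e₁ e₂ e₃ : OpenPartialHomeomorph H E) : Set (E × E) :=
  {p | p.1 ∈ e₁.target ∧ p.2 ∈ e₂.target ∧ e₁.symm p.1 * e₂.symm p.2 ∈ e₃.source}

/-- The inversion of `H` read in the chart `e`. -/
def invChart (e : OpenPartialHomeomorph H E) (x : E) : E := e (e.symm x)⁻¹

/-- The open set on which `invChart e` reads the inversion. -/
def invDom (e : OpenPartialHomeomorph H E) : Set E :=
  {x | x ∈ e.target ∧ (e.symm x)⁻¹ ∈ e.source}

lemma isOpen_mulDom [IsTopologicalGroup H] (e₁ e₂ e₃ : OpenPartialHomeomorph H E) :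
    IsOpen (mulDom e₁ e₂ e₃) := by
  have hc : ContinuousOn (fun p : E × E => e₁.symm p.1 * e₂.symm p.2) (e₁.target ×ˢ e₂.target) :=
    (e₁.continuousOn_symm.comp continuousOn_fst fun p hp => hp.1).mul
      (e₂.continuousOn_symm.comp continuousOn_snd fun p hp => hp.2)
  have := hc.isOpen_inter_preimage (e₁.open_target.prod e₂.open_target) e₃.open_source
  convert this using 1
  ext p
  simp [mulDom, and_assoc]

lemma isOpen_invDom [IsTopologicalGroup H] (e : OpenPartialHomeomorph H E) :
    IsOpen (invDom e) :=
  (e.continuousOn_symm.inv).isOpen_inter_preimage e.open_target e.open_source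

lemma eventually_mem_of_chart [ChartedSpace E H] {c : ℝ → E} (hc : ContinuousAt c 0)
    (h0 : c 0 = chartAt E (1 : H) 1) {s : Set H} (hs : s ∈ 𝓝 (1 : H)) :
    ∀ᶠ t in 𝓝 0, (chartAt E (1 : H)).symm (c t) ∈ s := by
  have h1 : ContinuousAt (chartAt E (1 : H)).symm (c 0) := by
    rw [h0]
    exact (chartAt E (1 : H)).continuousAt_symm (mem_chart_target E 1)
  have h2 := h1.comp hc
  refine h2.eventually_mem ?_
  simpa [h0, mem_chart_source] using hs

end Charts

variable {E : Type u} [AddCommGroup E] [Module ℝ E] [TopologicalSpace E]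
variable {H : Type w} [Group H] [TopologicalSpace H] [ChartedSpace E H]

lemma lineCurve_zero (x : E) : lineCurve H x 0 = 1 := by
  simp [lineCurve]

variable [IsTopologicalAddGroup E] [ContinuousSMul ℝ E]

lemma mulChart_dirDeriv_one [T2Space E] {dm : (E × E) × E × E → E}
    (hm : IsDirDeriv
      (mulChart (chartAt E (1 : H)) (chartAt E (1 : H)) (chartAt E (1 : H))) dm
      (mulDom (chartAt E (1 : H)) (chartAt E (1 : H)) (chartAt E (1 : H)))) (x : E) :
    dm ((chartAt E (1 : H) 1, chartAt E (1 : H) 1), (x, 0)) = x := by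
  set φ := chartAt E (1 : H)
  have hφ : (1 : H) ∈ φ.source := mem_chart_source E 1
  have hl : HasVelocity (fun t : ℝ => φ 1 + t • x) x := hasVelocity_line _ _
  refine (hm.velocity (φ 1, φ 1) (by simp [mulDom, hφ]) (x, 0)).unique (hl.congr ?_)
  have htarget : ∀ᶠ t : ℝ in 𝓝 0, φ 1 + t • x ∈ φ.target :=
    hl.continuousAt.eventually_mem (φ.open_target.mem_nhds (by simp [hφ]))
  filter_upwards [htarget] with t ht
  simp [mulChart, hφ, ht]

variable [LocallyConvexSpace ℝ E] (hH : IsLocallyConvexLieGroup E H)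
variable {Ad : H → E → E} (hAd : IsAdjointAction Ad)

include hH in
lemma hasVelocity_chart_conj {e₁ e₂ : OpenPartialHomeomorph H E} {g : H} (hg₁ : g ∈ e₁.source)
    (hg₂ : g⁻¹ ∈ e₂.source) {dm₁ dm₂ : (E × E) × E × E → E}
    (h₁ : IsDirDeriv (mulChart e₁ (chartAt E (1 : H)) e₁) dm₁ (mulDom e₁ (chartAt E (1 : H)) e₁))
    (h₂ : IsDirDeriv (mulChart e₁ e₂ (chartAt E (1 : H))) dm₂ (mulDom e₁ e₂ (chartAt E (1 : H))))
    {c : ℝ → E} {w : E} (hc : HasVelocity c w) (h0 : c 0 = chartAt E (1 : H) 1) :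
    HasVelocity (fun t => chartAt E (1 : H) (g * (chartAt E (1 : H)).symm (c t) * g⁻¹))
      (dm₂ ((e₁ g, e₂ g⁻¹), (dm₁ ((e₁ g, chartAt E (1 : H) 1), (0, w)), 0))) := by
  have := hH.topologicalGroup
  set φ := chartAt E (1 : H)
  have hφ : (1 : H) ∈ φ.source := mem_chart_source E 1
  have ha := h₁.comp_hasVelocity (isOpen_mulDom _ _ _) ((hasVelocity_const (e₁ g)).prodMk hc)
    (by simp [mulDom, h0, hφ, hg₁])
  have ha0 : mulChart e₁ φ e₁ (e₁ g, c 0) = e₁ g := by simp [mulChart, h0, hφ, hg₁]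
  have hb := h₂.comp_hasVelocity (isOpen_mulDom _ _ _)
    (ha.prodMk (hasVelocity_const (e₂ g⁻¹))) (by simp [ha0, mulDom, hφ, hg₁, hg₂])
  rw [ha0, h0] at hb
  refine hb.congr ?_
  have hs : (fun k => g * k) ⁻¹' e₁.source ∈ 𝓝 (1 : H) :=
    (continuous_const_mul g).continuousAt.preimage_mem_nhds
      (e₁.open_source.mem_nhds (by simpa using hg₁))
  filter_upwards [eventually_mem_of_chart hc.continuousAt h0 hs] with t ht
  have ht : g * φ.symm (c t) ∈ e₁.source := ht
  simp [mulChart, hg₁, hg₂, ht]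

variable [T2Space E]

include hH hAd in
lemma hasVelocity_conj (g : H) {c : ℝ → E} {w : E} (hc : HasVelocity c w)
    (h0 : c 0 = chartAt E (1 : H) 1) :
    HasVelocity (fun t => chartAt E (1 : H) (g * (chartAt E (1 : H)).symm (c t) * g⁻¹))
      (Ad g w) := by
  obtain ⟨dm₁, -, h₁, -⟩ := BastianiSmooth.exists_isDirDeriv
    (hH.smooth_mul _ (chart_mem_atlas E g) _ (chart_mem_atlas E 1) _ (chart_mem_atlas E g))
  obtain ⟨dm₂, -, h₂, -⟩ := BastianiSmooth.exists_isDirDeriv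
    (hH.smooth_mul _ (chart_mem_atlas E g) _ (chart_mem_atlas E g⁻¹) _ (chart_mem_atlas E 1))
  have key := fun {c : ℝ → E} {w : E} => hasVelocity_chart_conj hH (c := c) (w := w)
    (mem_chart_source E g) (mem_chart_source E g⁻¹) h₁ h₂
  have h := (key (hasVelocity_line (chartAt E (1 : H) 1) w) (by simp)).unique (hAd g w)
  rw [← h]
  exact key hc h0

omit [LocallyConvexSpace ℝ E] in
include hAd in
lemma adjointAction_one (y : E) : Ad 1 y = y := by
  set φ := chartAt E (1 : H) with hφ
  have hc : Continuous fun t : ℝ => φ 1 + t • y := by fun_prop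
  have htarget : ∀ᶠ t : ℝ in 𝓝 0, φ 1 + t • y ∈ φ.target :=
    hc.continuousAt.eventually_mem (φ.open_target.mem_nhds (by simp [φ]))
  refine ((hAd 1 y).congr ?_).unique (hasVelocity_line (φ 1) y)
  filter_upwards [htarget] with t ht
  simp [lineCurve, ← hφ, ht]

include hH hAd in
lemma adjointAction_mul (g k : H) (y : E) : Ad (g * k) y = Ad g (Ad k y) := by
  have := hH.topologicalGroup
  have h0 : chartAt E (1 : H) (k * lineCurve H y 0 * k⁻¹) = chartAt E (1 : H) 1 := by
    simp [lineCurve_zero]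
  have h := hasVelocity_conj hH hAd g (hAd k y) h0
  refine (hAd (g * k) y).unique (h.congr ?_)
  have hs : (fun q => k * q * k⁻¹) ⁻¹' (chartAt E (1 : H)).source ∈ 𝓝 (1 : H) := by
    have hcont : Continuous fun q : H => k * q * k⁻¹ := by fun_prop
    exact hcont.continuousAt.preimage_mem_nhds
      ((chartAt E (1 : H)).open_source.mem_nhds (by simp))
  have hl := (hasVelocity_line (chartAt E (1 : H) 1) y).continuousAt
  filter_upwards [eventually_mem_of_chart hl (by simp) hs] with t ht
  have ht : k * lineCurve H y t * k⁻¹ ∈ (chartAt E (1 : H)).source := ht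
  simp only [(chartAt E (1 : H)).left_inv ht]
  simp only [mul_assoc, mul_inv_rev]

include hH hAd in
lemma iterate_adjointAction (g : H) (y : E) (k : ℕ) : (Ad g)^[k] y = Ad (g ^ k) y := by
  induction k with
  | zero => simp [adjointAction_one hAd]
  | succ k ih => rw [Function.iterate_succ_apply', ih, pow_succ', adjointAction_mul hH hAd]

include hH hAd in
lemma exists_hasVelocity_adjointAction (y : E) :
    ∃ G : E → E, ∀ (u : ℝ → E) (w : E), HasVelocity u w → u 0 = chartAt E (1 : H) 1 →
      HasVelocity (fun t => Ad ((chartAt E (1 : H)).symm (u t)) y) (G w) := by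
  have := hH.topologicalGroup
  obtain ⟨dm, ddm, hm, hdm⟩ := BastianiSmooth.exists_isDirDeriv
    (hH.smooth_mul _ (chart_mem_atlas E 1) _ (chart_mem_atlas E 1) _ (chart_mem_atlas E 1))
  obtain ⟨di, -, hi, -⟩ := BastianiSmooth.exists_isDirDeriv
    (hH.smooth_inv _ (chart_mem_atlas E 1) _ (chart_mem_atlas E 1))
  set φ := chartAt E (1 : H)
  have hφ : (1 : H) ∈ φ.source := mem_chart_source E 1
  refine ⟨fun w => ddm (((φ 1, φ 1), (dm ((φ 1, φ 1), (0, y)), 0)),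
    ((w, di (φ 1, w)), (ddm (((φ 1, φ 1), (0, y)), ((w, 0), (0, 0))), 0))), ?_⟩
  intro u w hu h0
  have hO : IsOpen (mulDom φ φ φ ×ˢ (Set.univ : Set (E × E))) :=
    (isOpen_mulDom φ φ φ).prod isOpen_univ
  have h1 : HasVelocity (fun t => dm ((u t, φ 1), (0, y))) _ := hdm.comp_hasVelocity hO
    ((hu.prodMk (hasVelocity_const (φ 1))).prodMk (hasVelocity_const ((0 : E), y)))
    (by simp [h0, hφ])
  have h2 : HasVelocity (fun t => invChart φ (u t)) _ := hi.comp_hasVelocity (isOpen_invDom φ)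
    hu (by simp [h0, hφ])
  have hi0 : invChart φ (u 0) = φ 1 := by simp [invChart, h0, hφ]
  have h3 := hdm.comp_hasVelocity hO
    ((hu.prodMk h2).prodMk (h1.prodMk (hasVelocity_const (0 : E))))
    (by simp [h0, hφ, show invChart φ (φ 1) = φ 1 by simp [invChart, hφ]])
  rw [hi0, h0] at h3
  refine h3.congr ?_
  have hs : (fun k : H => k⁻¹) ⁻¹' φ.source ∈ 𝓝 (1 : H) :=
    continuous_inv.continuousAt.preimage_mem_nhds (φ.open_source.mem_nhds (by simpa using hφ))
  have ht0 : ∀ᶠ t in 𝓝 0, u t ∈ φ.target :=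
    hu.continuousAt.eventually_mem (φ.open_target.mem_nhds (by simp [h0, hφ]))
  filter_upwards [eventually_mem_of_chart hu.continuousAt h0 hs, ht0] with t ht ht'
  have ht : (φ.symm (u t))⁻¹ ∈ φ.source := ht
  have := hasVelocity_chart_conj hH (φ.map_target ht') ht hm hm
    (hasVelocity_line (φ 1) y) (by simp [φ])
  simpa [φ.right_inv ht', invChart] using this.unique (hAd (φ.symm (u t)) y)

end AdjointAction

section LieAlgebraOf

variable {E : Type u} [LieRing E] [LieAlgebra ℝ E] [TopologicalSpace E]
variable {H : Type w} [Group H] [TopologicalSpace H] [ChartedSpace E H]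
variable [IsTopologicalAddGroup E] [ContinuousSMul ℝ E] [T2Space E]
variable [LocallyConvexSpace ℝ E] (hH : IsLocallyConvexLieGroup E H)
variable {Ad : H → E → E} (hAd : IsAdjointAction Ad) (hLie : HasLieAlgebra Ad)

include hH hAd hLie

lemma hasVelocity_adjointAction (y : E) {u : ℝ → E} {w : E} (hu : HasVelocity u w)
    (h0 : u 0 = chartAt E (1 : H) 1) :
    HasVelocity (fun t => Ad ((chartAt E (1 : H)).symm (u t)) y) ⁅w, y⁆ := by
  obtain ⟨G, hG⟩ := exists_hasVelocity_adjointAction hH hAd y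
  have h : G w = ⁅w, y⁆ :=
    (hG _ w (hasVelocity_line (chartAt E (1 : H) 1) w) (by simp)).unique (hLie w y)
  rw [← h]
  exact hG u w hu h0

/-- With `γ = lineCurve H x`, one has `Ad (γ (s + r)) = Ad (γ (s + r) (γ s)⁻¹) ∘ Ad (γ s)`, and the
first factor moves through the identity with the velocity given by `dm`. -/
lemma hasVelocity_adjointAction_lineCurve {dm : (E × E) × E × E → E}
    (hm : IsDirDeriv
      (mulChart (chartAt E (1 : H)) (chartAt E (1 : H)) (chartAt E (1 : H))) dm
      (mulDom (chartAt E (1 : H)) (chartAt E (1 : H)) (chartAt E (1 : H))))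
    {x : E} {s : ℝ} (hs : chartAt E (1 : H) 1 + s • x ∈ invDom (chartAt E (1 : H))) (y : E) :
    HasVelocity (fun r => Ad (lineCurve H x (s + r)) y)
      ⁅dm ((chartAt E (1 : H) 1 + s • x,
          invChart (chartAt E (1 : H)) (chartAt E (1 : H) 1 + s • x)), (x, 0)),
        Ad (lineCurve H x s) y⁆ := by
  have := hH.topologicalGroup
  set φ := chartAt E (1 : H) with hφdef
  have hφ : (1 : H) ∈ φ.source := mem_chart_source E 1
  set p := (φ 1 + s • x, invChart φ (φ 1 + s • x))
  have hp0 : p ∈ mulDom φ φ φ := by simp [p, mulDom, invChart, hs.1, hs.2, hφ]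
  have hu : HasVelocity (fun r : ℝ => mulChart φ φ φ (p + r • ((x, 0) : E × E))) _ :=
    hm.velocity _ hp0 (x, 0)
  refine (hasVelocity_adjointAction hH hAd hLie (Ad (lineCurve H x s) y) hu ?_).congr ?_
  · simp [p, mulChart, invChart, hs.2, ← hφdef]
  · have hcont : Continuous fun r : ℝ => p + r • ((x, 0) : E × E) := by fun_prop
    have hev := hcont.continuousAt.eventually_mem (x := 0) (s := mulDom φ φ φ)
      (by simpa using (isOpen_mulDom φ φ φ).mem_nhds hp0)
    filter_upwards [hev] with r hr
    rw [← adjointAction_mul hH hAd, mulChart, ← hφdef, φ.left_inv hr.2.2]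
    congr 1
    simp [p, invChart, hs.2, lineCurve, add_smul, add_assoc, ← hφdef]

theorem exists_logarithmicDerivative (x : E) :
    ∃ δ : ℝ → E, ContinuousAt δ 0 ∧ δ 0 = x ∧ ∀ᶠ s in 𝓝 (0 : ℝ), ∀ y : E,
      HasVelocity (fun r => Ad (lineCurve H x (s + r)) y) ⁅δ s, Ad (lineCurve H x s) y⁆ := by
  have := hH.topologicalGroup
  obtain ⟨dm, -, hm, -⟩ := BastianiSmooth.exists_isDirDeriv
    (hH.smooth_mul _ (chart_mem_atlas E 1) _ (chart_mem_atlas E 1) _ (chart_mem_atlas E 1))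
  have hi : ContinuousOn (invChart (chartAt E (1 : H))) (invDom (chartAt E (1 : H))) :=
    hH.smooth_inv _ (chart_mem_atlas E 1) _ (chart_mem_atlas E 1) 0
  set φ := chartAt E (1 : H)
  have hφ : (1 : H) ∈ φ.source := mem_chart_source E 1
  have hl : Continuous fun s : ℝ => φ 1 + s • x := by fun_prop
  have hinv : ContinuousAt (fun s : ℝ => invChart φ (φ 1 + s • x)) 0 := by
    refine ContinuousAt.comp (g := invChart φ) ?_ hl.continuousAt
    exact hi.continuousAt ((isOpen_invDom φ).mem_nhds (by simp [invDom, hφ]))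
  refine ⟨fun s => dm ((φ 1 + s • x, invChart φ (φ 1 + s • x)), (x, 0)), ?_, ?_, ?_⟩
  · refine ContinuousAt.comp (g := dm) ?_ ((hl.continuousAt.prodMk hinv).prodMk continuousAt_const)
    refine hm.continuousOn.continuousAt (((isOpen_mulDom φ φ φ).prod isOpen_univ).mem_nhds ?_)
    simp [mulDom, invChart, hφ]
  · simpa [invChart, hφ] using mulChart_dirDeriv_one hm x
  · have hs1 : ∀ᶠ s : ℝ in 𝓝 0, φ 1 + s • x ∈ invDom φ :=
      hl.continuousAt.eventually_mem ((isOpen_invDom φ).mem_nhds (by simp [invDom, hφ]))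
    filter_upwards [hs1] with s hs y
    exact hasVelocity_adjointAction_lineCurve hH hAd hLie hm hs y

end LieAlgebraOf

/-! ### Functionals bounded below on adjoint orbits -/

section EulerScheme

variable {F : Type*} [NormedAddCommGroup F] [NormedSpace ℝ F]

lemma gronwallBound_zero_le {K c s : ℝ} (hK : 0 < K) (hc : 0 ≤ c) :
    gronwallBound 0 K c s ≤ c * s * Real.exp (K * s) := by
  have hexp : Real.exp (K * s) - 1 ≤ K * s * Real.exp (K * s) := by
    have h := mul_le_mul_of_nonneg_right (Real.one_sub_le_exp_neg (K * s)) (Real.exp_pos (K * s)).le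
    rw [← Real.exp_add, neg_add_cancel, Real.exp_zero] at h
    linarith
  simp only [gronwallBound_of_K_ne_0 hK.ne', zero_mul, zero_add]
  calc c / K * (Real.exp (K * s) - 1) ≤ c / K * (K * s * Real.exp (K * s)) := by gcongr
    _ = c * s * Real.exp (K * s) := by field_simp

lemma norm_apply_sub_apply_le {β b : F →L[ℝ] F} {η r : ℝ} (hr : 0 ≤ r) (hη : η ≤ 1)
    (hβ : ‖β - b‖ ≤ η) (z z₀ : F) :
    ‖β z - b z₀‖ ≤ (‖b‖ + 1) * ‖z - z₀ - r • b z₀‖ + (η + r * (‖b‖ + 1) ^ 2) * ‖z₀‖ := by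
  have hβK : ‖β‖ ≤ ‖b‖ + 1 := by linarith [norm_le_norm_add_norm_sub' β b]
  have hbK : ‖b‖ ≤ ‖b‖ + 1 := by linarith
  have hsplit : β z - b z₀ = β (z - z₀ - r • b z₀) + (β - b) z₀ + r • β (b z₀) := by
    simp only [map_sub, map_smul, sub_apply]
    abel
  calc ‖β z - b z₀‖ ≤ ‖β (z - z₀ - r • b z₀)‖ + ‖(β - b) z₀‖ + ‖r • β (b z₀)‖ :=
        hsplit ▸ norm_add₃_le
    _ ≤ (‖b‖ + 1) * ‖z - z₀ - r • b z₀‖ + η * ‖z₀‖ + r * ((‖b‖ + 1) * ((‖b‖ + 1) * ‖z₀‖)) := by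
        rw [norm_smul, Real.norm_of_nonneg hr]
        gcongr
        · exact β.le_of_opNorm_le hβK _
        · exact (β - b).le_of_opNorm_le hβ _
        · exact β.le_of_opNorm_le_of_le hβK (b.le_of_opNorm_le hbK _)
    _ = _ := by ring

lemma norm_sub_sub_smul_le_of_hasDerivAt {β : ℝ → F →L[ℝ] F} {b : F →L[ℝ] F} {z : ℝ → F}
    {η s : ℝ} (hs : 0 ≤ s) (hη : η ≤ 1) (hβ : ∀ r ∈ Set.Icc 0 s, ‖β r - b‖ ≤ η)
    (hz : ∀ r ∈ Set.Icc 0 s, HasDerivAt z (β r (z r)) r) :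
    ‖z s - z 0 - s • b (z 0)‖ ≤
      (η + s * (‖b‖ + 1) ^ 2) * Real.exp ((‖b‖ + 1) * s) * s * ‖z 0‖ := by
  have hη0 : 0 ≤ η := (norm_nonneg _).trans (hβ 0 ⟨le_rfl, hs⟩)
  have hderiv : ∀ r ∈ Set.Icc 0 s, HasDerivAt (fun r => z r - z 0 - r • b (z 0))
      (β r (z r) - b (z 0)) r := fun r hr => by
    simpa only [one_smul] using
      ((hz r hr).sub_const (z 0)).fun_sub ((hasDerivAt_id' r).smul_const (b (z 0)))
  have hbound : ∀ r ∈ Set.Ico 0 s, ‖β r (z r) - b (z 0)‖ ≤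
      (‖b‖ + 1) * ‖z r - z 0 - r • b (z 0)‖ + (η + s * (‖b‖ + 1) ^ 2) * ‖z 0‖ := fun r hr =>
    (norm_apply_sub_apply_le hr.1 hη (hβ r (Set.Ico_subset_Icc_self hr)) _ _).trans
      (by gcongr; exact hr.2.le)
  have hgronwall := norm_le_gronwallBound_of_norm_deriv_right_le (δ := 0)
    (fun r hr => (hderiv r hr).continuousAt.continuousWithinAt)
    (fun r hr => (hderiv r (Set.Ico_subset_Icc_self hr)).hasDerivWithinAt)
    (by simp) hbound s ⟨hs, le_rfl⟩
  rw [sub_zero] at hgronwall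
  exact (hgronwall.trans (gronwallBound_zero_le (by positivity) (by positivity))).trans_eq (by ring)

lemma norm_euler_step_le {b : F →L[ℝ] F} {ε s τ C : ℝ} (hε : 0 ≤ ε) (hε1 : ε ≤ 1) (hs : 0 ≤ s)
    {x₀ z z' : F} (hb : b (b x₀) = 0) (hz : ‖z' - z - s • b z‖ ≤ ε * s * ‖z‖)
    (hC : ‖x₀ + τ • b x₀‖ ≤ C) :
    ‖z' - (x₀ + (τ + s) • b x₀)‖ ≤
      (1 + s * (‖b‖ + 1)) * ‖z - (x₀ + τ • b x₀)‖ + ε * s * C := by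
  set e := z - (x₀ + τ • b x₀) with he
  have hsplit : z' - (x₀ + (τ + s) • b x₀) = (z' - z - s • b z) + e + s • b e := by
    simp only [he, map_sub, map_add, map_smul, hb, smul_zero, add_zero, smul_sub]
    module
  have hz_le : ‖z‖ ≤ ‖e‖ + C := by
    have h := norm_add_le e (x₀ + τ • b x₀)
    rw [he, sub_add_cancel] at h
    linarith
  calc _ ≤ ‖z' - z - s • b z‖ + ‖e‖ + ‖s • b e‖ := hsplit ▸ norm_add₃_le
    _ ≤ ε * s * (‖e‖ + C) + ‖e‖ + s * (‖b‖ * ‖e‖) := by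
        rw [norm_smul, Real.norm_of_nonneg hs]
        gcongr
        · exact hz.trans (by gcongr)
        · exact b.le_opNorm e
    _ ≤ _ := by nlinarith [mul_le_mul_of_nonneg_right hε1 (mul_nonneg hs (norm_nonneg e))]

lemma norm_euler_sub_le {b : F →L[ℝ] F} {z : ℕ → F} {ε s : ℝ} (hε : 0 ≤ ε) (hε1 : ε ≤ 1)
    (hs : 0 ≤ s) (hb : b (b (z 0)) = 0)
    (hz : ∀ k, ‖z (k + 1) - z k - s • b (z k)‖ ≤ ε * s * ‖z k‖) (k : ℕ) (hk : k * s ≤ 1) :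
    ‖z k - (z 0 + (k * s) • b (z 0))‖ ≤
      ε * (‖z 0‖ + ‖b (z 0)‖) * (k * s) * (1 + s * (‖b‖ + 1)) ^ k := by
  induction k with
  | zero => simp
  | succ k ih =>
    set C := ‖z 0‖ + ‖b (z 0)‖
    set q := 1 + s * (‖b‖ + 1)
    have hq : 1 ≤ q := le_add_of_nonneg_right (by positivity)
    have hk' : k * s ≤ 1 := le_trans (by gcongr; simp) hk
    have hC : ‖z 0 + (k * s) • b (z 0)‖ ≤ C := by
      refine (norm_add_le _ _).trans (add_le_add le_rfl ?_)
      rw [norm_smul, Real.norm_of_nonneg (by positivity)]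
      exact mul_le_of_le_one_left (norm_nonneg _) hk'
    calc ‖z (k + 1) - (z 0 + ((k + 1 : ℕ) * s) • b (z 0))‖
        = ‖z (k + 1) - (z 0 + (k * s + s) • b (z 0))‖ := by push_cast; rw [add_one_mul]
      _ ≤ q * ‖z k - (z 0 + (k * s) • b (z 0))‖ + ε * s * C :=
          norm_euler_step_le hε hε1 hs hb (hz k) hC
      _ ≤ q * (ε * C * (k * s) * q ^ k) + ε * s * C * q ^ (k + 1) := by
          refine add_le_add (by gcongr; exact ih hk') ?_
          exact le_mul_of_one_le_right (by positivity) (one_le_pow₀ hq)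
      _ = ε * C * ((k + 1 : ℕ) * s) * q ^ (k + 1) := by push_cast; ring

/-- The Euler scheme of the linear field `b`, started at a point where `b ^ 2` vanishes, converges
at time `1` to the exact solution, which is affine in the time. -/
lemma tendsto_euler_iterate {E : Type*} {p : E → F} {A : ℝ → E → E} {b : F →L[ℝ] F}
    (hA : ∀ ε > 0, ∀ᶠ s in 𝓝[>] 0, ∀ y, ‖p (A s y) - p y - s • b (p y)‖ ≤ ε * s * ‖p y‖)
    {y : E} (hy : b (b (p y)) = 0) :
    Tendsto (fun k : ℕ => p ((A (k : ℝ)⁻¹)^[k] y)) atTop (𝓝 (p y + b (p y))) := by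
  set M := (‖p y‖ + ‖b (p y)‖) * Real.exp (‖b‖ + 1)
  have hM : 0 ≤ M := by positivity
  refine Metric.tendsto_nhds.mpr fun η hη => ?_
  obtain ⟨ε, hε, hε1, hεM⟩ : ∃ ε > 0, ε ≤ 1 ∧ ε * M < η := by
    refine ⟨min 1 (η / (M + 1)), by positivity, min_le_left _ _, ?_⟩
    refine (mul_le_mul_of_nonneg_right (min_le_right _ _) hM).trans_lt ?_
    rw [div_mul_eq_mul_div, div_lt_iff₀ (by positivity)]
    linarith
  have hlim : Tendsto (fun k : ℕ => (k : ℝ)⁻¹) atTop (𝓝[>] 0) :=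
    tendsto_inv_atTop_nhdsGT_zero.comp tendsto_natCast_atTop_atTop
  filter_upwards [hlim.eventually (hA ε hε), eventually_gt_atTop 0] with k hk hk0
  have hk1 : (k : ℝ) * (k : ℝ)⁻¹ = 1 := mul_inv_cancel₀ (by positivity)
  have h := norm_euler_sub_le (z := fun j => p ((A (k : ℝ)⁻¹)^[j] y)) hε.le hε1
    (by positivity : 0 ≤ (k : ℝ)⁻¹) hy
    (fun j => by simpa only [Function.iterate_succ_apply'] using hk _) k hk1.le
  have hpow : (1 + (k : ℝ)⁻¹ * (‖b‖ + 1)) ^ k ≤ Real.exp (‖b‖ + 1) := by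
    rw [add_comm 1]
    refine (pow_le_pow_left₀ (by positivity) (Real.add_one_le_exp _) k).trans_eq ?_
    rw [← Real.exp_nat_mul, ← mul_assoc, hk1, one_mul]
  simp only [hk1, one_smul, mul_one, Function.iterate_zero_apply] at h
  rw [dist_eq_norm]
  calc _ ≤ ε * (‖p y‖ + ‖b (p y)‖) * (1 + (k : ℝ)⁻¹ * (‖b‖ + 1)) ^ k := h
    _ ≤ ε * (‖p y‖ + ‖b (p y)‖) * Real.exp (‖b‖ + 1) := by gcongr
    _ = ε * M := mul_assoc _ _ _
    _ < η := hεM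

end EulerScheme

section Orbit

variable {E : Type u} [LieRing E] [LieAlgebra ℝ E] [TopologicalSpace E]
variable {H : Type w} [Group H] [TopologicalSpace H] [ChartedSpace E H]
variable [IsTopologicalAddGroup E] [ContinuousSMul ℝ E] [LocallyConvexSpace ℝ E] [T2Space E]
variable (hH : IsLocallyConvexLieGroup E H)
variable {Ad : H → E → E} (hAd : IsAdjointAction Ad) (hLie : HasLieAlgebra Ad)
variable {F : Type*} [NormedAddCommGroup F] [NormedSpace ℝ F]
variable (p : E →L[ℝ] F) (B : F →L[ℝ] F →L[ℝ] F) (hB : ∀ x y, p ⁅x, y⁆ = B (p x) (p y))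

include hH hAd hLie hB

/-- As `B` intertwines the brackets, `p (Ad (γ s) y)` solves a linear differential equation on `F`
along `γ = lineCurve H x`. -/
lemma eventually_norm_adjointAction_sub_le (x : E) {ε : ℝ} (hε : 0 < ε) :
    ∀ᶠ s in 𝓝[>] 0, ∀ y,
      ‖p (Ad (lineCurve H x s) y) - p y - s • B (p x) (p y)‖ ≤ ε * s * ‖p y‖ := by
  obtain ⟨δ, hδ, hδ0, hvel⟩ := exists_logarithmicDerivative hH hAd hLie x
  set b := B (p x)
  set η := min 1 (ε / 2)
  have hη : η < ε := (min_le_right _ _).trans_lt (half_lt_self hε)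
  have hclose : ∀ᶠ s in 𝓝 (0 : ℝ), ‖B (p (δ s)) - b‖ < η := by
    have hcont : ContinuousAt (fun s => B (p (δ s))) 0 :=
      (B.continuous.comp p.continuous).continuousAt.comp hδ
    simpa [dist_eq_norm, hδ0] using Metric.continuousAt_iff'.mp hcont η (by positivity)
  have hrate : ∀ᶠ s in 𝓝 (0 : ℝ), (η + s * (‖b‖ + 1) ^ 2) * Real.exp ((‖b‖ + 1) * s) < ε := by
    have hcont : Continuous fun s : ℝ => (η + s * (‖b‖ + 1) ^ 2) * Real.exp ((‖b‖ + 1) * s) := by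
      fun_prop
    exact hcont.continuousAt.eventually_lt continuousAt_const (by simpa using hη)
  obtain ⟨s₁, hs₁, hnear⟩ := Metric.eventually_nhds_iff.mp (hvel.and hclose)
  filter_upwards [self_mem_nhdsWithin, nhdsWithin_le_nhds hrate,
    nhdsWithin_le_nhds (Metric.ball_mem_nhds 0 hs₁)] with s (hs : 0 < s) hrate_s hs_lt y
  have hmem : ∀ r ∈ Set.Icc 0 s, dist r 0 < s₁ := fun r hr => by
    rw [dist_zero_right, Real.norm_of_nonneg hr.1]
    rw [Metric.mem_ball, dist_zero_right, Real.norm_of_nonneg hs.le] at hs_lt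
    exact hr.2.trans_lt hs_lt
  have h := norm_sub_sub_smul_le_of_hasDerivAt (z := fun r => p (Ad (lineCurve H x r) y)) hs.le
    (min_le_left 1 (ε / 2)) (fun r hr => (hnear (hmem r hr)).2.le)
    (fun r hr => hB _ _ ▸ ((hnear (hmem r hr)).1 y).hasDerivAt p)
  simp only [lineCurve_zero, adjointAction_one hAd] at h
  exact h.trans (by gcongr)

lemma le_add_of_forall_le_adjointAction {x y : E} (hxy : ⁅x, ⁅x, y⁆⁆ = 0) (l : F →L[ℝ] ℝ) {m : ℝ}
    (hm : ∀ g : H, m ≤ l (p (Ad g y))) : m ≤ l (p y) + l (p ⁅x, y⁆) := by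
  have hlim := tendsto_euler_iterate (p := p) (A := fun s => Ad (lineCurve H x s)) (y := y)
    (fun ε hε => eventually_norm_adjointAction_sub_le hH hAd hLie p B hB x hε)
    (by rw [← hB, ← hB, hxy, map_zero])
  rw [hB, ← map_add]
  refine ge_of_tendsto' ((l.continuous.tendsto _).comp hlim) fun k => ?_
  simpa only [Function.comp_apply, iterate_adjointAction hH hAd] using hm _

lemma apply_lie_eq_zero_of_forall_le {x y : E} (hxy : ⁅x, ⁅x, y⁆⁆ = 0) (l : F →L[ℝ] ℝ) {m : ℝ}
    (hm : ∀ g : H, m ≤ l (p (Ad g y))) : l (p ⁅x, y⁆) = 0 := by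
  have hline : ∀ t : ℝ, m ≤ l (p y) + t * l (p ⁅x, y⁆) := fun t => by
    simpa using le_add_of_forall_le_adjointAction hH hAd hLie p B hB (x := t • x)
      (by simp [hxy]) l hm
  by_contra hne
  have h := hline ((m - l (p y) - 1) / l (p ⁅x, y⁆))
  rw [div_mul_cancel₀ _ hne] at h
  linarith

end Orbit

section FiniteFactor

variable {E : Type*} [LieRing E] [LieAlgebra ℝ E] [TopologicalSpace E]
variable {F : Type*} [NormedAddCommGroup F] [NormedSpace ℝ F]

lemma exists_quasiInverse {K V W : Type*} [Field K] [AddCommGroup V] [Module K V] [AddCommGroup W]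
    [Module K W] (p : V →ₗ[K] W) : ∃ s : W →ₗ[K] V, ∀ x, p (s (p x)) = p x := by
  obtain ⟨s₀, hs₀⟩ := p.rangeRestrict.exists_rightInverse_of_surjective p.range_rangeRestrict
  obtain ⟨s, hs⟩ := s₀.exists_extend
  refine ⟨s, fun x => ?_⟩
  have h1 : s (p x) = s₀ (p.rangeRestrict x) := LinearMap.congr_fun hs (p.rangeRestrict x)
  rw [h1]
  exact congrArg Subtype.val (LinearMap.congr_fun hs₀ (p.rangeRestrict x))

lemma exists_bracket_factor [FiniteDimensional ℝ F] (p : E →L[ℝ] F)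
    (hp : ∀ x y : E, p x = 0 → p ⁅x, y⁆ = 0) :
    ∃ B : F →L[ℝ] F →L[ℝ] F, ∀ x y : E, p ⁅x, y⁆ = B (p x) (p y) := by
  obtain ⟨s, hs⟩ := exists_quasiInverse p.toLinearMap
  have hs : ∀ x, p (s (p x)) = p x := hs
  let b : F →ₗ[ℝ] F →ₗ[ℝ] F := LinearMap.mk₂ ℝ (fun u w => p ⁅s u, s w⁆) (by simp) (by simp)
    (by simp) (by simp)
  refine ⟨LinearMap.toContinuousLinearMap
    (LinearMap.toContinuousLinearMap.toLinearMap ∘ₗ b), fun x y => ?_⟩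
  change p ⁅x, y⁆ = p ⁅s (p x), s (p y)⁆
  have hp' : ∀ x y : E, p y = 0 → p ⁅x, y⁆ = 0 := by
    intro x y h
    rw [← lie_skew, map_neg, hp y x h, neg_zero]
  have h1 := hp (x - s (p x)) y (by simp [hs])
  have h2 := hp' (s (p x)) (y - s (p y)) (by simp [hs])
  rw [sub_lie, map_sub, sub_eq_zero] at h1
  rw [lie_sub, map_sub, sub_eq_zero] at h2
  rw [h1, h2]

lemma exists_functional_factor [FiniteDimensional ℝ F] (p : E →L[ℝ] F) (l : E →L[ℝ] ℝ)
    (hl : ∀ x, p x = 0 → l x = 0) : ∃ l' : F →L[ℝ] ℝ, ∀ x, l x = l' (p x) := by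
  obtain ⟨s, hs⟩ := exists_quasiInverse p.toLinearMap
  have hs : ∀ x, p (s (p x)) = p x := hs
  refine ⟨LinearMap.toContinuousLinearMap (l.toLinearMap ∘ₗ s), fun x => ?_⟩
  change l x = l (s (p x))
  have := hl (x - s (p x)) (by simp [hs])
  rwa [map_sub, sub_eq_zero] at this

end FiniteFactor

/-- The functional `l` factors through a finite-dimensional quotient of the topological Lie algebra
`E`: it vanishes on the kernel of a continuous linear map to some `ℝ ^ d`, and this kernel is an
ideal. This is what reduces the adjoint action to a flow in finite dimension. -/
def HasFiniteFactor {E : Type*} [LieRing E] [LieAlgebra ℝ E] [TopologicalSpace E]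
    (l : E →L[ℝ] ℝ) : Prop :=
  ∃ (d : ℕ) (p : E →L[ℝ] (Fin d → ℝ)), (∀ x y : E, p x = 0 → p ⁅x, y⁆ = 0) ∧
    ∀ x, p x = 0 → l x = 0

section Orbit

variable {E : Type u} [LieRing E] [LieAlgebra ℝ E] [TopologicalSpace E]
variable {H : Type w} [Group H] [TopologicalSpace H] [ChartedSpace E H]
variable [IsTopologicalAddGroup E] [ContinuousSMul ℝ E] [T2Space E]

lemma HasFiniteFactor.apply_lie_eq_zero [LocallyConvexSpace ℝ E]
    (hH : IsLocallyConvexLieGroup E H) {Ad : H → E → E} (hAd : IsAdjointAction Ad)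
    (hLie : HasLieAlgebra Ad) {l : E →L[ℝ] ℝ} (hl : HasFiniteFactor l) {x y : E}
    (hxy : ⁅x, ⁅x, y⁆⁆ = 0) (hb : BddBelow (Set.range fun g : H => l (Ad g y))) :
    l ⁅x, y⁆ = 0 := by
  obtain ⟨d, p, hp, hpl⟩ := hl
  obtain ⟨B, hB⟩ := exists_bracket_factor p hp
  obtain ⟨l', hl'⟩ := exists_functional_factor p l hpl
  obtain ⟨m, hm⟩ := hb
  rw [hl']
  refine apply_lie_eq_zero_of_forall_le hH hAd hLie p B hB hxy l' (m := m) fun g => ?_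
  rw [← hl']
  exact hm ⟨g, rfl⟩

end Orbit

section Unitary

variable {𝓓 : Type v} [NormedAddCommGroup 𝓓] [InnerProductSpace ℂ 𝓓]

lemma skewOps_eq_zero_of_dense (X : skewOps 𝓓) {𝓓₀ : Submodule ℂ 𝓓} (hd : Dense (𝓓₀ : Set 𝓓))
    (h : ∀ ψ ∈ 𝓓₀, inner ℂ ψ ((X : Module.End ℂ 𝓓) ψ) = 0) : X = 0 := by
  have hX : ∀ φ ψ : 𝓓, inner ℂ ((X : Module.End ℂ 𝓓) φ) ψ =
    -inner ℂ φ ((X : Module.End ℂ 𝓓) ψ) := X.2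
  set T : Module.End ℂ 𝓓 := (X : Module.End ℂ 𝓓)
  have hself : ∀ ψ ∈ 𝓓₀, inner ℂ (T ψ) ψ = 0 := fun ψ hψ => by rw [hX, h ψ hψ, neg_zero]
  have hpolar : ∀ φ ∈ 𝓓₀, ∀ ψ ∈ 𝓓₀, inner ℂ (T ψ) φ = 0 := fun φ hφ ψ hψ => by
    have hI := 𝓓₀.smul_mem Complex.I hψ
    rw [inner_map_polarization, hself _ (add_mem hφ hψ), hself _ (sub_mem hφ hψ),
      hself _ (add_mem hφ hI), hself _ (sub_mem hφ hI)]
    simp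
  have hzero : ∀ ψ ∈ 𝓓₀, T ψ = 0 := fun ψ hψ =>
    hd.eq_zero_of_inner_left ℂ fun φ hφ => hpolar φ hφ ψ hψ
  ext φ
  exact hd.eq_zero_of_inner_left ℂ fun ψ hψ => by
    rw [hX, hzero ψ hψ, inner_zero_right, neg_zero]

variable {𝔥 : Type u} [LieRing 𝔥] [LieAlgebra ℝ 𝔥] [TopologicalSpace 𝔥]

/-- The expectation value of the symmetric operator `-i π(ξ)` in the state `ψ`, as a continuous
functional of `ξ`. -/
noncomputable def expectation (π : 𝔥 →ₗ⁅ℝ⁆ skewOps 𝓓) (hπ : IsContinuousRep π) (ψ : 𝓓) :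
    𝔥 →L[ℝ] ℝ where
  toFun ξ := (inner ℂ ψ ((-Complex.I) • (π ξ : Module.End ℂ 𝓓) ψ)).re
  map_add' ξ η := by simp [inner_neg_right]
  map_smul' r ξ := by
    have hsmul : ((π (r • ξ) : skewOps 𝓓) : Module.End ℂ 𝓓) ψ =
        (r : ℂ) • (π ξ : Module.End ℂ 𝓓) ψ := by
      rw [map_smul]; rfl
    rw [hsmul, smul_comm, inner_smul_right]
    simp
  cont := by
    have := hπ ψ
    fun_prop

lemma inner_eq_zero_of_expectation_eq_zero {π : 𝔥 →ₗ⁅ℝ⁆ skewOps 𝓓} {hπ : IsContinuousRep π}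
    {ψ : 𝓓} {ξ : 𝔥} (h : expectation π hπ ψ ξ = 0) :
    inner ℂ ψ ((π ξ : Module.End ℂ 𝓓) ψ) = 0 := by
  have hskew : inner ℂ ((π ξ : Module.End ℂ 𝓓) ψ) ψ = -inner ℂ ψ ((π ξ : Module.End ℂ 𝓓) ψ) :=
    (π ξ).2 ψ ψ
  have him : (inner ℂ ψ ((-Complex.I) • (π ξ : Module.End ℂ 𝓓) ψ)).re = 0 := h
  rw [← inner_conj_symm] at hskew
  have hre := congrArg Complex.re hskew
  rw [Complex.conj_re, Complex.neg_re] at hre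
  rw [inner_smul_right, neg_mul, Complex.neg_re, Complex.I_mul_re, neg_neg] at him
  exact Complex.ext (by rw [Complex.zero_re]; linarith) him

theorem IsGPE.map_lie_eq_zero [IsTopologicalAddGroup 𝔥] [ContinuousSMul ℝ 𝔥]
    [LocallyConvexSpace ℝ 𝔥] [T2Space 𝔥] (hf : ∀ l : 𝔥 →L[ℝ] ℝ, HasFiniteFactor l)
    {π : 𝔥 →ₗ⁅ℝ⁆ skewOps 𝓓} (hπ : IsContinuousRep π) {x y : 𝔥} (h : IsGPE.{u, v, w} π y)
    (hxy : ⁅x, ⁅x, y⁆⁆ = 0) : π ⁅x, y⁆ = 0 := by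
  obtain ⟨H, _, _, _, Ad, 𝓓₀, hH, -, hAd, hLie, hd, hb⟩ := h
  exact skewOps_eq_zero_of_dense _ hd fun ψ hψ =>
    inner_eq_zero_of_expectation_eq_zero (hπ := hπ)
      ((hf _).apply_lie_eq_zero hH hAd hLie hxy (hb ψ hψ))

end Unitary

/-! ### Derivations and powers of an ideal -/

section IteratedDerivation

variable {R A : Type*} [CommRing R] [CommRing A] [Algebra R A] {D : Derivation R A A}

lemma iterate_derivation_mul_mem {K : Ideal A} {n : ℕ} {f g : A}
    (h : ∀ i j, i + j = n → D^[i] f * D^[j] g ∈ K) : D^[n] (f * g) ∈ K := by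
  induction n generalizing f g with
  | zero => exact h 0 0 rfl
  | succ n ih =>
    rw [Function.iterate_succ_apply, Derivation.leibniz, iterate_map_add D, smul_eq_mul,
      smul_eq_mul, mul_comm g]
    refine K.add_mem (ih fun i j hij => ?_) (ih fun i j hij => ?_)
    · rw [← Function.iterate_succ_apply]
      exact h i (j + 1) (by omega)
    · rw [← Function.iterate_succ_apply]
      exact h (i + 1) j (by omega)

lemma derivation_mem_pow {I : Ideal A} (hD : ∀ f ∈ I, D f ∈ I) (k : ℕ) :
    ∀ f ∈ I ^ k, D f ∈ I ^ k := by
  induction k with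
  | zero => simp
  | succ k ih =>
    intro f hf
    rw [pow_succ] at hf ⊢
    induction hf using Submodule.mul_induction_on' with
    | mem_mul_mem a ha b hb =>
      rw [Derivation.leibniz, smul_eq_mul, smul_eq_mul, mul_comm b]
      exact Ideal.add_mem _ (Ideal.mul_mem_mul ha (hD b hb)) (Ideal.mul_mem_mul (ih a ha) hb)
    | add a _ b _ ha hb =>
      rw [map_add]
      exact Ideal.add_mem _ ha hb

lemma iterate_derivation_mem_sq_span {s : Set A} (hD : ∀ f, D f ∈ Ideal.span s) {r : ℕ}
    (hr : ∀ x ∈ s, D^[r] x ∈ Ideal.span s ^ 2) {f : A} (hf : f ∈ Ideal.span s) :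
    D^[r] f ∈ Ideal.span s ^ 2 := by
  induction hf using Submodule.span_induction with
  | mem x hx => exact hr x hx
  | zero => rw [iterate_map_zero D]; exact zero_mem _
  | add f g _ _ hf hg => rw [iterate_map_add D]; exact add_mem hf hg
  | smul a x hx ih =>
    refine iterate_derivation_mul_mem fun i j hij => ?_
    rcases i with _ | i
    · obtain rfl : j = r := by omega
      exact Ideal.mul_mem_left _ _ ih
    · rw [sq, Function.iterate_succ_apply']
      exact Ideal.mul_mem_mul (hD _)
        (Set.MapsTo.iterate (s := Ideal.span s) (fun f _ => hD f) j hx)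

lemma exists_iterate_derivation_mem_pow_succ {I : Ideal A} (hD : ∀ f, D f ∈ I) {r : ℕ}
    (hr : ∀ f ∈ I, D^[r] f ∈ I ^ 2) (k : ℕ) : ∃ s, ∀ f ∈ I ^ k, D^[s] f ∈ I ^ (k + 1) := by
  have iterate_mem (k n : ℕ) {f : A} (hf : f ∈ I ^ k) : D^[n] f ∈ I ^ k :=
    Set.MapsTo.iterate (f := D) (s := ((I ^ k : Ideal A) : Set A))
      (derivation_mem_pow (fun f _ => hD f) k) n hf
  induction k with
  | zero => exact ⟨1, fun f _ => by simpa using hD f⟩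
  | succ k ih =>
    obtain ⟨s, hs⟩ := ih
    refine ⟨r + s, fun f hf => ?_⟩
    rw [pow_succ'] at hf
    induction hf using Submodule.mul_induction_on' with
    | mem_mul_mem a ha b hb =>
      refine iterate_derivation_mul_mem fun i j hij => ?_
      rcases le_total r i with hi | hi
      · obtain ⟨i, rfl⟩ := Nat.exists_eq_add_of_le' hi
        rw [show k + 1 + 1 = 2 + k by ring, pow_add, Function.iterate_add_apply]
        exact Ideal.mul_mem_mul (iterate_mem 2 i (hr a ha)) (iterate_mem k j hb)
      · obtain ⟨j, rfl⟩ := Nat.exists_eq_add_of_le' (show s ≤ j by omega)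
        rw [pow_succ' I (k + 1), Function.iterate_add_apply D j]
        exact Ideal.mul_mem_mul (by simpa using iterate_mem 1 i (by simpa using ha))
          (iterate_mem (k + 1) j (hs b hb))
    | add f _ g _ hf hg =>
      rw [iterate_map_add D]
      exact add_mem hf hg

lemma exists_iterate_derivation_mem_pow {I : Ideal A} (hD : ∀ f, D f ∈ I) {r : ℕ}
    (hr : ∀ f ∈ I, D^[r] f ∈ I ^ 2) (k : ℕ) : ∃ m, ∀ f, D^[m] f ∈ I ^ k := by
  induction k with
  | zero => exact ⟨0, by simp⟩
  | succ k ih =>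
    obtain ⟨m, hm⟩ := ih
    obtain ⟨s, hs⟩ := exists_iterate_derivation_mem_pow_succ hD hr k
    exact ⟨s + m, fun f => by rw [Function.iterate_add_apply]; exact hs _ (hm f)⟩

end IteratedDerivation

/-! ### The order of formal power series -/

section OrderFiltration

open MvPowerSeries

variable {ι R : Type*} [CommRing R]

variable (ι R) in
/-- The ideal of formal power series generated by the coordinates. Its powers filter the formal
power series by their order at the origin. -/
noncomputable def coordIdeal : Ideal (MvPowerSeries ι R) :=
  Ideal.span (Set.range MvPowerSeries.X)

lemma X_mem_coordIdeal (i : ι) : (X i : MvPowerSeries ι R) ∈ coordIdeal ι R :=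
  Ideal.subset_span ⟨i, rfl⟩

lemma le_order_of_mem_coordIdeal_pow {k : ℕ} {f : MvPowerSeries ι R}
    (hf : f ∈ coordIdeal ι R ^ k) : (k : ℕ∞) ≤ f.order := by
  have one_le_order : ∀ f ∈ coordIdeal ι R, 1 ≤ f.order := by
    have h : coordIdeal ι R ≤ RingHom.ker constantCoeff :=
      Ideal.span_le.mpr (by rintro _ ⟨i, rfl⟩; simp)
    exact fun f hf => one_le_order_iff_constCoeff_eq_zero.mpr (h hf)
  induction hf using Submodule.pow_induction_on_left' with
  | algebraMap f => simp
  | add f g k _ _ hf hg => exact (le_min hf hg).trans min_order_le_add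
  | mem_mul f hf k g _ hg =>
    rw [Nat.cast_succ, add_comm]
    exact (add_le_add (one_le_order f hf) hg).trans le_order_mul

lemma exists_eq_sum_X_mul_of_lt_order [Fintype ι] {k : ℕ} {f : MvPowerSeries ι R}
    (hf : (k : ℕ∞) < f.order) :
    ∃ g : ι → MvPowerSeries ι R, (∀ i, (k : ℕ∞) ≤ (g i).order) ∧ f = ∑ i, X i * g i := by
  classical
  -- `c d` is a variable occurring in the monomial with exponent `d`; `X i * g i` collects the
  -- monomials with `c d = i`.
  choose c hc using fun d : {d : ι →₀ ℕ // d ≠ 0} => Finsupp.ne_iff.mp d.2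
  let g (i : ι) : MvPowerSeries ι R := fun e =>
    if c ⟨e + Finsupp.single i 1, by simp⟩ = i then coeff (e + Finsupp.single i 1) f else 0
  have coeff_g {d e : ι →₀ ℕ} {i : ι} (hd : d ≠ 0) (h : e + Finsupp.single i 1 = d) :
      coeff e (g i) = if c ⟨d, hd⟩ = i then coeff d f else 0 := by
    subst h
    rfl
  refine ⟨g, fun i => nat_le_order fun e he => ?_, ?_⟩
  · have hdeg : (e + Finsupp.single i 1).degree ≤ k := by
      rw [map_add, Finsupp.degree_single]
      exact he
    rw [coeff_g (by simp) rfl, coeff_of_lt_order (lt_of_le_of_lt (by exact_mod_cast hdeg) hf),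
      ite_self]
  ext d
  simp only [map_sum, X, coeff_monomial_mul, one_mul]
  by_cases hd : d = 0
  · rw [coeff_of_lt_order (by simpa [hd] using pos_of_gt hf)]
    simp [hd]
  have hle : Finsupp.single (c ⟨d, hd⟩) 1 ≤ d :=
    Finsupp.single_le_iff.mpr (Nat.one_le_iff_ne_zero.mpr (hc ⟨d, hd⟩))
  rw [Finset.sum_eq_single_of_mem (c ⟨d, hd⟩) (Finset.mem_univ _), if_pos hle,
    coeff_g hd (tsub_add_cancel_of_le hle), if_pos rfl]
  intro i _ hi
  split_ifs with hle'
  · rw [coeff_g hd (tsub_add_cancel_of_le hle'), if_neg (Ne.symm hi)]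
  · rfl

lemma mem_coordIdeal_pow [Finite ι] {k : ℕ} {f : MvPowerSeries ι R} :
    f ∈ coordIdeal ι R ^ k ↔ (k : ℕ∞) ≤ f.order := by
  refine ⟨le_order_of_mem_coordIdeal_pow, fun hf => ?_⟩
  have := Fintype.ofFinite ι
  induction k generalizing f with
  | zero => simp
  | succ k ih =>
    obtain ⟨g, hg, rfl⟩ := exists_eq_sum_X_mul_of_lt_order
      (lt_of_lt_of_le (by exact_mod_cast k.lt_succ_self) hf)
    rw [pow_succ']
    exact Ideal.sum_mem _ fun i _ => Ideal.mul_mem_mul (X_mem_coordIdeal i) (ih (hg i))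

lemma mem_coordIdeal [Finite ι] {f : MvPowerSeries ι R} :
    f ∈ coordIdeal ι R ↔ constantCoeff f = 0 := by
  rw [← pow_one (coordIdeal ι R), mem_coordIdeal_pow, Nat.cast_one,
    one_le_order_iff_constCoeff_eq_zero]

end OrderFiltration

/-! ### Formal vector fields -/

section VectorFields

open MvPowerSeries

lemma pderiv_comm {ι R : Type*} [CommRing R] (i j : ι) (f : MvPowerSeries ι R) :
    pderiv R i (pderiv R j f) = pderiv R j (pderiv R i f) := by
  classical
  ext d
  by_cases hij : i = j
  · rw [hij]
  · simp only [coeff_pderiv, Finsupp.add_apply, Finsupp.single_eq_of_ne (Ne.symm hij),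
      Finsupp.single_eq_of_ne hij, add_zero]
    rw [add_right_comm]
    ring

variable {ι : Type*} [Fintype ι] {V : Type*} [AddCommGroup V] [Module ℝ V]

lemma lieDer_apply (v : ι → MvPowerSeries ι ℝ) (f : MvPowerSeries ι ℝ) :
    lieDer v f = ∑ i, v i * pderiv ℝ i f := by
  rw [lieDer, ← Derivation.coeFnAddMonoidHom_apply, map_sum, Finset.sum_apply]
  rfl

lemma lieDer_X (v : ι → MvPowerSeries ι ℝ) (i : ι) : lieDer v (X i) = v i := by
  classical
  rw [lieDer_apply, Finset.sum_eq_single i]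
  · simp
  · intro j _ hj
    rw [pderiv_X_of_ne hj.symm, mul_zero]
  · simp

lemma lieDer_add (u w : ι → MvPowerSeries ι ℝ) : lieDer (u + w) = lieDer u + lieDer w := by
  ext1 f
  simp [lieDer_apply, add_mul, Finset.sum_add_distrib]

lemma lieDer_mem {I : Ideal (MvPowerSeries ι ℝ)} {v : ι → MvPowerSeries ι ℝ} (hv : ∀ i, v i ∈ I)
    (f : MvPowerSeries ι ℝ) : lieDer v f ∈ I := by
  rw [lieDer_apply]
  exact I.sum_mem fun i _ => I.mul_mem_right _ (hv i)

lemma lieDer_lie (u w : ι → MvPowerSeries ι ℝ) :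
    ⁅lieDer u, lieDer w⁆ = lieDer fun i => lieDer u (w i) - lieDer w (u i) := by
  ext1 f
  have second_order : ∑ i, w i * lieDer u (pderiv ℝ i f) =
      ∑ i, u i * lieDer w (pderiv ℝ i f) := by
    simp only [lieDer_apply, Finset.mul_sum]
    rw [Finset.sum_comm]
    refine Finset.sum_congr rfl fun i _ => Finset.sum_congr rfl fun j _ => ?_
    rw [pderiv_comm]
    ring
  rw [Derivation.commutator_apply, lieDer_apply w f, lieDer_apply u f, map_sum, map_sum,
    lieDer_apply _ f]
  simp only [Derivation.leibniz, smul_eq_mul, Finset.sum_add_distrib, sub_mul,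
    Finset.sum_sub_distrib]
  rw [second_order, add_sub_add_left_eq_sub]
  simp only [mul_comm]

lemma linearSeries_mem_coordIdeal (b : Module.Basis ι ℝ V) (φ : Module.Dual ℝ V) :
    linearSeries b φ ∈ coordIdeal ι ℝ :=
  Ideal.sum_mem _ fun i _ => Submodule.smul_of_tower_mem _ _ (X_mem_coordIdeal i)

lemma linearSeries_coord (b : Module.Basis ι ℝ V) (i : ι) :
    linearSeries b (b.coord i) = X i := by
  classical
  change ∑ j, b.coord i (b j) • X j = _
  rw [Finset.sum_eq_single i]
  · simp
  · intro j _ hj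
    simp [Finsupp.single_eq_of_ne hj.symm]
  · simp

lemma lieDer_linearSeries (b : Module.Basis ι ℝ V) (v : ι → MvPowerSeries ι ℝ)
    (φ : Module.Dual ℝ V) : lieDer v (linearSeries b φ) = ∑ i, φ (b i) • v i := by
  change lieDer v (∑ i, φ (b i) • X i) = _
  simp [lieDer_X]

variable [DecidableEq ι] (b : Module.Basis ι ℝ V)

lemma linearField_apply (A : Module.End ℝ V) (i : ι) :
    linearField b A i = linearSeries b (A.dualMap (b.coord i)) := by
  simp [linearField, linearSeries, LinearMap.toMatrix_apply]

lemma linearField_add (A B : Module.End ℝ V) :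
    linearField b (A + B) = linearField b A + linearField b B := by
  ext1 i
  simp [linearField, Finset.sum_add_distrib, add_smul]

lemma lieDer_linearField_linearSeries (A : Module.End ℝ V) (φ : Module.Dual ℝ V) :
    lieDer (linearField b A) (linearSeries b φ) = linearSeries b (A.dualMap φ) := by
  rw [lieDer_linearSeries]
  simp only [linearField_apply, ← map_smul, ← map_sum]
  rw [b.sum_dual_apply_smul_coord]

lemma lieDer_linearField_lie_eq_zero {A B : Module.End ℝ V} (h : Commute A B) :
    ⁅lieDer (linearField b A), lieDer (linearField b B)⁆ = 0 := by
  have dualMap_comm (φ : Module.Dual ℝ V) :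
      A.dualMap (B.dualMap φ) = B.dualMap (A.dualMap φ) := by
    ext x
    exact congrArg φ (LinearMap.congr_fun h.eq.symm x)
  rw [lieDer_lie]
  ext1 f
  simp [lieDer_apply _ f, linearField_apply, lieDer_linearField_linearSeries, dualMap_comm]

lemma higherOrderPart_mem_coordIdeal_sq {v : ι → MvPowerSeries ι ℝ}
    (hv : ∀ i, constantCoeff (v i) = 0) (i : ι) :
    higherOrderPart b v i ∈ coordIdeal ι ℝ ^ 2 := by
  refine mem_coordIdeal_pow.mpr (nat_le_order fun d hd => ?_)
  simp only [higherOrderPart, Pi.sub_apply, linearField, linearPart, LinearMap.toMatrix_toLin,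
    Matrix.of_apply, map_sub, map_sum, map_smul, coeff_X, smul_eq_mul]
  rcases Nat.lt_succ_iff_lt_or_eq.mp hd with h | h
  · obtain rfl : d = 0 := (Finsupp.degree_eq_zero_iff d).mp (by omega)
    simp [hv, Finsupp.single_eq_zero, eq_comm (a := (0 : ι →₀ ℕ))]
  · obtain ⟨j, rfl⟩ : d ∈ Set.range fun a : ι => Finsupp.single a 1 := by
      rw [Finsupp.range_single_one]
      exact h
    simp [Finsupp.single_left_inj]

lemma linearField_add_mem_coordIdeal {w : ι → MvPowerSeries ι ℝ}
    (hw : ∀ i, w i ∈ coordIdeal ι ℝ ^ 2) (N : Module.End ℝ V) (i : ι) :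
    (linearField b N + w) i ∈ coordIdeal ι ℝ := by
  rw [Pi.add_apply, linearField_apply]
  exact add_mem (linearSeries_mem_coordIdeal _ _) (Ideal.pow_le_self two_ne_zero (hw i))

lemma iterate_lieDer_linearSeries_sub_mem {w : ι → MvPowerSeries ι ℝ}
    (hw : ∀ i, w i ∈ coordIdeal ι ℝ ^ 2) (N : Module.End ℝ V) (m : ℕ) (φ : Module.Dual ℝ V) :
    (lieDer (linearField b N + w))^[m] (linearSeries b φ) -
      linearSeries b (φ ∘ₗ N ^ m) ∈ coordIdeal ι ℝ ^ 2 := by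
  induction m with
  | zero => simp [Module.End.one_eq_id]
  | succ m ih =>
    have higher_order : lieDer (linearField b N + w) (linearSeries b (φ ∘ₗ N ^ m)) -
        linearSeries b (φ ∘ₗ N ^ (m + 1)) ∈ coordIdeal ι ℝ ^ 2 := by
      rw [lieDer_add, Derivation.add_apply, lieDer_linearField_linearSeries, pow_succ]
      exact (add_sub_cancel_left (linearSeries b (φ ∘ₗ (N ^ m * N))) _).symm ▸
        lieDer_mem hw _
    have := derivation_mem_pow
      (fun f _ => lieDer_mem (linearField_add_mem_coordIdeal b hw N) f) 2 _ ih
    rw [Function.iterate_succ_apply']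
    simpa using add_mem this higher_order

lemma exists_iterate_lieDer_mem_pow {w : ι → MvPowerSeries ι ℝ}
    (hw : ∀ i, w i ∈ coordIdeal ι ℝ ^ 2) {N : Module.End ℝ V} (hN : IsNilpotent N) (k : ℕ) :
    ∃ m, ∀ f, (lieDer (linearField b N + w))^[m] f ∈ coordIdeal ι ℝ ^ k := by
  obtain ⟨r, hr⟩ := hN
  have maps_to := lieDer_mem (linearField_add_mem_coordIdeal b hw N)
  refine exists_iterate_derivation_mem_pow maps_to (r := r) (fun f hf => ?_) k
  refine iterate_derivation_mem_sq_span maps_to ?_ hf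
  rintro _ ⟨i, rfl⟩
  have := iterate_lieDer_linearSeries_sub_mem b hw N r (b.coord i)
  rwa [hr, LinearMap.comp_zero, map_zero, sub_zero, linearSeries_coord] at this

lemma lieDer_eq_add_of_linearPart_eq {v : ι → MvPowerSeries ι ℝ} {S N : Module.End ℝ V}
    (h : linearPart b v = S + N) :
    lieDer v = lieDer (linearField b S) + lieDer (linearField b N + higherOrderPart b v) := by
  rw [← lieDer_add, ← add_assoc, ← linearField_add, ← h, higherOrderPart, add_sub_cancel]

lemma lieDer_linearField_lie_lieDer_eq_zero {v : ι → MvPowerSeries ι ℝ} {S N : Module.End ℝ V}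
    (h : linearPart b v = S + N) (hSN : Commute S N)
    (hS : ⁅lieDer (linearField b S), lieDer (higherOrderPart b v)⁆ = 0) :
    ⁅lieDer (linearField b S), lieDer v⁆ = 0 := by
  ext1 f
  have commute_higherOrder := Derivation.congr_fun hS f
  have commute_nilpotent := Derivation.congr_fun (lieDer_linearField_lie_eq_zero b hSN) f
  rw [Derivation.commutator_apply, Derivation.zero_apply] at *
  simp only [lieDer_eq_add_of_linearPart_eq b h, lieDer_add, Derivation.add_apply, map_add]
  linear_combination commute_higherOrder + commute_nilpotent

end VectorFields

/-! ### Polynomials in operators -/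

section PolynomialsInOperators

open Polynomial

lemma exists_aeval_pow_eq_mul_add_mul {R A : Type*} [CommRing R] [Ring A] [Algebra R A] {x y : A}
    (h : Commute x y) (q : R[X]) (r : ℕ) :
    ∃ c d : A, aeval x q ^ r = c * aeval y q + (x - y) ^ r * d := by
  -- In the commutative subalgebra generated by `x` and `y`, the element `x - y` divides
  -- `q(x) - q(y)`.
  have := Algebra.isMulCommutative_adjoin R (s := {x, y}) (by
    simp only [Set.mem_insert_iff, Set.mem_singleton_iff]
    rintro _ (rfl | rfl) _ (rfl | rfl)
    exacts [rfl, h, h.symm, rfl])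
  let B := Algebra.adjoin R {x, y}
  let x' : B := ⟨x, Algebra.subset_adjoin (by simp)⟩
  let y' : B := ⟨y, Algebra.subset_adjoin (by simp)⟩
  open scoped IsMulCommutative in
  obtain ⟨u, hu⟩ : x' - y' ∣ aeval x' q - aeval y' q := by
    simpa [eval_map_algebraMap] using sub_dvd_eval_sub x' y' (q.map (algebraMap R B))
  open scoped IsMulCommutative in
  obtain ⟨c, hc⟩ : aeval y' q ∣ aeval x' q ^ r - ((x' - y') * u) ^ r := by
    rw [← hu]
    simpa using sub_dvd_pow_sub_pow (aeval x' q) (aeval x' q - aeval y' q) r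
  refine ⟨c, (u : A) ^ r, ?_⟩
  open scoped IsMulCommutative in
  rw [mul_pow, mul_comm (aeval y' q), sub_eq_iff_eq_add] at hc
  simpa [x', y', ← aeval_subalgebra_coe] using congrArg Subtype.val hc

variable {R M M' P : Type*} [CommRing R] [AddCommGroup M] [Module R M] [AddCommGroup M']
  [Module R M'] [AddCommGroup P] [Module R P]

lemma aeval_pow_apply_mem {T T' : Module.End R M} (h : Commute T T') {q : R[X]} {x : M}
    (hx : aeval T' q x = 0) {W : Submodule R M} {r : ℕ} (hW : ∀ y, ((T - T') ^ r) y ∈ W) :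
    aeval T (q ^ r) x ∈ W := by
  obtain ⟨c, d, hcd⟩ := exists_aeval_pow_eq_mul_add_mul h q r
  rw [map_pow, hcd, LinearMap.add_apply, Module.End.mul_apply, hx, map_zero, zero_add]
  exact hW _

lemma apply_aeval_of_intertwines {T : Module.End R M} {T' : Module.End R M'} {f : M →ₗ[R] M'}
    (h : ∀ x, f (T x) = T' (f x)) (q : R[X]) (x : M) : f (aeval T q x) = aeval T' q (f x) := by
  have apply_pow (n : ℕ) : f ((T ^ n) x) = (T' ^ n) (f x) := by
    simpa only [Module.End.pow_apply] using Function.Semiconj.iterate_right h n x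
  induction q using Polynomial.induction_on' with
  | add p q hp hq => simp [hp, hq]
  | monomial n a => simp [aeval_monomial, apply_pow]

lemma apply_aeval_of_adjoint {T : Module.End R M} {T' : Module.End R M'}
    {β : M →ₗ[R] M' →ₗ[R] P} (h : ∀ x y, β (T x) y = β x (T' y)) (q : R[X]) (x : M) (y : M') :
    β (aeval T q x) y = β x (aeval T' q y) := by
  have apply_pow (n : ℕ) (y : M') : β ((T ^ n) x) y = β x ((T' ^ n) y) := by
    induction n generalizing y with
    | zero => rfl
    | succ n ih => rw [pow_succ', Module.End.mul_apply, h, ih, pow_succ, Module.End.mul_apply]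
  induction q using Polynomial.induction_on' with
  | add p q hp hq => simp [hp, hq]
  | monomial n a => simp [aeval_monomial, apply_pow]

lemma aeval_dualMap (A : Module.End R M) (q : R[X]) : aeval A.dualMap q = (aeval A q).dualMap := by
  ext φ x
  exact apply_aeval_of_adjoint (β := LinearMap.id) (fun _ _ => rfl) q φ x

lemma isCoprime_X_of_isCoprime_comp_neg_X {q : R[X]} (hq : IsCoprime q (q.comp (-X))) :
    IsCoprime X q := by
  obtain ⟨a, c, h⟩ := hq
  have isUnit_coeff_zero : IsUnit (q.coeff 0) := IsUnit.of_mul_eq_one_right ((a + c).eval 0) (by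
    simpa [eval_comp, add_mul, coeff_zero_eq_eval_zero] using congrArg (eval 0) h)
  rw [← divX_mul_X_add q]
  exact (isCoprime_one_right.of_isCoprime_of_dvd_right
    (isUnit_coeff_zero.map C).dvd).mul_add_right_right _

lemma apply_eq_zero_of_aeval_mem {T : Module.End R M} {W : Submodule R M}
    (hW : W ≤ W.comap T) {β : M →ₗ[R] M →ₗ[R] P} (hβ : ∀ x y, β (T x) y = -β x (T y))
    (hβl : W ≤ LinearMap.ker β) (hβr : W ≤ LinearMap.ker β.flip) {q : R[X]}
    (hq : IsCoprime q (q.comp (-X))) {x y : M} (hx : aeval T q x ∈ W) (hy : aeval T q y ∈ W) :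
    β x y = 0 := by
  obtain ⟨a, c, hac⟩ := hq
  have decomposition :
      y = aeval T a (aeval T q y) + aeval T (q.comp (-X)) (aeval T c y) := by
    have := congrArg (fun p => aeval T p y) hac
    rw [mul_comm c] at this
    simpa using this.symm
  -- The form is skew for `T`, so the adjoint of `q(T)` is `q(-T)`.
  have adjoint (z : M) : β x (aeval T (q.comp (-X)) z) = β (aeval T q x) z := by
    rw [aeval_comp, map_neg, aeval_X]
    exact (apply_aeval_of_adjoint (T' := -T) (by simpa using hβ) q x z).symm
  have left : β (aeval T q x) = 0 := hβl hx
  have right : β.flip (aeval T a (aeval T q y)) = 0 :=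
    hβr (aeval_apply_smul_mem_of_le_comap hy a T hW)
  rw [decomposition, map_add, adjoint, left, LinearMap.zero_apply, add_zero]
  exact LinearMap.congr_fun right x

lemma mem_span_apply_sup_of_aeval_mem {T : Module.End R M} {W : Submodule R M}
    (hW : W ≤ W.comap T) {β : M →ₗ[R] M →ₗ[R] P} (hβ : ∀ x y, β (T x) y = -β x (T y))
    (hβl : W ≤ LinearMap.ker β) (hβr : W ≤ LinearMap.ker β.flip) {q : R[X]}
    (hq : IsCoprime q (q.comp (-X))) {x : M} (hx : aeval T q x ∈ W) :
    x ∈ Submodule.span R {z | ∃ y, β y z = 0 ∧ T y = z} ⊔ W := by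
  obtain ⟨a, c, hac⟩ := isCoprime_X_of_isCoprime_comp_neg_X hq
  have aeval_mem (p : R[X]) : aeval T q (aeval T p x) ∈ W := by
    rw [← Module.End.mul_apply, ← map_mul, mul_comm, map_mul, Module.End.mul_apply]
    exact aeval_apply_smul_mem_of_le_comap hx p T hW
  have decomposition : x = T (aeval T a x) + aeval T c (aeval T q x) := by
    have := congrArg (fun p => aeval T p x) hac
    rw [mul_comm a] at this
    simpa using this.symm
  have apply_eq : T (aeval T a x) = aeval T (X * a) x := by simp
  rw [decomposition]
  refine Submodule.add_mem_sup (Submodule.subset_span ⟨aeval T a x, ?_, rfl⟩)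
    (aeval_apply_smul_mem_of_le_comap hx c T hW)
  rw [apply_eq]
  exact apply_eq_zero_of_aeval_mem hW hβ hβl hβr hq (aeval_mem _) (aeval_mem _)

end PolynomialsInOperators

/-! ### The annihilator of the center space -/

section CenterSpace

open Polynomial

lemma exists_eq_mul_of_isConjRoot {K L : Type*} [Field K] [Field L] [Algebra K L] {P : L → Prop}
    (hP : ∀ z w, IsConjRoot K z w → P z → P w) {p : K[X]} (hp : p ≠ 0) :
    ∃ q r : K[X], p = q * r ∧ (∀ z, aeval z q = 0 → P z) ∧ ∀ z, aeval z r = 0 → ¬P z := by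
  induction p using UniqueFactorizationMonoid.induction_on_prime with
  | h₁ => exact absurd rfl hp
  | h₂ p hu =>
    exact ⟨p, 1, by simp, fun z hz => absurd hz (hu.map (aeval z)).ne_zero, by simp⟩
  | h₃ a p ha hprime ih =>
    obtain ⟨q, r, rfl, hq, hr⟩ := ih ha
    have isConjRoot {z w : L} (hz : aeval z p = 0) (hw : aeval w p = 0) : IsConjRoot K z w := by
      rw [isConjRoot_def, ← minpoly.eq_of_irreducible hprime.irreducible hz,
        ← minpoly.eq_of_irreducible hprime.irreducible hw]
    by_cases h : ∃ z, aeval z p = 0 ∧ P z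
    · obtain ⟨z, hz, hPz⟩ := h
      refine ⟨p * q, r, by ring, fun w hw => ?_, hr⟩
      rw [map_mul, mul_eq_zero] at hw
      exact hw.elim (fun hw => hP z w (isConjRoot hz hw) hPz) (hq w)
    · refine ⟨q, p * r, by ring, hq, fun w hw hPw => ?_⟩
      rw [map_mul, mul_eq_zero] at hw
      exact hw.elim (fun hw => h ⟨w, hw, hPw⟩) (fun hw => hr w hw hPw)

lemma re_eq_of_isConjRoot {z w : ℂ} (h : IsConjRoot ℝ z w) : z.re = w.re := by
  have : IsAlgClosure ℝ ℂ := ⟨inferInstance, inferInstance⟩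
  have : Normal ℝ ℂ := IsAlgClosure.normal ℝ ℂ
  obtain ⟨σ, rfl⟩ := isConjRoot_iff_exists_algEquiv.mp h
  change ((σ : ℂ →ₐ[ℝ] ℂ) w).re = w.re
  rcases Complex.real_algHom_eq_id_or_conj (σ : ℂ →ₐ[ℝ] ℂ) with h | h <;> simp [h]

lemma exists_eq_mul_of_re {p : ℝ[X]} (hp : p ≠ 0) : ∃ q₀ q₁ q₂ : ℝ[X], p = q₀ * (q₁ * q₂) ∧
    (∀ z : ℂ, aeval z q₀ = 0 → z.re = 0) ∧ (∀ z : ℂ, aeval z q₁ = 0 → 0 < z.re) ∧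
      ∀ z : ℂ, aeval z q₂ = 0 → z.re < 0 := by
  obtain ⟨q₀, r, rfl, h₀, hr⟩ := exists_eq_mul_of_isConjRoot
    (P := fun z : ℂ => z.re = 0) (fun z w h hz => re_eq_of_isConjRoot h ▸ hz) hp
  obtain ⟨q₁, q₂, rfl, h₁, h₂⟩ := exists_eq_mul_of_isConjRoot
    (P := fun z : ℂ => 0 < z.re) (fun z w h hz => re_eq_of_isConjRoot h ▸ hz)
    (right_ne_zero_of_mul hp)
  exact ⟨q₀, q₁, q₂, rfl, h₀, h₁, fun z hz =>
    (not_lt.mp (h₂ z hz)).lt_of_ne (hr z (by rw [map_mul, hz, mul_zero]))⟩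

lemma isCoprime_of_aeval_ne_zero {p q : ℝ[X]} (h : ∀ z : ℂ, aeval z p = 0 → aeval z q ≠ 0) :
    IsCoprime p q :=
  (isCoprime_iff_aeval_ne_zero_of_isAlgClosed ℝ ℂ p q).mpr fun z => not_or_of_imp (h z)

lemma isCoprime_comp_neg_X {q : ℝ[X]} (s : ℝ) (h : ∀ z : ℂ, aeval z q = 0 → 0 < s * z.re) :
    IsCoprime q (q.comp (-X)) := by
  refine isCoprime_of_aeval_ne_zero fun z hz hz' => ?_
  rw [aeval_comp, map_neg, aeval_X] at hz'
  have := h (-z) hz'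
  rw [Complex.neg_re] at this
  linarith [h z hz]

lemma ker_aeval_le_iSup_maxGenEigenspace {K M : Type*} [Field K] [IsAlgClosed K] [AddCommGroup M]
    [Module K M] [FiniteDimensional K M] (F : Module.End K M) (p : K[X]) :
    LinearMap.ker (aeval F p) ≤ ⨆ μ ∈ {μ | p.IsRoot μ}, F.maxGenEigenspace μ := by
  have invariant : ∀ x ∈ LinearMap.ker (aeval F p), F x ∈ LinearMap.ker (aeval F p) := by
    intro x hx
    have comm : aeval F (p * X) = aeval F (X * p) := by rw [mul_comm]
    simpa [LinearMap.mem_ker.mp hx] using LinearMap.congr_fun comm x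
  rw [Submodule.eq_iSup_inf_genEigenspace ⊤ invariant (Module.End.iSup_maxGenEigenspace_eq_top F)]
  refine iSup_le fun μ => ?_
  by_cases hμ : p.IsRoot μ
  · exact inf_le_right.trans (le_iSup₂_of_le (f := fun μ _ => F.maxGenEigenspace μ) μ hμ le_rfl)
  · rintro x ⟨hx, hxμ⟩
    obtain ⟨k, hk⟩ := F.mem_maxGenEigenspace μ x |>.mp hxμ
    have coprime : IsCoprime p ((X - C μ) ^ k) :=
      (((irreducible_X_sub_C μ).coprime_iff_not_dvd.mpr (mt dvd_iff_isRoot.mp hμ)).pow_left).symm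
    have hx' : x ∈ LinearMap.ker (aeval F ((X - C μ) ^ k)) := by
      simpa [Algebra.algebraMap_eq_smul_one] using hk
    rw [(Submodule.disjoint_def.mp (disjoint_ker_aeval_of_isCoprime F coprime)) x hx hx']
    exact zero_mem _

variable {V : Type*} [AddCommGroup V] [Module ℝ V]

lemma aeval_baseChange_tmul (A : Module.End ℝ V) (q : ℝ[X]) (x : V) :
    aeval (A.baseChange ℂ) (q.map (algebraMap ℝ ℂ)) ((1 : ℂ) ⊗ₜ[ℝ] x) =
      (1 : ℂ) ⊗ₜ[ℝ] aeval A q x := by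
  rw [aeval_map_algebraMap]
  exact LinearMap.congr_fun (aeval_algHom_apply (Module.End.baseChangeHom ℝ ℂ V) A q) _

lemma ker_aeval_le_centerSpace [FiniteDimensional ℝ V] (A : Module.End ℝ V) {q : ℝ[X]}
    (hq : ∀ z : ℂ, aeval z q = 0 → z.re = 0) : LinearMap.ker (aeval A q) ≤ centerSpace A := by
  intro x hx
  have mem_ker : (1 : ℂ) ⊗ₜ[ℝ] x ∈
      LinearMap.ker (aeval (A.baseChange ℂ) (q.map (algebraMap ℝ ℂ))) := by
    rw [LinearMap.mem_ker, aeval_baseChange_tmul, LinearMap.mem_ker.mp hx, tmul_zero]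
  have root_re (μ : ℂ) (hμ : μ ∈ {μ | (q.map (algebraMap ℝ ℂ)).IsRoot μ}) : μ.re = 0 :=
    hq μ (by simpa [IsRoot, eval_map_algebraMap] using hμ)
  exact (iSup₂_le fun μ hμ => le_iSup₂_of_le (f := fun μ (_ : μ ∈ {μ : ℂ | μ.re = 0}) =>
    Module.End.maxGenEigenspace (A.baseChange ℂ) μ) μ (root_re μ hμ) le_rfl :
      _ ≤ complexCenterSpace A) (ker_aeval_le_iSup_maxGenEigenspace _ _ mem_ker)

lemma dualAnnihilator_centerSpace_le [FiniteDimensional ℝ V] (A : Module.End ℝ V) :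
    ∃ q₁ q₂ : ℝ[X], IsCoprime q₁ (q₁.comp (-X)) ∧ IsCoprime q₂ (q₂.comp (-X)) ∧
      (centerSpace A).dualAnnihilator ≤
        LinearMap.ker (aeval A.dualMap q₁) ⊔ LinearMap.ker (aeval A.dualMap q₂) := by
  obtain ⟨q₀, q₁, q₂, hq, h₀, h₁, h₂⟩ := exists_eq_mul_of_re
    (minpoly.ne_zero (Algebra.IsIntegral.isIntegral (R := ℝ) A))
  have coprime : IsCoprime q₁ q₂ :=
    isCoprime_of_aeval_ne_zero fun z hz hz' => lt_asymm (h₁ z hz) (h₂ z hz')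
  refine ⟨q₁, q₂, isCoprime_comp_neg_X 1 (by simpa using h₁),
    isCoprime_comp_neg_X (-1) (by simpa using h₂), fun φ hφ => ?_⟩
  rw [sup_ker_aeval_eq_ker_aeval_mul_of_coprime _ coprime, LinearMap.mem_ker, aeval_dualMap]
  ext x
  refine (Submodule.mem_dualAnnihilator φ).mp hφ _ (ker_aeval_le_centerSpace A h₀ ?_)
  rw [LinearMap.mem_ker, ← Module.End.mul_apply, ← map_mul, ← hq, minpoly.aeval,
    LinearMap.zero_apply]

lemma exists_aeval_dualMap_pow_eq_zero {S N : Module.End ℝ V} (h : Commute S N)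
    (hN : IsNilpotent N) {q : ℝ[X]} {φ : Module.Dual ℝ V} (hφ : aeval (S + N).dualMap q φ = 0) :
    ∃ r, aeval S.dualMap (q ^ r) φ = 0 := by
  obtain ⟨r, hr⟩ := hN
  refine ⟨r, ?_⟩
  have commute : Commute (S.dualMap : Module.End ℝ (Module.Dual ℝ V)) (S + N).dualMap :=
    LinearMap.ext fun ψ => LinearMap.ext fun x =>
      congrArg ψ (LinearMap.congr_fun ((Commute.refl S).add_right h).eq.symm x)
  have sub_pow : ((S.dualMap - (S + N).dualMap : Module.End ℝ (Module.Dual ℝ V)) ^ r) = 0 := by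
    have sub_eq : S.dualMap - (S + N).dualMap = (-N).dualMap := by
      ext ψ x
      simp
    have pow_dualMap := aeval_dualMap (-N) (X ^ r)
    rw [map_pow, map_pow, aeval_X, aeval_X, neg_pow N, hr, mul_zero] at pow_dualMap
    rw [sub_eq, pow_dualMap]
    exact map_zero Module.Dual.transpose
  exact aeval_pow_apply_mem (W := ⊥) commute hφ fun ψ => by simp [sub_pow]

variable {ι : Type*} [Fintype ι] [DecidableEq ι] (b : Module.Basis ι ℝ V)

lemma exists_aeval_lieDer_linearSeries_mem {v : ι → MvPowerSeries ι ℝ}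
    (hv : ∀ i, MvPowerSeries.constantCoeff (v i) = 0) {S N : Module.End ℝ V}
    (h : linearPart b v = S + N) (hSN : Commute S N) (hN : IsNilpotent N)
    (hS : ⁅lieDer (linearField b S), lieDer (higherOrderPart b v)⁆ = 0) {q : ℝ[X]}
    {φ : Module.Dual ℝ V} (hφ : aeval (linearPart b v).dualMap q φ = 0) (k : ℕ) :
    ∃ r, aeval (lieDer v).toLinearMap (q ^ r) (linearSeries b φ) ∈ coordIdeal ι ℝ ^ k := by
  have commute : Commute (lieDer v).toLinearMap (lieDer (linearField b S)).toLinearMap := by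
    ext1 f
    have := Derivation.congr_fun (lieDer_linearField_lie_lieDer_eq_zero b h hSN hS) f
    rw [Derivation.commutator_apply, Derivation.zero_apply, sub_eq_zero] at this
    exact this.symm
  have sub_eq : (lieDer v).toLinearMap - (lieDer (linearField b S)).toLinearMap =
      (lieDer (linearField b N + higherOrderPart b v)).toLinearMap := by
    rw [lieDer_eq_add_of_linearPart_eq b h]
    ext1 f
    simp
  obtain ⟨r₁, hr₁⟩ := exists_aeval_dualMap_pow_eq_zero hSN hN (h ▸ hφ)
  have aeval_semisimple :
      aeval (lieDer (linearField b S)).toLinearMap (q ^ r₁) (linearSeries b φ) = 0 := by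
    rw [← apply_aeval_of_intertwines (f := linearSeries b)
      (fun ψ => (lieDer_linearField_linearSeries b S ψ).symm), hr₁, map_zero]
  obtain ⟨r₂, hr₂⟩ :=
    exists_iterate_lieDer_mem_pow b (higherOrderPart_mem_coordIdeal_sq b hv) hN k
  refine ⟨r₁ * r₂, ?_⟩
  rw [pow_mul]
  refine aeval_pow_apply_mem (W := (coordIdeal ι ℝ ^ k).restrictScalars ℝ) commute
    aeval_semisimple fun f => ?_
  rw [sub_eq, Module.End.pow_apply]
  exact hr₂ f

theorem linearSeries_mem_span_lieDer_sup {v : ι → MvPowerSeries ι ℝ}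
    (hv : ∀ i, MvPowerSeries.constantCoeff (v i) = 0) {S N : Module.End ℝ V}
    (h : linearPart b v = S + N) (hSN : Commute S N) (hN : IsNilpotent N)
    (hS : ⁅lieDer (linearField b S), lieDer (higherOrderPart b v)⁆ = 0)
    {β : MvPowerSeries ι ℝ →ₗ[ℝ] MvPowerSeries ι ℝ →ₗ[ℝ] ℝ}
    (hβ : ∀ f g, β (lieDer v f) g = -β f (lieDer v g)) {m : ℕ}
    (hβl : (coordIdeal ι ℝ ^ m).restrictScalars ℝ ≤ LinearMap.ker β)
    (hβr : (coordIdeal ι ℝ ^ m).restrictScalars ℝ ≤ LinearMap.ker β.flip)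
    {φ : Module.Dual ℝ V} (hφ : φ ∈ (centerSpace (linearPart b v)).dualAnnihilator) (k : ℕ) :
    linearSeries b φ ∈ Submodule.span ℝ {f | ∃ g, β g f = 0 ∧ lieDer v g = f} ⊔
      (coordIdeal ι ℝ ^ k).restrictScalars ℝ := by
  have : FiniteDimensional ℝ V := b.finiteDimensional_of_finite
  let W := (coordIdeal ι ℝ ^ max m k).restrictScalars ℝ
  have hWm : W ≤ (coordIdeal ι ℝ ^ m).restrictScalars ℝ := Ideal.pow_le_pow_right (le_max_left m k)
  have hWk : W ≤ (coordIdeal ι ℝ ^ k).restrictScalars ℝ :=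
    Ideal.pow_le_pow_right (le_max_right m k)
  have invariant : W ≤ W.comap (lieDer v).toLinearMap := derivation_mem_pow
    (fun f _ => lieDer_mem (fun i => mem_coordIdeal.mpr (hv i)) f) (max m k)
  have mem_of_aeval_eq_zero {q : ℝ[X]} (hq : IsCoprime q (q.comp (-X))) {ψ : Module.Dual ℝ V}
      (hψ : aeval (linearPart b v).dualMap q ψ = 0) :
      linearSeries b ψ ∈ Submodule.span ℝ {f | ∃ g, β g f = 0 ∧ lieDer v g = f} ⊔ W := by
    obtain ⟨r, hr⟩ := exists_aeval_lieDer_linearSeries_mem b hv h hSN hN hS hψ (max m k)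
    refine mem_span_apply_sup_of_aeval_mem invariant hβ (hWm.trans hβl) (hWm.trans hβr)
      (q := q ^ r) ?_ hr
    rw [pow_comp]
    exact hq.pow
  obtain ⟨q₁, q₂, hq₁, hq₂, hle⟩ := dualAnnihilator_centerSpace_le (linearPart b v)
  obtain ⟨φ₁, hφ₁, φ₂, hφ₂, rfl⟩ := Submodule.mem_sup.mp (hle hφ)
  rw [map_add]
  exact sup_le_sup_left hWk _
    (add_mem (mem_of_aeval_eq_zero hq₁ hφ₁) (mem_of_aeval_eq_zero hq₂ hφ₂))

end CenterSpace

/-! ### Filtration of the jet algebras -/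

section JetIdeal

variable {ι : Type*} {𝔨 : Type*} [LieRing 𝔨] [LieAlgebra ℝ 𝔨]

lemma jetCoeff_tmul (n : ι →₀ ℕ) (f : MvPowerSeries ι ℝ) (X : 𝔨) :
    jetCoeff n (f ⊗ₜ[ℝ] X) = MvPowerSeries.coeff n f • X := by
  simp [jetCoeff]

lemma coeff_equivFinsuppOfBasisRight {κ : Type*} [DecidableEq κ] (e : Module.Basis κ ℝ 𝔨)
    (ξ : JetAlg ι 𝔨) (n : ι →₀ ℕ) (i : κ) :
    MvPowerSeries.coeff n (TensorProduct.equivFinsuppOfBasisRight e ξ i) =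
      e.repr (jetCoeff n ξ) i := by
  induction ξ using TensorProduct.induction_on with
  | zero => simp
  | add x y hx hy => simp [hx, hy]
  | tmul f X => simp [jetCoeff_tmul, mul_comm]

lemma jet_ext {ξ η : JetAlg ι 𝔨} (h : ∀ n, jetCoeff n ξ = jetCoeff n η) : ξ = η := by
  classical
  let e := Module.Free.chooseBasis ℝ 𝔨
  refine (TensorProduct.equivFinsuppOfBasisRight e).injective ?_
  ext i n
  rw [coeff_equivFinsuppOfBasisRight, coeff_equivFinsuppOfBasisRight, h]

/-- The ideal `I ⊗ 𝔨` of `R ⊗ 𝔨` for an ideal `I` of the ring `R` of formal power series. -/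
noncomputable def jetIdeal (𝔨 : Type*) [LieRing 𝔨] [LieAlgebra ℝ 𝔨]
    (I : Ideal (MvPowerSeries ι ℝ)) : Submodule ℝ (JetAlg ι 𝔨) :=
  Submodule.map₂ (TensorProduct.mk ℝ (MvPowerSeries ι ℝ) 𝔨) (I.restrictScalars ℝ) ⊤

variable {I J : Ideal (MvPowerSeries ι ℝ)}

lemma tmul_mem_jetIdeal {f : MvPowerSeries ι ℝ} (hf : f ∈ I) (X : 𝔨) :
    f ⊗ₜ[ℝ] X ∈ jetIdeal 𝔨 I :=
  Submodule.apply_mem_map₂ _ hf Submodule.mem_top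

lemma jetIdeal_le {W : Submodule ℝ (JetAlg ι 𝔨)} :
    jetIdeal 𝔨 I ≤ W ↔ ∀ f ∈ I, ∀ X : 𝔨, f ⊗ₜ[ℝ] X ∈ W := by
  simp [jetIdeal, Submodule.map₂_le]

lemma jetIdeal_mono (h : I ≤ J) : jetIdeal 𝔨 I ≤ jetIdeal 𝔨 J :=
  jetIdeal_le.mpr fun _ hf => tmul_mem_jetIdeal (h hf)

lemma mem_jetIdeal_coordIdeal_pow [Finite ι] {k : ℕ} {ξ : JetAlg ι 𝔨} :
    ξ ∈ jetIdeal 𝔨 (coordIdeal ι ℝ ^ k) ↔ ∀ n, n.degree < k → jetCoeff n ξ = 0 := by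
  classical
  refine ⟨fun h n hn => LinearMap.mem_ker.mp (jetIdeal_le.mpr (fun f hf X => ?_) h), fun h => ?_⟩
  · have hf : (k : ℕ∞) ≤ f.order := mem_coordIdeal_pow.mp hf
    rw [LinearMap.mem_ker, jetCoeff_tmul,
      MvPowerSeries.coeff_of_lt_order (lt_of_lt_of_le (Nat.cast_lt.mpr hn) hf), zero_smul]
  · let e := Module.Free.chooseBasis ℝ 𝔨
    rw [← (TensorProduct.equivFinsuppOfBasisRight e).symm_apply_apply ξ,
      TensorProduct.equivFinsuppOfBasisRight_symm_apply]
    refine sum_mem fun i _ => tmul_mem_jetIdeal ?_ _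
    refine mem_coordIdeal_pow.mpr (MvPowerSeries.nat_le_order fun n hn => ?_)
    rw [coeff_equivFinsuppOfBasisRight, h n hn, map_zero, Finsupp.zero_apply]

lemma lie_mem_jetIdeal {ξ : JetAlg ι 𝔨} (hξ : ξ ∈ jetIdeal 𝔨 I) (η : JetAlg ι 𝔨) :
    ⁅ξ, η⁆ ∈ jetIdeal 𝔨 I := by
  rw [← lie_skew]
  refine neg_mem (jetIdeal_le (W := (jetIdeal 𝔨 I).comap (LieAlgebra.ad ℝ (JetAlg ι 𝔨) η)).mpr
    (fun f hf X => ?_) hξ)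
  rw [Submodule.mem_comap, LieAlgebra.ad_apply]
  induction η using TensorProduct.induction_on with
  | zero => rw [zero_lie]; exact zero_mem _
  | add x y hx hy => rw [add_lie]; exact add_mem hx hy
  | tmul g Y =>
    rw [LieAlgebra.ExtendScalars.bracket_tmul]
    exact tmul_mem_jetIdeal (I.mul_mem_left g hf) _

variable [Fintype ι] {v : ι → MvPowerSeries ι ℝ} {σ : JetAlg ι 𝔨}

lemma jetDerivation_tmul (f : MvPowerSeries ι ℝ) (X : 𝔨) :
    jetDerivation v σ (f ⊗ₜ[ℝ] X) = -(lieDer v f ⊗ₜ[ℝ] X) + ⁅σ, f ⊗ₜ[ℝ] X⁆ := by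
  simp [jetDerivation]

lemma jetDerivation_mem_jetIdeal (hI : ∀ f ∈ I, lieDer v f ∈ I) {ξ : JetAlg ι 𝔨}
    (hξ : ξ ∈ jetIdeal 𝔨 I) : jetDerivation v σ ξ ∈ jetIdeal 𝔨 I := by
  refine jetIdeal_le (W := (jetIdeal 𝔨 I).comap (jetDerivation v σ).toLinearMap).mpr
    (fun f hf X => ?_) hξ
  change jetDerivation v σ (f ⊗ₜ[ℝ] X) ∈ jetIdeal 𝔨 I
  rw [jetDerivation_tmul, ← lie_skew σ]
  exact add_mem (neg_mem (tmul_mem_jetIdeal (hI f hf) X))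
    (neg_mem (lie_mem_jetIdeal (tmul_mem_jetIdeal hf X) σ))

lemma lie_jetIncl (ξ : JetAlg ι 𝔨) (y : JetSharp v σ) :
    ⁅jetIncl v σ ξ, y⁆ = jetIncl v σ (⁅ξ, y.left⁆ - y.right • jetDerivation v σ ξ) := by
  let D := jetDerivation v σ
  change (⟨⁅ξ, y.left⁆ + oneParamAction D 0 y.left - y.right • D ξ, ⁅(0 : ℝ), y.right⁆⟩ :
    JetSharp v σ) = ⟨⁅ξ, y.left⁆ - y.right • D ξ, 0⟩
  rw [map_zero, LieDerivation.zero_apply, add_zero, zero_lie]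

end JetIdeal

/-! ### Topology of the jet algebras and their extensions -/

section Topology

section Jets

variable {ι : Type*} {𝔨 : Type*} [LieRing 𝔨] [LieAlgebra ℝ 𝔨] [TopologicalSpace 𝔨]

lemma isInducing_jetCoeff :
    IsInducing (LinearMap.pi jetCoeff : JetAlg ι 𝔨 →ₗ[ℝ] (ι →₀ ℕ) → 𝔨) := ⟨rfl⟩

lemma continuous_jetCoeff (n : ι →₀ ℕ) : Continuous (jetCoeff n : JetAlg ι 𝔨 → 𝔨) :=
  (continuous_apply n).comp isInducing_jetCoeff.continuous

instance [IsTopologicalAddGroup 𝔨] : IsTopologicalAddGroup (JetAlg ι 𝔨) :=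
  isInducing_jetCoeff.topologicalAddGroup

instance [ContinuousSMul ℝ 𝔨] : ContinuousSMul ℝ (JetAlg ι 𝔨) :=
  isInducing_jetCoeff.continuousSMul continuous_id fun {r ξ} => map_smul _ r ξ

instance [LocallyConvexSpace ℝ 𝔨] : LocallyConvexSpace ℝ (JetAlg ι 𝔨) :=
  isInducing_jetCoeff.locallyConvexSpace

instance [T2Space 𝔨] : T2Space (JetAlg ι 𝔨) :=
  T2Space.of_injective_continuous (fun _ _ h => jet_ext (congrFun h))
    isInducing_jetCoeff.continuous

lemma exists_jetIdeal_subset [Finite ι] {U : Set (JetAlg ι 𝔨)} (hU : U ∈ 𝓝 0) :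
    ∃ k, (jetIdeal 𝔨 (coordIdeal ι ℝ ^ k) : Set (JetAlg ι 𝔨)) ⊆ U := by
  rw [isInducing_jetCoeff.nhds_eq_comap, mem_comap] at hU
  obtain ⟨W, hW, hWU⟩ := hU
  rw [map_zero, nhds_pi, Filter.mem_pi] at hW
  obtain ⟨s, hs, t, ht, htW⟩ := hW
  obtain ⟨k, hk⟩ := (hs.image Finsupp.degree).bddAbove
  refine ⟨k + 1, fun ξ hξ => hWU (htW fun n hn => ?_)⟩
  have hn0 : jetCoeff n ξ = 0 :=
    mem_jetIdeal_coordIdeal_pow.mp hξ n (Nat.lt_succ_of_le (hk ⟨n, hn, rfl⟩))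
  rw [LinearMap.pi_apply, hn0]
  exact mem_of_mem_nhds (ht n)

lemma map_eq_zero_of_forall_norm_lt {E G : Type*} [AddCommGroup E] [Module ℝ E]
    [NormedAddCommGroup G] [NormedSpace ℝ G] {W : Submodule ℝ E} {f : E →ₗ[ℝ] G} {r : ℝ}
    (h : ∀ x ∈ W, ‖f x‖ < r) {x : E} (hx : x ∈ W) : f x = 0 := by
  by_contra hne
  have := h _ (W.smul_mem (r * ‖f x‖⁻¹) hx)
  rw [map_smul, norm_smul, norm_mul, norm_inv, norm_norm, mul_assoc,
    inv_mul_cancel₀ (norm_ne_zero_iff.mpr hne), mul_one] at this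
  exact (Real.le_norm_self r).not_gt this

lemma exists_jetIdeal_map_eq_zero [Finite ι] {G : Type*} [NormedAddCommGroup G] [NormedSpace ℝ G]
    (f : JetAlg ι 𝔨 →L[ℝ] G) : ∃ k, ∀ ξ ∈ jetIdeal 𝔨 (coordIdeal ι ℝ ^ k), f ξ = 0 := by
  obtain ⟨k, hk⟩ := exists_jetIdeal_subset
    (f.continuous.continuousAt.preimage_mem_nhds (Metric.ball_mem_nhds (f 0) one_pos))
  refine ⟨k, fun ξ hξ => map_eq_zero_of_forall_norm_lt (f := f.toLinearMap) (r := 1)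
    (fun x hx => ?_) hξ⟩
  simpa using hk hx

lemma exists_jetIdeal_map₂_eq_zero [Finite ι] {E G : Type*} [AddCommGroup E] [Module ℝ E]
    [TopologicalSpace E] [ContinuousSMul ℝ E] [NormedAddCommGroup G] [NormedSpace ℝ G]
    (B : JetAlg ι 𝔨 →ₗ[ℝ] E →ₗ[ℝ] G) (hB : Continuous fun p : JetAlg ι 𝔨 × E => B p.1 p.2) :
    ∃ k, ∀ ξ ∈ jetIdeal 𝔨 (coordIdeal ι ℝ ^ k), B ξ = 0 := by
  have hball : {p : JetAlg ι 𝔨 × E | ‖B p.1 p.2‖ < 1} ∈ 𝓝 ((0, 0) : JetAlg ι 𝔨 × E) :=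
    (isOpen_lt hB.norm continuous_const).mem_nhds (by simp)
  obtain ⟨U, hU, U', hU', hUU⟩ := mem_nhds_prod_iff.mp hball
  obtain ⟨k, hk⟩ := exists_jetIdeal_subset hU
  refine ⟨k, fun ξ hξ => ?_⟩
  have eq_zero_on_nhds (y : E) (hy : y ∈ U') : B ξ y = 0 :=
    map_eq_zero_of_forall_norm_lt (f := B.flip y) (fun x hx => hUU (Set.mk_mem_prod (hk hx) hy)) hξ
  ext y
  obtain ⟨t, ht, hty⟩ := ((absorbent_nhds_zero (𝕜 := ℝ) hU').eventually_nhdsNE_zero y).and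
    self_mem_nhdsWithin |>.exists
  have := eq_zero_on_nhds _ ht
  rwa [map_smul, smul_eq_zero_iff_right hty] at this

end Jets

section SemiDirectSum

variable {𝔤 𝔭 : Type*} [LieRing 𝔤] [LieAlgebra ℝ 𝔤] [LieRing 𝔭] [LieAlgebra ℝ 𝔭]
  [TopologicalSpace 𝔤] [TopologicalSpace 𝔭] {D : 𝔭 →ₗ⁅ℝ⁆ LieDerivation ℝ 𝔤 𝔤}

lemma isInducing_toProdl : IsInducing (LieAlgebra.SemiDirectSum.toProdl D) := ⟨rfl⟩

instance [IsTopologicalAddGroup 𝔤] [IsTopologicalAddGroup 𝔭] :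
    IsTopologicalAddGroup (LieAlgebra.SemiDirectSum 𝔤 𝔭 D) :=
  isInducing_toProdl.topologicalAddGroup

instance [ContinuousSMul ℝ 𝔤] [ContinuousSMul ℝ 𝔭] :
    ContinuousSMul ℝ (LieAlgebra.SemiDirectSum 𝔤 𝔭 D) :=
  isInducing_toProdl.continuousSMul continuous_id fun {r x} => map_smul _ r x

instance [LocallyConvexSpace ℝ 𝔤] [LocallyConvexSpace ℝ 𝔭] :
    LocallyConvexSpace ℝ (LieAlgebra.SemiDirectSum 𝔤 𝔭 D) :=
  isInducing_toProdl.locallyConvexSpace (f := (LieAlgebra.SemiDirectSum.toProdl D).toLinearMap)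

instance [T2Space 𝔤] [T2Space 𝔭] : T2Space (LieAlgebra.SemiDirectSum 𝔤 𝔭 D) :=
  T2Space.of_injective_continuous (LieAlgebra.SemiDirectSum.toProdl D).injective
    isInducing_toProdl.continuous

lemma continuous_inl : Continuous (LieAlgebra.SemiDirectSum.inl D) :=
  isInducing_toProdl.continuous_iff.mpr (continuous_id.prodMk continuous_const)

end SemiDirectSum

section CentralExtension

variable {𝔥 : Type*} [LieRing 𝔥] [LieAlgebra ℝ 𝔥]

lemma lie_centralMk (ω : ScalarCocycle 𝔥) (x y : 𝔥) (a b : ℝ) :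
    ⁅centralMk ω x a, centralMk ω y b⁆ =
      centralMk ω ⁅x, y⁆ (TrivialLieModule.equiv ℝ 𝔥 ℝ (ω.1 x y)) := by
  have lie_eq_zero (x : 𝔥) (z : TrivialLieModule ℝ 𝔥 ℝ) : ⁅x, z⁆ = 0 := trivial_lie_zero _ _ x z
  simp [centralMk, LieAlgebra.bracket_ofTwoCocycle, LieAlgebra.ofProd, lie_eq_zero]

/-- The linear coordinates `(ξ, z)` of the central extension of `𝔥` by `ℝ` defined by `ω`. -/
noncomputable def centralProd (ω : ScalarCocycle 𝔥) : LieAlgebra.ofTwoCocycle ω ≃ₗ[ℝ] 𝔥 × ℝ where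
  toFun x := (x.carrier.1, TrivialLieModule.equiv ℝ 𝔥 ℝ x.carrier.2)
  invFun p := centralMk ω p.1 p.2
  map_add' _ _ := rfl
  map_smul' _ _ := rfl
  left_inv _ := rfl
  right_inv _ := rfl

lemma centralProd_symm_apply (ω : ScalarCocycle 𝔥) (p : 𝔥 × ℝ) :
    (centralProd ω).symm p = centralMk ω p.1 p.2 := rfl

variable [TopologicalSpace 𝔥] {ω : ScalarCocycle 𝔥}

lemma isInducing_centralProd : IsInducing (centralProd ω) := ⟨rfl⟩

instance [IsTopologicalAddGroup 𝔥] : IsTopologicalAddGroup (LieAlgebra.ofTwoCocycle ω) :=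
  isInducing_centralProd.topologicalAddGroup

instance [ContinuousSMul ℝ 𝔥] : ContinuousSMul ℝ (LieAlgebra.ofTwoCocycle ω) :=
  isInducing_centralProd.continuousSMul continuous_id fun {r x} => map_smul _ r x

instance [LocallyConvexSpace ℝ 𝔥] : LocallyConvexSpace ℝ (LieAlgebra.ofTwoCocycle ω) :=
  isInducing_centralProd.locallyConvexSpace (f := (centralProd ω).toLinearMap)

instance [T2Space 𝔥] : T2Space (LieAlgebra.ofTwoCocycle ω) :=
  T2Space.of_injective_continuous (centralProd ω).injective isInducing_centralProd.continuous

end CentralExtension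

end Topology

/-! ### Finite-dimensional quotients of the central extension -/

section FiniteFactor

lemma locallyConvexSpace_of_finiteDimensional (E : Type*) [AddCommGroup E] [Module ℝ E]
    [TopologicalSpace E] [IsTopologicalAddGroup E] [ContinuousSMul ℝ E] [T2Space E]
    [FiniteDimensional ℝ E] : LocallyConvexSpace ℝ E :=
  let e : E ≃L[ℝ] (Fin (Module.finrank ℝ E) → ℝ) := .ofFinrankEq (Module.finrank_fin_fun ℝ).symm
  IsInducing.locallyConvexSpace (f := e.toLinearMap) e.toHomeomorph.isInducing

lemma HasFiniteFactor.of_finiteDimensional {E F : Type*} [LieRing E] [LieAlgebra ℝ E]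
    [TopologicalSpace E] [AddCommGroup F] [Module ℝ F] [TopologicalSpace F]
    [IsTopologicalAddGroup F] [ContinuousSMul ℝ F] [T2Space F] [FiniteDimensional ℝ F]
    {l : E →L[ℝ] ℝ} (p : E →L[ℝ] F) (hp : ∀ x y, p x = 0 → p ⁅x, y⁆ = 0)
    (hl : ∀ x, p x = 0 → l x = 0) : HasFiniteFactor l := by
  let e : F ≃L[ℝ] (Fin (Module.finrank ℝ F) → ℝ) := .ofFinrankEq (Module.finrank_fin_fun ℝ).symm
  exact ⟨_, (e : F →L[ℝ] Fin (Module.finrank ℝ F) → ℝ).comp p, by simpa using hp, by simpa using hl⟩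

variable {ι : Type*} {𝔨 : Type*} [LieRing 𝔨] [LieAlgebra ℝ 𝔨] [TopologicalSpace 𝔨]

/-- The truncation of a `𝔨`-valued formal power series: its coefficients of degree less than `k`. -/
noncomputable def jetTrunc (k : ℕ) : JetAlg ι 𝔨 →L[ℝ] ({n : ι →₀ ℕ | n.degree < k} → 𝔨) where
  toLinearMap := LinearMap.pi fun n => jetCoeff n
  cont := continuous_pi fun n => continuous_jetCoeff (n : ι →₀ ℕ)

lemma jetTrunc_eq_zero [Finite ι] {k : ℕ} {ξ : JetAlg ι 𝔨} :
    jetTrunc k ξ = 0 ↔ ξ ∈ jetIdeal 𝔨 (coordIdeal ι ℝ ^ k) := by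
  rw [mem_jetIdeal_coordIdeal_pow, funext_iff]
  exact Subtype.forall

variable [Fintype ι] {v : ι → MvPowerSeries ι ℝ} {σ : JetAlg ι 𝔨} {ω : ScalarCocycle (JetSharp v σ)}

lemma continuous_jetIncl : Continuous (jetIncl v σ) := continuous_inl

/-- The truncation of an element of the central extension of `(R ⊗ 𝔨) ⋊ ℝ`: the coefficients of
degree less than `k` of its component in `R ⊗ 𝔨`, and the two scalar components. -/
noncomputable def centralTrunc (ω : ScalarCocycle (JetSharp v σ)) (k : ℕ) :
    LieAlgebra.ofTwoCocycle ω →L[ℝ] (({n : ι →₀ ℕ | n.degree < k} → 𝔨) × ℝ) × ℝ where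
  toLinearMap := (((jetTrunc k).toLinearMap.prodMap LinearMap.id ∘ₗ
    (LieAlgebra.SemiDirectSum.toProdl _).toLinearMap).prodMap LinearMap.id) ∘ₗ
      (centralProd ω).toLinearMap
  cont := (((jetTrunc k).continuous.prodMap continuous_id).comp
    isInducing_toProdl.continuous).prodMap continuous_id |>.comp isInducing_centralProd.continuous

lemma centralTrunc_eq_zero {k : ℕ} {x : LieAlgebra.ofTwoCocycle ω} :
    centralTrunc ω k x = 0 ↔
      ∃ ξ ∈ jetIdeal 𝔨 (coordIdeal ι ℝ ^ k), centralMk ω (jetIncl v σ ξ) 0 = x := by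
  constructor
  · obtain ⟨⟨⟨ξ, t⟩, z⟩⟩ := x
    intro h
    obtain ⟨hξt, hz⟩ := Prod.mk_eq_zero.mp h
    obtain ⟨hξ, ht⟩ := Prod.mk_eq_zero.mp hξt
    obtain rfl : t = 0 := ht
    obtain rfl : z = 0 := hz
    exact ⟨ξ, jetTrunc_eq_zero.mp hξ, rfl⟩
  · rintro ⟨ξ, hξ, rfl⟩
    exact Prod.ext (Prod.ext (jetTrunc_eq_zero.mpr hξ) rfl) rfl

lemma exists_jetIdeal_cocycle_eq_zero [ContinuousSMul ℝ 𝔨] (hω : IsContinuousCocycle ω) :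
    ∃ k, ∀ ξ ∈ jetIdeal 𝔨 (coordIdeal ι ℝ ^ k), ω.1 (jetIncl v σ ξ) = 0 := by
  let B : JetAlg ι 𝔨 →ₗ[ℝ] JetSharp v σ →ₗ[ℝ] ℝ :=
    (ω.1.1.compr₂ (TrivialLieModule.equiv ℝ (JetSharp v σ) ℝ).toLinearMap) ∘ₗ
      (jetIncl v σ : JetAlg ι 𝔨 →ₗ[ℝ] JetSharp v σ)
  obtain ⟨k, hk⟩ := exists_jetIdeal_map₂_eq_zero B
    (hω.comp (continuous_jetIncl.prodMap continuous_id))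
  refine ⟨k, fun ξ hξ => LinearMap.ext fun y => ?_⟩
  exact (TrivialLieModule.equiv ℝ (JetSharp v σ) ℝ).map_eq_zero_iff.mp
    (LinearMap.congr_fun (hk ξ hξ) y)

lemma centralTrunc_lie_eq_zero (hv : ∀ i, v i ∈ coordIdeal ι ℝ) {k : ℕ}
    (hk : ∀ ξ ∈ jetIdeal 𝔨 (coordIdeal ι ℝ ^ k), ω.1 (jetIncl v σ ξ) = 0)
    (x y : LieAlgebra.ofTwoCocycle ω) (hx : centralTrunc ω k x = 0) :
    centralTrunc ω k ⁅x, y⁆ = 0 := by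
  obtain ⟨ξ, hξ, rfl⟩ := centralTrunc_eq_zero.mp hx
  obtain ⟨⟨y, a⟩, rfl⟩ := (centralProd ω).symm.surjective y
  rw [centralProd_symm_apply, lie_centralMk, hk ξ hξ, LinearMap.zero_apply, map_zero, lie_jetIncl]
  exact centralTrunc_eq_zero.mpr ⟨_, sub_mem (lie_mem_jetIdeal hξ _) (Submodule.smul_mem _ _
    (jetDerivation_mem_jetIdeal (derivation_mem_pow (fun f _ => lieDer_mem hv f) k) hξ)),
    rfl⟩

lemma hasFiniteFactor_central [IsTopologicalAddGroup 𝔨] [ContinuousSMul ℝ 𝔨] [T2Space 𝔨]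
    [Module.Finite ℝ 𝔨] (hv : ∀ i, v i ∈ coordIdeal ι ℝ) (hω : IsContinuousCocycle ω)
    (l : LieAlgebra.ofTwoCocycle ω →L[ℝ] ℝ) : HasFiniteFactor l := by
  obtain ⟨k₁, hk₁⟩ := exists_jetIdeal_cocycle_eq_zero hω
  let i : JetAlg ι 𝔨 →L[ℝ] LieAlgebra.ofTwoCocycle ω :=
    { toLinearMap := (centralProd ω).symm.toLinearMap ∘ₗ LinearMap.inl ℝ (JetSharp v σ) ℝ ∘ₗ
        (jetIncl v σ : JetAlg ι 𝔨 →ₗ[ℝ] JetSharp v σ)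
      cont := isInducing_centralProd.continuous_iff.mpr
        (continuous_jetIncl.prodMk continuous_const) }
  obtain ⟨k₂, hk₂⟩ := exists_jetIdeal_map_eq_zero (l.comp i)
  have : Finite {n : ι →₀ ℕ | n.degree < max k₁ k₂} := Finsupp.finite_of_degree_lt _
  refine .of_finiteDimensional (centralTrunc ω (max k₁ k₂))
    (centralTrunc_lie_eq_zero hv fun ξ hξ =>
      hk₁ ξ (jetIdeal_mono (Ideal.pow_le_pow_right (le_max_left _ _)) hξ)) fun x hx => ?_
  obtain ⟨ξ, hξ, rfl⟩ := centralTrunc_eq_zero.mp hx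
  exact hk₂ ξ (jetIdeal_mono (Ideal.pow_le_pow_right (le_max_right _ _)) hξ)

end FiniteFactor

/-! ### Projective representations -/

section ProjRep

variable {𝓓 : Type*} [NormedAddCommGroup 𝓓] [InnerProductSpace ℂ 𝓓]

lemma mem_imaginaryScalars_of_eq_smul {X : skewOps 𝓓} {c : ℂ}
    (hX : (X : Module.End ℂ 𝓓) = c • 1) : X ∈ imaginaryScalars 𝓓 := by
  rcases subsingleton_or_nontrivial 𝓓 with _ | _
  · exact ⟨0, Subsingleton.elim _ _⟩
  obtain ⟨ψ, hψ⟩ := exists_ne (0 : 𝓓)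
  have conj_eq_neg : (starRingEnd ℂ) c = -c := by
    have h := X.2 ψ ψ
    rw [hX, LinearMap.smul_apply, Module.End.one_apply, inner_smul_left, inner_smul_right,
      ← neg_mul] at h
    exact mul_right_cancel₀ (inner_self_ne_zero.mpr hψ) h
  have re_eq_zero : c.re = 0 := by
    have := congrArg Complex.re conj_eq_neg
    rw [Complex.conj_re, Complex.neg_re] at this
    linarith
  refine ⟨c.im, hX.trans ?_⟩
  congr 1
  exact Complex.ext (by simp [re_eq_zero]) (by simp)

lemma eq_zero_of_forall_rayAction_eq_zero {x : projSkewOps 𝓓}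
    (h : ∀ ψ ≠ 0, rayAction ψ x = 0) : x = 0 := by
  obtain ⟨X, rfl⟩ := Submodule.Quotient.mk_surjective _ x
  obtain ⟨c, hc⟩ := LinearMap.exists_eq_smul_id_of_forall_notLinearIndependent
    (f := (X : Module.End ℂ 𝓓)) fun ψ hψ => by
      have hray : (X : Module.End ℂ 𝓓) ψ ∈ ℂ ∙ ψ :=
        (Submodule.Quotient.mk_eq_zero _).mp (h ψ (hψ.ne_zero 0))
      obtain ⟨c, hc⟩ := Submodule.mem_span_singleton.mp hray
      have := LinearIndependent.pair_iff.mp hψ c (-1) (by rw [hc, neg_one_smul, add_neg_cancel])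
      exact one_ne_zero (neg_eq_zero.mp this.2)
  exact (Submodule.Quotient.mk_eq_zero _).mpr (mem_imaginaryScalars_of_eq_smul hc)

variable {𝔤 𝔥 : Type*} [LieRing 𝔤] [LieAlgebra ℝ 𝔤] [TopologicalSpace 𝔤] [LieRing 𝔥]
  [LieAlgebra ℝ 𝔥] [TopologicalSpace 𝔥]

lemma IsContinuousProjRep.comp {ρ : 𝔥 →ₗ⁅ℝ⁆ projSkewOps 𝓓} (hρ : IsContinuousProjRep ρ)
    {f : 𝔤 →ₗ⁅ℝ⁆ 𝔥} (hf : Continuous f) : IsContinuousProjRep (ρ.comp f) :=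
  fun ψ hψ => (hρ ψ hψ).comp hf

lemma IsLift.isContinuousProjRep {ρ : 𝔥 →ₗ⁅ℝ⁆ projSkewOps 𝓓} {ω : ScalarCocycle 𝔥}
    {π : LieAlgebra.ofTwoCocycle ω →ₗ⁅ℝ⁆ skewOps 𝓓} (hπ : IsLift ρ ω π) :
    IsContinuousProjRep ρ := by
  intro ψ _
  have hmk : Continuous fun ξ => centralMk ω ξ 0 :=
    isInducing_centralProd.continuous_iff.mpr (continuous_id.prodMk continuous_const)
  simp only [← hπ.covers _ 0]
  exact continuous_quot_mk.comp ((hπ.continuous_rep ψ).comp hmk)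

lemma IsContinuousProjRep.map_tmul_eq_zero {ι 𝔨 : Type*} [Finite ι] [LieRing 𝔨]
    [LieAlgebra ℝ 𝔨] [TopologicalSpace 𝔨] {ρ : JetAlg ι 𝔨 →ₗ⁅ℝ⁆ projSkewOps 𝓓}
    (hρ : IsContinuousProjRep ρ) {f : MvPowerSeries ι ℝ} {X : 𝔨}
    {W : Submodule ℝ (MvPowerSeries ι ℝ)} (hW : ∀ g ∈ W, ρ (g ⊗ₜ[ℝ] X) = 0)
    (hf : ∀ k, f ∈ W ⊔ (coordIdeal ι ℝ ^ k).restrictScalars ℝ) :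
    ρ (f ⊗ₜ[ℝ] X) = 0 := by
  refine eq_zero_of_forall_rayAction_eq_zero fun ψ hψ => ?_
  have : IsClosed ((ℂ ∙ ψ : Submodule ℂ 𝓓) : Set 𝓓) := Submodule.closed_of_finiteDimensional _
  obtain ⟨k, hk⟩ := exists_jetIdeal_map_eq_zero (G := 𝓓 ⧸ (ℂ ∙ ψ))
    ⟨rayAction ψ ∘ₗ (ρ : JetAlg ι 𝔨 →ₗ[ℝ] projSkewOps 𝓓), hρ ψ hψ⟩
  obtain ⟨g, hg, h, hh, rfl⟩ := Submodule.mem_sup.mp (hf k)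
  rw [add_tmul, map_add, hW g hg, zero_add]
  exact hk _ (tmul_mem_jetIdeal hh X)

end ProjRep

section Simple

variable {𝔨 : Type*} [LieRing 𝔨] [LieAlgebra ℝ 𝔨]

lemma exists_ne_zero_mem_of_maximal [Nontrivial 𝔨] {𝔱 : LieSubalgebra ℝ 𝔨}
    (h𝔱 : Maximal (fun s : LieSubalgebra ℝ 𝔨 => IsLieAbelian s) 𝔱) : ∃ H ∈ 𝔱, H ≠ 0 := by
  obtain ⟨X, hX⟩ := exists_ne (0 : 𝔨)
  have lie_eq_zero {x y : 𝔨} (hx : x ∈ ℝ ∙ X) (hy : y ∈ ℝ ∙ X) : ⁅x, y⁆ = 0 := by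
    obtain ⟨a, rfl⟩ := Submodule.mem_span_singleton.mp hx
    obtain ⟨b, rfl⟩ := Submodule.mem_span_singleton.mp hy
    rw [smul_lie, lie_smul, lie_self, smul_zero, smul_zero]
  let s : LieSubalgebra ℝ 𝔨 :=
    { ℝ ∙ X with lie_mem' := fun hx hy => by rw [lie_eq_zero hx hy]; exact zero_mem (ℝ ∙ X) }
  have hs : IsLieAbelian s := ⟨fun x y => Subtype.ext (lie_eq_zero x.2 y.2)⟩
  by_contra! h
  have hle : 𝔱 ≤ s := fun x hx => by rw [h x hx]; exact zero_mem s
  exact hX (h X (h𝔱.le_of_ge hs hle (Submodule.mem_span_singleton_self X)))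

variable {ι : Type*}

lemma lie_tmul_eq_zero {𝔱 : LieSubalgebra ℝ 𝔨} [IsLieAbelian 𝔱] {σ : JetAlg ι 𝔨}
    (hσ : σ ∈ LinearMap.range
      (LinearMap.lTensor (MvPowerSeries ι ℝ) 𝔱.toSubmodule.subtype)) {H : 𝔨} (hH : H ∈ 𝔱)
    (f : MvPowerSeries ι ℝ) : ⁅σ, f ⊗ₜ[ℝ] H⁆ = 0 := by
  obtain ⟨τ, rfl⟩ := hσ
  induction τ using TensorProduct.induction_on with
  | zero => exact (congrArg (⁅·, f ⊗ₜ[ℝ] H⁆) (map_zero _)).trans (zero_lie (f ⊗ₜ[ℝ] H))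
  | add a b ha hb =>
    rw [map_add]
    exact (add_lie _ _ (f ⊗ₜ[ℝ] H)).trans (by rw [ha, hb, add_zero])
  | tmul g Y =>
    have hYH : ⁅(Y : 𝔨), H⁆ = 0 := congrArg Subtype.val (trivial_lie_zero 𝔱 𝔱 Y ⟨H, hH⟩)
    rw [LinearMap.lTensor_tmul, LieAlgebra.ExtendScalars.bracket_tmul, Submodule.subtype_apply,
      hYH, tmul_zero]

variable [LieAlgebra.IsSimple ℝ 𝔨] {𝔭 : Type*} [LieRing 𝔭] [LieAlgebra ℝ 𝔭]

lemma exists_lie_ne_zero {H : 𝔨} (hH : H ≠ 0) : ∃ Y : 𝔨, ⁅Y, H⁆ ≠ 0 := by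
  by_contra! h
  have mem_center : H ∈ LieAlgebra.center ℝ 𝔨 := (LieModule.mem_maxTrivSubmodule _ _ _ H).mpr h
  rw [LieAlgebra.center_eq_bot, LieSubmodule.mem_bot] at mem_center
  exact hH mem_center

lemma map_mul_tmul_eq_zero (ρ : JetAlg ι 𝔨 →ₗ⁅ℝ⁆ 𝔭) {f : MvPowerSeries ι ℝ} {H : 𝔨} (hH : H ≠ 0)
    (hf : ρ (f ⊗ₜ[ℝ] H) = 0) (g : MvPowerSeries ι ℝ) (X : 𝔨) : ρ ((g * f) ⊗ₜ[ℝ] X) = 0 := by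
  let I : LieIdeal ℝ 𝔨 :=
    { LinearMap.ker ((ρ : JetAlg ι 𝔨 →ₗ[ℝ] 𝔭) ∘ₗ TensorProduct.mk ℝ _ 𝔨 (g * f)) with
      lie_mem := fun {Y Z} hZ => by
        change ρ ((g * f) ⊗ₜ[ℝ] ⁅Y, Z⁆) = 0
        rw [← one_mul (g * f), ← LieAlgebra.ExtendScalars.bracket_tmul, LieHom.map_lie]
        exact (congrArg _ hZ).trans (lie_zero _) }
  obtain ⟨Y, hY⟩ := exists_lie_ne_zero hH
  have lie_mem : ⁅Y, H⁆ ∈ I := by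
    change ρ ((g * f) ⊗ₜ[ℝ] ⁅Y, H⁆) = 0
    rw [← LieAlgebra.ExtendScalars.bracket_tmul, LieHom.map_lie, hf, lie_zero]
  have eq_top : I = ⊤ := (LieAlgebra.IsSimple.eq_bot_or_eq_top I).resolve_left fun h =>
    hY ((LieSubmodule.mem_bot _).mp (h ▸ lie_mem))
  exact (eq_top ▸ LieSubmodule.mem_top X : X ∈ I)

lemma jetIdeal_span_le_ker (ρ : JetAlg ι 𝔨 →ₗ⁅ℝ⁆ 𝔭) {s : Set (MvPowerSeries ι ℝ)} {H : 𝔨}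
    (hH : H ≠ 0) (hs : ∀ f ∈ s, ρ (f ⊗ₜ[ℝ] H) = 0) :
    jetIdeal 𝔨 (Ideal.span s) ≤ LinearMap.ker (ρ : JetAlg ι 𝔨 →ₗ[ℝ] 𝔭) := by
  refine jetIdeal_le.mpr fun f hf X => ?_
  suffices h : ∀ g, ρ ((g * f) ⊗ₜ[ℝ] X) = 0 by simpa using h 1
  induction hf using Submodule.span_induction with
  | mem f hf => exact fun g => map_mul_tmul_eq_zero ρ hH (hs f hf) g X
  | zero => simp
  | add f₁ f₂ _ _ h₁ h₂ => exact fun g => by rw [mul_add, add_tmul, map_add, h₁, h₂, add_zero]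
  | smul a f _ h => exact fun g => by rw [smul_eq_mul, ← mul_assoc, h]

end Simple

/-! ### Vanishing on the annihilator of the center subspace -/

section Vanishing

variable {ι : Type*} [Fintype ι] {𝔨 : Type*} [LieRing 𝔨] [LieAlgebra ℝ 𝔨]
  {v : ι → MvPowerSeries ι ℝ} {σ : JetAlg ι 𝔨} {H : 𝔨}

lemma lie_jetIncl_tmul_jetGenerator (hH : ∀ f : MvPowerSeries ι ℝ, ⁅σ, f ⊗ₜ[ℝ] H⁆ = 0)
    (f : MvPowerSeries ι ℝ) :
    ⁅jetIncl v σ (f ⊗ₜ[ℝ] H), jetGenerator v σ⁆ = jetIncl v σ (lieDer v f ⊗ₜ[ℝ] H) := by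
  rw [lie_jetIncl]
  change jetIncl v σ (⁅f ⊗ₜ[ℝ] H, 0⁆ - (1 : ℝ) • jetDerivation v σ (f ⊗ₜ[ℝ] H)) = _
  have lie_zero : ⁅f ⊗ₜ[ℝ] H, (0 : JetAlg ι 𝔨)⁆ = 0 := lie_zero (f ⊗ₜ[ℝ] H)
  rw [lie_zero, one_smul, jetDerivation_tmul, hH, add_zero, sub_neg_eq_add, zero_add]

lemma lie_jetIncl_tmul_self (f g : MvPowerSeries ι ℝ) :
    ⁅jetIncl v σ (f ⊗ₜ[ℝ] H), jetIncl v σ (g ⊗ₜ[ℝ] H)⁆ = 0 := by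
  rw [← LieHom.map_lie, LieAlgebra.ExtendScalars.bracket_tmul, lie_self, tmul_zero, map_zero]

/-- The bilinear form `(f, g) ↦ ω (f ⊗ H, g ⊗ H)` on power series. -/
noncomputable def cocycleForm (ω : ScalarCocycle (JetSharp v σ)) (H : 𝔨) :
    MvPowerSeries ι ℝ →ₗ[ℝ] MvPowerSeries ι ℝ →ₗ[ℝ] ℝ :=
  let i := (jetIncl v σ : JetAlg ι 𝔨 →ₗ[ℝ] JetSharp v σ) ∘ₗ (TensorProduct.mk ℝ _ 𝔨).flip H
  (ω.1.1.compl₁₂ i i).compr₂ (TrivialLieModule.equiv ℝ (JetSharp v σ) ℝ).toLinearMap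

lemma cocycleForm_apply (ω : ScalarCocycle (JetSharp v σ)) (H : 𝔨) (f g : MvPowerSeries ι ℝ) :
    cocycleForm ω H f g = TrivialLieModule.equiv ℝ (JetSharp v σ) ℝ
      (ω.1 (jetIncl v σ (f ⊗ₜ[ℝ] H)) (jetIncl v σ (g ⊗ₜ[ℝ] H))) := rfl

variable {ω : ScalarCocycle (JetSharp v σ)}

lemma cocycleForm_swap (f g : MvPowerSeries ι ℝ) : cocycleForm ω H f g = -cocycleForm ω H g f := by
  rw [cocycleForm_apply, cocycleForm_apply, ← LieModule.Cohomology.twoCochain_skew, map_neg]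

lemma cocycleForm_lieDer (hH : ∀ f : MvPowerSeries ι ℝ, ⁅σ, f ⊗ₜ[ℝ] H⁆ = 0)
    (f g : MvPowerSeries ι ℝ) :
    cocycleForm ω H (lieDer v f) g = -cocycleForm ω H f (lieDer v g) := by
  have h := (LieModule.Cohomology.mem_twoCocycle_iff_of_trivial _ _ _ ω.1).mp ω.2
    (jetIncl v σ (f ⊗ₜ[ℝ] H)) (jetIncl v σ (g ⊗ₜ[ℝ] H)) (jetGenerator v σ)
  rw [lie_jetIncl_tmul_self, map_zero, LinearMap.zero_apply, zero_add,
    lie_jetIncl_tmul_jetGenerator hH, lie_jetIncl_tmul_jetGenerator hH] at h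
  rw [cocycleForm_swap, cocycleForm_apply, cocycleForm_apply, h]

lemma exists_coordIdeal_pow_le_ker_cocycleForm [TopologicalSpace 𝔨] [ContinuousSMul ℝ 𝔨]
    (hω : IsContinuousCocycle ω) (H : 𝔨) :
    ∃ k, (coordIdeal ι ℝ ^ k).restrictScalars ℝ ≤ LinearMap.ker (cocycleForm ω H) := by
  obtain ⟨k, hk⟩ := exists_jetIdeal_cocycle_eq_zero hω
  refine ⟨k, fun f hf => LinearMap.mem_ker.mpr (LinearMap.ext fun g => ?_)⟩
  rw [cocycleForm_apply, hk _ (tmul_mem_jetIdeal hf H), LinearMap.zero_apply, map_zero]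
  rfl

end Vanishing

section Kernel

variable {V : Type*} [AddCommGroup V] [Module ℝ V] {ι : Type*} [Fintype ι]
  {𝔨 : Type*} [LieRing 𝔨] [LieAlgebra ℝ 𝔨] [TopologicalSpace 𝔨] [T2Space 𝔨]
  [IsTopologicalAddGroup 𝔨] [ContinuousSMul ℝ 𝔨] [Module.Finite ℝ 𝔨]
  {v : ι → MvPowerSeries ι ℝ} {σ : JetAlg ι 𝔨} {H : 𝔨}
  {𝓓 : Type*} [NormedAddCommGroup 𝓓] [InnerProductSpace ℂ 𝓓]
  {πbar : JetSharp v σ →ₗ⁅ℝ⁆ projSkewOps 𝓓}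

lemma IsLift.map_lieDer_tmul_eq_zero (hv : ∀ i, v i ∈ coordIdeal ι ℝ)
    (hH : ∀ f : MvPowerSeries ι ℝ, ⁅σ, f ⊗ₜ[ℝ] H⁆ = 0) {ω : ScalarCocycle (JetSharp v σ)}
    {π : LieAlgebra.ofTwoCocycle ω →ₗ⁅ℝ⁆ skewOps 𝓓} (hπ : IsLift πbar ω π) {z : ℝ}
    (hgpe : IsGPE.{_, _, w} π (centralMk ω (jetGenerator v σ) z)) {g : MvPowerSeries ι ℝ}
    (hg : cocycleForm ω H g (lieDer v g) = 0) :
    πbar (jetIncl v σ (lieDer v g ⊗ₜ[ℝ] H)) = 0 := by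
  have := locallyConvexSpace_of_finiteDimensional 𝔨
  let x := centralMk ω (jetIncl v σ (g ⊗ₜ[ℝ] H)) 0
  obtain ⟨c, hxy⟩ : ∃ c, ⁅x, centralMk ω (jetGenerator v σ) z⁆ =
      centralMk ω (jetIncl v σ (lieDer v g ⊗ₜ[ℝ] H)) c :=
    ⟨_, by rw [lie_centralMk, lie_jetIncl_tmul_jetGenerator hH]⟩
  have hxxy : ⁅x, ⁅x, centralMk ω (jetGenerator v σ) z⁆⁆ = 0 := by
    rw [hxy, lie_centralMk, lie_jetIncl_tmul_self, ← cocycleForm_apply, hg]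
    rfl
  rw [← hπ.covers _ c, ← hxy,
    IsGPE.map_lie_eq_zero (hasFiniteFactor_central hv hπ.continuous_cocycle) hπ.continuous_rep hgpe
      hxxy]
  rfl

lemma jetIdeal_annihilatorIdeal_le_ker [DecidableEq ι] [LieAlgebra.IsSimple ℝ 𝔨]
    (b : Module.Basis ι ℝ V) (hv : ∀ i, MvPowerSeries.constantCoeff (v i) = 0)
    (hH : ∀ f : MvPowerSeries ι ℝ, ⁅σ, f ⊗ₜ[ℝ] H⁆ = 0) (hH0 : H ≠ 0) {S N : Module.End ℝ V}
    (h : linearPart b v = S + N) (hSN : Commute S N) (hN : IsNilpotent N)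
    (hS : ⁅lieDer (linearField b S), lieDer (higherOrderPart b v)⁆ = 0)
    (hgpe : IsProjGPE.{_, _, w} πbar (jetGenerator v σ)) :
    jetIdeal 𝔨 (annihilatorIdeal b (centerSpace (linearPart b v))) ≤
      LinearMap.ker (πbar.comp (jetIncl v σ) : JetAlg ι 𝔨 →ₗ[ℝ] projSkewOps 𝓓) := by
  obtain ⟨ω, π, z, hπ, hg⟩ := hgpe
  refine jetIdeal_span_le_ker _ hH0 ?_
  rintro _ ⟨φ, hφ, rfl⟩
  have hcont := hπ.isContinuousProjRep.comp (continuous_jetIncl (v := v) (σ := σ))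
  obtain ⟨m, hm⟩ := exists_coordIdeal_pow_le_ker_cocycleForm hπ.continuous_cocycle H
  have hm' : (coordIdeal ι ℝ ^ m).restrictScalars ℝ ≤ LinearMap.ker (cocycleForm ω H).flip :=
    fun f hf => LinearMap.ext fun g => by
      rw [LinearMap.flip_apply, cocycleForm_swap, LinearMap.mem_ker.mp (hm hf)]
      exact neg_zero
  refine hcont.map_tmul_eq_zero (fun f hf => ?_)
    (linearSeries_mem_span_lieDer_sup b hv h hSN hN hS (cocycleForm_lieDer hH) hm hm' hφ)
  induction hf using Submodule.span_induction with
  | mem f hf =>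
    obtain ⟨g, hg₀, rfl⟩ := hf
    exact hπ.map_lieDer_tmul_eq_zero (fun i => mem_coordIdeal.mpr (hv i)) hH hg hg₀
  | zero => rw [zero_tmul, map_zero]
  | add f₁ f₂ _ _ h₁ h₂ => rw [add_tmul, map_add, h₁, h₂, add_zero]
  | smul a f _ h => rw [← smul_tmul', map_smul, h, smul_zero]

end Kernel

/-! ### Restriction to a subspace -/

section AlgHom

variable {ι κ R : Type*} [CommRing R]

lemma coordIdeal_pow_le_comap {θ : MvPowerSeries ι R →ₐ[R] MvPowerSeries κ R}
    (hθ : ∀ i, θ (MvPowerSeries.X i) ∈ coordIdeal κ R) (k : ℕ) :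
    coordIdeal ι R ^ k ≤ (coordIdeal κ R ^ k).comap θ := by
  have hle : (coordIdeal ι R).map θ ≤ coordIdeal κ R := by
    rw [coordIdeal, Ideal.map_le_iff_le_comap, Ideal.span_le]
    rintro _ ⟨i, rfl⟩
    exact hθ i
  rw [← Ideal.map_le_iff_le_comap, Ideal.map_pow]
  exact Ideal.pow_right_mono hle k

lemma sub_truncTotal_mem_coordIdeal_pow [Finite ι] (k : ℕ) (f : MvPowerSeries ι R) :
    f - (f.truncTotal k : MvPowerSeries ι R) ∈ coordIdeal ι R ^ k := by
  refine mem_coordIdeal_pow.mpr (MvPowerSeries.nat_le_order fun d hd => ?_)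
  rw [map_sub, MvPolynomial.coeff_coe, MvPowerSeries.coeff_truncTotal f hd, sub_self]

lemma sub_map_mem_of_forall_X {θ : MvPowerSeries ι R →ₐ[R] MvPowerSeries ι R}
    {I : Ideal (MvPowerSeries ι R)}
    (hθ : ∀ i, MvPowerSeries.X i - θ (MvPowerSeries.X i) ∈ I) (p : MvPolynomial ι R) :
    (p : MvPowerSeries ι R) - θ p ∈ I := by
  let incl := MvPolynomial.coeToMvPowerSeries.algHom (σ := ι) (R := R) R
  let q := Ideal.Quotient.mkₐ R I
  have h : q.comp incl = (q.comp θ).comp incl :=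
    MvPolynomial.algHom_ext fun i => by simpa [q, incl] using Ideal.Quotient.eq.mpr (hθ i)
  have := congrArg (fun F : MvPolynomial ι R →ₐ[R] _ => F p) h
  exact Ideal.Quotient.eq.mp (by simpa [q, incl] using this)

lemma sub_map_mem_sup_coordIdeal_pow [Finite ι]
    {θ : MvPowerSeries ι R →ₐ[R] MvPowerSeries ι R} {I : Ideal (MvPowerSeries ι R)}
    (hθ : ∀ i, θ (MvPowerSeries.X i) ∈ coordIdeal ι R)
    (hθI : ∀ i, MvPowerSeries.X i - θ (MvPowerSeries.X i) ∈ I) (f : MvPowerSeries ι R) (k : ℕ) :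
    f - θ f ∈ I ⊔ coordIdeal ι R ^ k := by
  have hf := sub_truncTotal_mem_coordIdeal_pow k f
  have hsub : f - θ f = ((f.truncTotal k : MvPowerSeries ι R) - θ (f.truncTotal k)) +
      ((f - f.truncTotal k) - θ (f - f.truncTotal k)) := by
    rw [map_sub]
    ring
  rw [hsub]
  exact Submodule.add_mem_sup (sub_map_mem_of_forall_X hθI _)
    (sub_mem hf (coordIdeal_pow_le_comap hθ k hf))

end AlgHom

section Continuity

variable {ι κ 𝔨 : Type*} [Finite ι] [Finite κ] [LieRing 𝔨] [LieAlgebra ℝ 𝔨] [TopologicalSpace 𝔨]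
  [IsTopologicalAddGroup 𝔨] [ContinuousSMul ℝ 𝔨] [T2Space 𝔨] [Module.Finite ℝ 𝔨]

lemma continuous_of_jetIdeal_le_ker {E : Type*} [AddCommGroup E] [Module ℝ E] [TopologicalSpace E]
    [IsTopologicalAddGroup E] [ContinuousSMul ℝ E] {k : ℕ} {f : JetAlg ι 𝔨 →ₗ[ℝ] E}
    (hf : jetIdeal 𝔨 (coordIdeal ι ℝ ^ k) ≤ LinearMap.ker f) : Continuous f := by
  have : Finite {n : ι →₀ ℕ | n.degree < k} := Finsupp.finite_of_degree_lt _
  let t : JetAlg ι 𝔨 →ₗ[ℝ] _ := (jetTrunc k).toLinearMap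
  obtain ⟨s, hs⟩ := t.rangeRestrict.exists_rightInverse_of_surjective t.range_rangeRestrict
  have factor (ξ : JetAlg ι 𝔨) : (f ∘ₗ s) (t.rangeRestrict ξ) = f ξ := by
    rw [LinearMap.comp_apply, ← sub_eq_zero, ← map_sub]
    refine hf (jetTrunc_eq_zero.mp ?_)
    have := congrArg Subtype.val (LinearMap.congr_fun hs (t.rangeRestrict ξ))
    exact (map_sub t _ _).trans (sub_eq_zero.mpr this)
  exact ((f ∘ₗ s).continuous_of_finiteDimensional.comp
    ((jetTrunc k).continuous.subtype_mk _)).congr factor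

lemma continuous_map_jet {θ : MvPowerSeries ι ℝ →ₐ[ℝ] MvPowerSeries κ ℝ}
    (hθ : ∀ i, θ (MvPowerSeries.X i) ∈ coordIdeal κ ℝ) :
    Continuous (LieAlgebra.ExtendScalars.map θ LieHom.id : JetAlg ι 𝔨 →ₗ⁅ℝ⁆ JetAlg κ 𝔨) := by
  let T : JetAlg ι 𝔨 →ₗ[ℝ] JetAlg κ 𝔨 :=
    (LieAlgebra.ExtendScalars.map θ LieHom.id : JetAlg ι 𝔨 →ₗ⁅ℝ⁆ JetAlg κ 𝔨)
  refine isInducing_jetCoeff.continuous_iff.mpr (continuous_pi fun n => ?_)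
  refine continuous_of_jetIdeal_le_ker (f := jetCoeff n ∘ₗ T) (k := n.degree + 1)
    (jetIdeal_le.mpr fun f hf X => ?_)
  have hθf : θ f ∈ coordIdeal κ ℝ ^ (n.degree + 1) := coordIdeal_pow_le_comap hθ _ hf
  change jetCoeff n (θ f ⊗ₜ[ℝ] X) = 0
  exact mem_jetIdeal_coordIdeal_pow.mp (tmul_mem_jetIdeal hθf X) n (Nat.lt_succ_self _)

end Continuity

section Restriction

variable {V : Type*} [AddCommGroup V] [Module ℝ V] {ι κ : Type*} [Fintype ι] [Fintype κ]
  (b : Module.Basis ι ℝ V) {W : Submodule ℝ V} (c : Module.Basis κ ℝ W)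

lemma coordIdeal_le_annihilatorIdeal_bot : coordIdeal ι ℝ ≤ annihilatorIdeal b ⊥ := by
  refine Ideal.span_le.mpr ?_
  rintro _ ⟨i, rfl⟩
  exact Ideal.subset_span ⟨b.coord i, by simp, linearSeries_coord b i⟩

lemma restrictSeries_X (i : ι) :
    restrictSeries b c (MvPowerSeries.X i) = linearSeries c (b.coord i ∘ₗ W.subtype) :=
  MvPowerSeries.substAlgHom_X _ i

/-- Pullback of formal power series from `W` to `V` along a linear map `P : V → W`. -/
noncomputable def pullbackSeries (P : V →ₗ[ℝ] W) : MvPowerSeries κ ℝ →ₐ[ℝ] MvPowerSeries ι ℝ :=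
  MvPowerSeries.substAlgHom (a := fun j => linearSeries b (c.coord j ∘ₗ P))
    (MvPowerSeries.hasSubst_of_constantCoeff_zero fun _ =>
      mem_coordIdeal.mp (linearSeries_mem_coordIdeal _ _))

lemma pullbackSeries_X (P : V →ₗ[ℝ] W) (j : κ) :
    pullbackSeries b c P (MvPowerSeries.X j) = linearSeries b (c.coord j ∘ₗ P) :=
  MvPowerSeries.substAlgHom_X _ j

lemma pullbackSeries_linearSeries (P : V →ₗ[ℝ] W) (φ : Module.Dual ℝ W) :
    pullbackSeries b c P (linearSeries c φ) = linearSeries b (φ ∘ₗ P) := by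
  suffices h : (pullbackSeries b c P).toLinearMap ∘ₗ linearSeries c =
      linearSeries b ∘ₗ P.dualMap from LinearMap.congr_fun h φ
  classical
  refine c.dualBasis.ext fun j => ?_
  change pullbackSeries b c P (linearSeries c (c.dualBasis j)) =
    linearSeries b (P.dualMap (c.dualBasis j))
  rw [c.coe_dualBasis, linearSeries_coord, pullbackSeries_X]
  rfl

lemma X_sub_pullbackSeries_restrictSeries_mem {P : V →ₗ[ℝ] W} (hP : P ∘ₗ W.subtype = LinearMap.id)
    (i : ι) :
    MvPowerSeries.X i - pullbackSeries b c P (restrictSeries b c (MvPowerSeries.X i)) ∈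
      annihilatorIdeal b W := by
  rw [restrictSeries_X, pullbackSeries_linearSeries, ← linearSeries_coord b, ← map_sub]
  refine Ideal.subset_span ⟨_, (Submodule.mem_dualAnnihilator _).mpr fun x hx => ?_, rfl⟩
  have hPx : P x = ⟨x, hx⟩ := LinearMap.congr_fun hP ⟨x, hx⟩
  rw [LinearMap.sub_apply, LinearMap.comp_apply, LinearMap.comp_apply, hPx]
  exact sub_self _

end Restriction

section Factorization

variable {V : Type*} [AddCommGroup V] [Module ℝ V] {ι κ : Type*} [Fintype ι] [Fintype κ]
  (b : Module.Basis ι ℝ V) {W : Submodule ℝ V} (c : Module.Basis κ ℝ W)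
  {𝔨 : Type*} [LieRing 𝔨] [LieAlgebra ℝ 𝔨] [TopologicalSpace 𝔨] [IsTopologicalAddGroup 𝔨]
  [ContinuousSMul ℝ 𝔨] [T2Space 𝔨] [Module.Finite ℝ 𝔨]
  {𝓓 : Type*} [NormedAddCommGroup 𝓓] [InnerProductSpace ℂ 𝓓] {ρ : JetAlg ι 𝔨 →ₗ⁅ℝ⁆ projSkewOps 𝓓}

lemma IsContinuousProjRep.exists_comp_restrictJet (hρ : IsContinuousProjRep ρ)
    (hW : jetIdeal 𝔨 (annihilatorIdeal b W) ≤ LinearMap.ker (ρ : JetAlg ι 𝔨 →ₗ[ℝ] projSkewOps 𝓓)) :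
    ∃ ρ' : JetAlg κ 𝔨 →ₗ⁅ℝ⁆ projSkewOps 𝓓, IsContinuousProjRep ρ' ∧
      ∀ ξ, ρ ξ = ρ' (restrictJet b c 𝔨 ξ) := by
  obtain ⟨P, hP⟩ := W.subtype.exists_leftInverse_of_injective W.ker_subtype
  have pullback_X (j : κ) : pullbackSeries b c P (MvPowerSeries.X j) ∈ coordIdeal ι ℝ := by
    rw [pullbackSeries_X]
    exact linearSeries_mem_coordIdeal _ _
  let θ := (pullbackSeries b c P).comp (restrictSeries b c)
  have θ_X (i : ι) : θ (MvPowerSeries.X i) ∈ coordIdeal ι ℝ := by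
    rw [AlgHom.comp_apply, restrictSeries_X, pullbackSeries_linearSeries]
    exact linearSeries_mem_coordIdeal _ _
  refine ⟨ρ.comp (LieAlgebra.ExtendScalars.map (pullbackSeries b c P) LieHom.id),
    hρ.comp (continuous_map_jet pullback_X), fun ξ => ?_⟩
  induction ξ using TensorProduct.induction_on with
  | zero => simp only [map_zero]
  | add x y hx hy => simp only [map_add, hx, hy]
  | tmul f X =>
    change ρ (f ⊗ₜ[ℝ] X) = ρ (θ f ⊗ₜ[ℝ] X)
    rw [← sub_eq_zero, ← map_sub, ← sub_tmul]
    exact hρ.map_tmul_eq_zero (W := (annihilatorIdeal b W).restrictScalars ℝ)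
      (fun g hg => hW (tmul_mem_jetIdeal hg X))
      fun k => by
        rw [← Submodule.restrictScalars_sup]
        exact sub_map_mem_sup_coordIdeal_pow θ_X
          (X_sub_pullbackSeries_restrictSeries_mem b c hP) f k

end Factorization

section Evaluation

/-- The inclusion of `𝔨` in `R ⊗ 𝔨` as the constant power series. -/
noncomputable def jetConst (ι 𝔨 : Type*) [LieRing 𝔨] [LieAlgebra ℝ 𝔨] : 𝔨 →ₗ⁅ℝ⁆ JetAlg ι 𝔨 :=
  { TensorProduct.mk ℝ (MvPowerSeries ι ℝ) 𝔨 1 with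
    map_lie' := fun {X Y} => by
      change 1 ⊗ₜ[ℝ] ⁅X, Y⁆ = ⁅1 ⊗ₜ[ℝ] X, 1 ⊗ₜ[ℝ] Y⁆
      rw [LieAlgebra.ExtendScalars.bracket_tmul, one_mul] }

variable {ι 𝔨 : Type*} [Finite ι] [LieRing 𝔨] [LieAlgebra ℝ 𝔨]

lemma sub_jetConst_jetEval_mem (ξ : JetAlg ι 𝔨) :
    ξ - jetConst ι 𝔨 (jetEval ξ) ∈ jetIdeal 𝔨 (coordIdeal ι ℝ) := by
  rw [← pow_one (coordIdeal ι ℝ), mem_jetIdeal_coordIdeal_pow]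
  intro n hn
  obtain rfl : n = 0 := (Finsupp.degree_eq_zero_iff n).mp (Nat.lt_one_iff.mp hn)
  rw [map_sub, sub_eq_zero]
  have h : jetCoeff 0 (jetConst ι 𝔨 (jetEval ξ)) = jetEval ξ :=
    (jetCoeff_tmul 0 1 _).trans (by rw [MvPowerSeries.coeff_zero_one, one_smul])
  exact h.symm

variable [TopologicalSpace 𝔨] [IsTopologicalAddGroup 𝔨] [ContinuousSMul ℝ 𝔨] [T2Space 𝔨]
  [Module.Finite ℝ 𝔨]

lemma IsContinuousProjRep.exists_comp_jetEval {𝓓 : Type*} [NormedAddCommGroup 𝓓]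
    [InnerProductSpace ℂ 𝓓] {ρ : JetAlg ι 𝔨 →ₗ⁅ℝ⁆ projSkewOps 𝓓} (hρ : IsContinuousProjRep ρ)
    (h : jetIdeal 𝔨 (coordIdeal ι ℝ) ≤ LinearMap.ker (ρ : JetAlg ι 𝔨 →ₗ[ℝ] projSkewOps 𝓓)) :
    ∃ π₀ : 𝔨 →ₗ⁅ℝ⁆ projSkewOps 𝓓, IsContinuousProjRep π₀ ∧ ∀ ξ, ρ ξ = π₀ (jetEval ξ) :=
  ⟨ρ.comp (jetConst ι 𝔨),
    hρ.comp (jetConst ι 𝔨 : 𝔨 →ₗ[ℝ] JetAlg ι 𝔨).continuous_of_finiteDimensional, fun ξ =>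
    sub_eq_zero.mp ((map_sub ρ _ _).symm.trans (h (sub_jetConst_jetEval_mem ξ)))⟩

end Evaluation

end JetGPE

theorem mainTheorem6_general
    {V : Type*} [AddCommGroup V] [Module ℝ V] {ι : Type*} [Fintype ι] [DecidableEq ι]
    (b : Module.Basis ι ℝ V)
    {𝔨 : Type*} [LieRing 𝔨] [LieAlgebra ℝ 𝔨] [TopologicalSpace 𝔨] [T2Space 𝔨]
    [IsTopologicalAddGroup 𝔨] [ContinuousSMul ℝ 𝔨] [Module.Finite ℝ 𝔨] [LieAlgebra.IsSimple ℝ 𝔨]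
    {v : ι → MvPowerSeries ι ℝ} (hv : ∀ i, MvPowerSeries.constantCoeff (v i) = 0)
    {σ : JetGPE.JetAlg ι 𝔨} {H : 𝔨} (hH₀ : H ≠ 0)
    (hH : ∀ f : MvPowerSeries ι ℝ, ⁅σ, f ⊗ₜ[ℝ] H⁆ = 0)
    {S N : Module.End ℝ V} (hadd : JetGPE.linearPart b v = S + N) (hSN : Commute S N)
    (hN : IsNilpotent N)
    (hcomm : ⁅JetGPE.lieDer (JetGPE.linearField b S),
      JetGPE.lieDer (JetGPE.higherOrderPart b v)⁆ = 0)
    {𝓓 : Type*} [NormedAddCommGroup 𝓓] [InnerProductSpace ℂ 𝓓]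
    {πbar : JetGPE.JetSharp v σ →ₗ⁅ℝ⁆ JetGPE.projSkewOps 𝓓}
    (hgpe : JetGPE.IsProjGPE.{_, _, w} πbar (JetGPE.jetGenerator v σ)) :
    (∀ f ∈ JetGPE.annihilatorIdeal b (JetGPE.centerSpace (JetGPE.linearPart b v)), ∀ X : 𝔨,
      πbar (JetGPE.jetIncl v σ (f ⊗ₜ[ℝ] X)) = 0) ∧
    (∀ {κ : Type*} [Fintype κ]
      (c : Module.Basis κ ℝ (JetGPE.centerSpace (JetGPE.linearPart b v))),
      ∃ πc : JetGPE.JetAlg κ 𝔨 →ₗ⁅ℝ⁆ JetGPE.projSkewOps 𝓓,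
        JetGPE.IsContinuousProjRep πc ∧
        ∀ ξ : JetGPE.JetAlg ι 𝔨,
          πbar (JetGPE.jetIncl v σ ξ) = πc (JetGPE.restrictJet b c 𝔨 ξ)) ∧
    (JetGPE.centerSpace (JetGPE.linearPart b v) = ⊥ →
      ∃ π₀ : 𝔨 →ₗ⁅ℝ⁆ JetGPE.projSkewOps 𝓓,
        JetGPE.IsContinuousProjRep π₀ ∧
        ∀ ξ : JetGPE.JetAlg ι 𝔨,
          πbar (JetGPE.jetIncl v σ ξ) = π₀ (JetGPE.jetEval ξ)) := by
  have hker := JetGPE.jetIdeal_annihilatorIdeal_le_ker b hv hH hH₀ hadd hSN hN hcomm hgpe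
  obtain ⟨ω, π, z, hπ, _⟩ := hgpe
  have hρ := hπ.isContinuousProjRep.comp (JetGPE.continuous_jetIncl (v := v) (σ := σ))
  refine ⟨fun f hf X => hker (JetGPE.tmul_mem_jetIdeal hf X), fun c =>
    hρ.exists_comp_restrictJet b c hker, fun hbot => hρ.exists_comp_jetEval ?_⟩
  exact (JetGPE.jetIdeal_mono (JetGPE.coordIdeal_le_annihilatorIdeal_bot b)).trans (hbot ▸ hker)

theorem mainTheorem6
    {V : Type*} [AddCommGroup V] [Module ℝ V] {n : ℕ} (b : Module.Basis (Fin n) ℝ V)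
    {𝔨 : Type*} [LieRing 𝔨] [LieAlgebra ℝ 𝔨] [TopologicalSpace 𝔨] [T2Space 𝔨]
    [IsTopologicalAddGroup 𝔨] [ContinuousSMul ℝ 𝔨] (h𝔨 : JetGPE.IsCompactSimple 𝔨)
    -- a formal vector field `v` vanishing at the origin and a vertical twist `σ`
    (v : Fin n → MvPowerSeries (Fin n) ℝ) (hv : ∀ i, MvPowerSeries.constantCoeff (v i) = 0)
    (σ : JetGPE.JetAlg (Fin n) 𝔨)
    -- `σ ∈ R ⊗ 𝔱` for a maximal abelian subalgebra `𝔱`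
    (𝔱 : LieSubalgebra ℝ 𝔨) (h𝔱 : Maximal (fun s : LieSubalgebra ℝ 𝔨 => IsLieAbelian s) 𝔱)
    (hσ : σ ∈ LinearMap.range
      (LinearMap.lTensor (MvPowerSeries (Fin n) ℝ) 𝔱.toSubmodule.subtype))
    -- the semisimple part of the linearization of `v` commutes with the higher order part of `v`
    (S N : Module.End ℝ V) (hSN : JetGPE.IsJordanDecomposition (JetGPE.linearPart b v) S N)
    (hcomm : ⁅JetGPE.lieDer (JetGPE.linearField b S),
      JetGPE.lieDer (JetGPE.higherOrderPart b v)⁆ = 0)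
    -- a continuous projective unitary representation of generalized positive energy at `d`
    {𝓓 : Type*} [NormedAddCommGroup 𝓓] [InnerProductSpace ℂ 𝓓]
    (πbar : JetGPE.JetSharp v σ →ₗ⁅ℝ⁆ JetGPE.projSkewOps 𝓓)
    (hcont : JetGPE.IsContinuousProjRep πbar)
    (hgpe : JetGPE.IsProjGPE.{_, _, w} πbar (JetGPE.jetGenerator v σ)) :
    (∀ f ∈ JetGPE.annihilatorIdeal b (JetGPE.centerSpace (JetGPE.linearPart b v)), ∀ X : 𝔨,
      πbar (JetGPE.jetIncl v σ (f ⊗ₜ[ℝ] X)) = 0) ∧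
    (∀ (m : ℕ) (c : Module.Basis (Fin m) ℝ (JetGPE.centerSpace (JetGPE.linearPart b v))),
      ∃ πc : JetGPE.JetAlg (Fin m) 𝔨 →ₗ⁅ℝ⁆ JetGPE.projSkewOps 𝓓,
        JetGPE.IsContinuousProjRep πc ∧
        ∀ ξ : JetGPE.JetAlg (Fin n) 𝔨,
          πbar (JetGPE.jetIncl v σ ξ) = πc (JetGPE.restrictJet b c 𝔨 ξ)) ∧
    (JetGPE.centerSpace (JetGPE.linearPart b v) = ⊥ →
      ∃ π₀ : 𝔨 →ₗ⁅ℝ⁆ JetGPE.projSkewOps 𝓓,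
        JetGPE.IsContinuousProjRep π₀ ∧
        ∀ ξ : JetGPE.JetAlg (Fin n) 𝔨,
          πbar (JetGPE.jetIncl v σ ξ) = π₀ (JetGPE.jetEval ξ)) := by
  have := h𝔨.finite
  have := h𝔨.simple
  have := LieAlgebra.IsSimple.nontrivial ℝ 𝔨
  obtain ⟨H, hHt, hH₀⟩ := JetGPE.exists_ne_zero_mem_of_maximal h𝔱
  have : IsLieAbelian 𝔱 := h𝔱.prop
  obtain ⟨hker, hrestrict, heval⟩ := mainTheorem6_general b hv hH₀ (JetGPE.lie_tmul_eq_zero hσ hHt)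
    hSN.eq_add hSN.commute hSN.nilpotent hcomm hgpe
  exact ⟨hker, fun _ => hrestrict, heval⟩
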